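/- \textbf{Setting.} Let $\mathbb H$ be the open upper half plane, $\mathbb D$ the open unit disc and $\Psi(z)=(z-i)/(z+i)$, which maps $\mathbb H$ onto $\mathbb D$. For $r,R,\eta>0$ let $\mathcal D(r,R,\eta)$ be the collection of all quadruplets $(D,a,b,p)$ such that $D\subset R\,\mathbb D$ is a simply connected domain, $a\ne b$ are prime ends of $D$, $p=\phi^{-1}(i)$ for some conformal map $\phi:D\to\mathbb H$ with $\phi(a)=0$, $\phi(b)=\infty$ (such a $\phi$ is determined by $a,b,p$), $\mathrm{rad}_p(D):=\inf\{|z-p|:z\notin D\}\ge r$, and, with $\psi:=\Psi\circ\phi:D\to\mathbb D$, the inverse $\psi^{-1}$ has an analytic extension to $\{z\in\mathbb C:|z-1|<\eta\}$. Given $(D,a,b,p)\in\mathcal D(r,R,\eta)$ with its map $\phi$, let $\gamma:(0,S)\to D$, $0<S\le\infty$, be a simple curve with $\gamma(0+)=a$, $\gamma(S-)=b$. For $0\le t<S$ let $g_t:\mathbb H\setminus\phi(\gamma(0,t])\to\mathbb H$ be the conformal map with $g_t(z)-z\to0$ as $z\to\infty$, and suppose that $\gamma$ is parametrized by half-plane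 capacity, i.e. $\lim_{z\to\infty}z(g_t(z)-z)=2t$. Put $D(t)=D\setminus\gamma(0,t]$ and $\phi_t=g_t\circ\phi$, let $U(t)=\phi_t(\gamma(t))\in\mathbb R$ be the driving function (the boundary value of $\phi_t$ at the prime end $\gamma(t)$ of $D(t)$, where for $t>0$ this is the tip of the slit and $\gamma(0)=a$), and let $p(t)\in D(t)$ be the point with $\phi_t(p(t))=U(t)+i$. For $T>1$ and $\varepsilon>0$ put $$\tilde T=\sup\bigl\{t\in[0,T]:\ t<S,\ |U(s)|<1/\varepsilon\ \text{for all}\ s\in[0,t]\bigr\}.$$ \textbf{Lemma.} Fix $r,R,\eta>0$. For all $T>1$ and $\varepsilon>0$ there exist $r_1>0$ and $\eta_1>0$, depending only on $T,\varepsilon$ and the fixed constants $r,R,\eta$, such that for every $(D,a,b,p)\in\mathcal D(r,R,\eta)$ and every curve $\gamma$ as above, $$(D(t),\gamma(t),b,p(t))\in\mathcal D(r_1,R,\eta_1)\qquad\text{for all }0\le t<\tilde T.$$ In particular, with $\psi_t:=\Psi\circ(\phi_t-U(t)):D(t)\to\mathbb D$, the inverse $\psi_t^{-1}$ has an analytic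 extension to $\{z:|z-1|<\eta_1\}$ for all $0\le t<\tilde T$. -/

import Mathlib

open Set Filter Topology Metric

noncomputable section

/-- The upper half plane `ℍ`, as a subset of `ℂ`. -/
def halfPlane : Set ℂ := {z | 0 < z.im}

/-- The unit disc `𝔻`. -/
def unitDisc : Set ℂ := ball 0 1

/-- `f` is a conformal map of `D` onto `D'`: a holomorphic bijection. -/
def ConformalBijOn (f : ℂ → ℂ) (D D' : Set ℂ) : Prop :=
  DifferentiableOn ℂ f D ∧ BijOn f D D'

/-- Prime ends of a simply connected domain `D ⊊ ℂ`, i.e. the points that the Carathéodory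
compactification of `D` adds to `D`. A Riemann map `𝔻 → D` extends to a homeomorphism of the closed
disc onto this compactification, so the added points are the images of the points `ζ` of the unit
circle. A prime end is represented by the trace on `D` of its neighbourhood filter, and a function
`φ` on `D` has the value `x` at the prime end `a` when `Tendsto φ a (𝓝 x)` (the value `∞` when
`Tendsto φ a (cocompact ℂ)`). -/
def IsPrimeEnd (D : Set ℂ) (a : Filter ℂ) : Prop :=
  ∃ (f : ℂ → ℂ) (ζ : ℂ), ConformalBijOn f unitDisc D ∧ ‖ζ‖ = 1 ∧ a = map f (𝓝[unitDisc] ζ)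

/-- The inner radius `rad_p(D) = inf {|z - p| : z ∉ D}`. -/
def innerRadius (p : ℂ) (D : Set ℂ) : ℝ := infDist p Dᶜ

/-- `Ψ(z) = (z - i) / (z + i)`, which maps `ℍ` onto `𝔻`. -/
def cayley (z : ℂ) : ℂ := (z - Complex.I) / (z + Complex.I)

/-- `φ : D → ℍ` is a conformal map with `φ(a) = 0` and `φ(b) = ∞`. -/
def IsChordalMap (D : Set ℂ) (a b : Filter ℂ) (φ : ℂ → ℂ) : Prop :=
  ConformalBijOn φ D halfPlane ∧ Tendsto φ a (𝓝 0) ∧ Tendsto φ b (cocompact ℂ)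

/-- The collection `𝒟(r, R, η)` of quadruplets `(D, a, b, p)`: `D` is a simply connected domain,
`a` and `b` are distinct prime ends of `D`, `p = φ⁻¹(i)` for a conformal map `φ : D → ℍ` with
`φ(a) = 0` and `φ(b) = ∞`, `rad_p(D) ≥ r`, `D ⊆ R𝔻`, and the inverse of `ψ = Ψ ∘ φ` extends
analytically to `{z : |z - 1| < η}`. -/
def quadClass (r R η : ℝ) : Set (Set ℂ × Filter ℂ × Filter ℂ × ℂ) :=
  {(D, a, b, p) | IsOpen D ∧ IsSimplyConnected D ∧ IsPrimeEnd D a ∧ IsPrimeEnd D b ∧ a ≠ b ∧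
    p ∈ D ∧ r ≤ innerRadius p D ∧ D ⊆ ball 0 R ∧
    ∃ φ : ℂ → ℂ, IsChordalMap D a b φ ∧ φ p = Complex.I ∧
      ∃ F : ℂ → ℂ, AnalyticOnNhd ℂ F (ball 1 η) ∧
        ∀ z ∈ D, cayley (φ z) ∈ ball 1 η → F (cayley (φ z)) = z}

/-- `γ : (0, S) → D` is a simple curve connecting the prime ends `a` and `b`, so that `γ(0+) = a`
and `γ(S-) = b`; the lifetime `S` may be `∞`. -/
structure IsSimpleCurve (D : Set ℂ) (a b : Filter ℂ) (S : EReal) (γ : ℝ → ℂ) : Prop where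
  lifetime_pos : 0 < S
  continuousOn : ContinuousOn γ {t : ℝ | 0 < t ∧ (t : EReal) < S}
  injOn : InjOn γ {t : ℝ | 0 < t ∧ (t : EReal) < S}
  mapsTo : MapsTo γ {t : ℝ | 0 < t ∧ (t : EReal) < S} D
  tendsto_start : Tendsto γ (𝓝[>] 0) a
  tendsto_end : Tendsto γ (comap (fun t : ℝ ↦ (t : EReal)) (𝓝[<] S)) b

/-- `D(t) = D \ γ(0, t]`. -/
def slitDomain (D : Set ℂ) (γ : ℝ → ℂ) (t : ℝ) : Set ℂ := D \ γ '' Ioc 0 t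

/-- The boundary point `γ(t)` of `D(t)`, as a prime end. For `t = 0` it is the starting prime end
`a` of the curve. For `t > 0` it is the tip of the slit; as `γ` is simple, only one prime end of
`D(t)` lies over the tip, and its neighbourhoods are those of `γ(t)` in the plane. -/
def tip (D : Set ℂ) (a : Filter ℂ) (γ : ℝ → ℂ) (t : ℝ) : Filter ℂ :=
  if t = 0 then a else 𝓝[slitDomain D γ t] (γ t)

/-- `z → ∞` within `ℍ \ K`. -/
def atInfinity (K : Set ℂ) : Filter ℂ := cocompact ℂ ⊓ 𝓟 (halfPlane \ K)

/-- `g` is the conformal map `g_K : ℍ \ K → ℍ` with `g(z) - z → 0` as `z → ∞`. -/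
def IsMappingOut (K : Set ℂ) (g : ℂ → ℂ) : Prop :=
  ConformalBijOn g (halfPlane \ K) halfPlane ∧ Tendsto (fun z ↦ g z - z) (atInfinity K) (𝓝 0)

/-- `(g_t)` is the chordal Loewner chain generated by the curve `φ ∘ γ` in `ℍ`, where `γ` is
parametrized so that `hcap (φ ∘ γ (0, t]) = lim z (g_t(z) - z) = 2 t`, and `U` is its driving
function, `U(t) = φ_t(γ(t))` with `φ_t = g_t ∘ φ`. -/
structure IsLoewnerChain (D : Set ℂ) (a : Filter ℂ) (φ : ℂ → ℂ) (S : EReal) (γ : ℝ → ℂ)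
    (g : ℝ → ℂ → ℂ) (U : ℝ → ℝ) : Prop where
  mappingOut : ∀ t : ℝ, 0 ≤ t → (t : EReal) < S → IsMappingOut ((φ ∘ γ) '' Ioc 0 t) (g t)
  hcap : ∀ t : ℝ, 0 ≤ t → (t : EReal) < S →
    Tendsto (fun z ↦ z * (g t z - z)) (atInfinity ((φ ∘ γ) '' Ioc 0 t)) (𝓝 ((2 * t : ℝ) : ℂ))
  driving : ∀ t : ℝ, 0 ≤ t → (t : EReal) < S →
    Tendsto (g t ∘ φ) (tip D a γ t) (𝓝 ((U t : ℝ) : ℂ))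

/-- The reference point `p(t) = φ_t⁻¹(U(t) + i)` in `D(t)`, with `φ_t = g_t ∘ φ`. -/
def refPoint (D : Set ℂ) (φ : ℂ → ℂ) (γ : ℝ → ℂ) (g : ℝ → ℂ → ℂ) (U : ℝ → ℝ) (t : ℝ) : ℂ :=
  Function.invFunOn (g t ∘ φ) (slitDomain D γ t) ((U t : ℂ) + Complex.I)

/-- `T̃`, the supremum of the times `t ∈ [0, T]` before the end of the curve up to which
`|U| < 1 / ε`. -/
def exitTime (T ε : ℝ) (S : EReal) (U : ℝ → ℝ) : ℝ :=
  sSup {t : ℝ | 0 ≤ t ∧ t ≤ T ∧ (t : EReal) < S ∧ ∀ s ∈ Icc 0 t, |U s| < 1 / ε}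

end

noncomputable section

/-! ### Injective holomorphic maps -/

/-! Everything reduces to estimates for `h = g_t⁻¹`, uniform in the chain, depending only on the
bounds `t ≤ T` and `|U| < m = 1/ε`. Neither the Loewner differential equation nor continuity of `U`
is used. The transition maps between two times are hydrodynamically normalized with capacity twice
the time difference, and Schwarz–Pick, with one point sent to infinity, gives `‖h w - w‖ ≤ c / Im w`
(`HydroPair.norm_sub_le_div`).

The hull is bounded: as long as `|U| < m`, the curve `φ ∘ γ` stays in the disc of radius `B = m +
√(8T)` (`LoewnerFlow.norm_le`). Points lying to one side of all driving values only move further to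
that side, and `(Im g_t z)²` decreases at a bounded rate.

Analytic extension: far from the origin `h` has real boundary values, so it continues by reflection
to a neighbourhood of infinity of controlled size (`HydroPair.exists_extension`). Since `ψ_t⁻¹ = ψ⁻¹
∘ Ψ ∘ h ∘ (· + U) ∘ Ψ⁻¹`, the given extension of `ψ⁻¹` near `1` extends `ψ_t⁻¹` near `1`; the
singularity at `1` is removable (`HydroPair.exists_analytic_extension`).

Inner radius: let `z₁ = h(U + iY)` with `Y` larger than `2B`. A weak Koebe distortion theorem
compares the inner radius of `D(t)` at `p(t)` with the distance from `φ⁻¹(z₁)` to some point outside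
`D(t)`. If that point is on the slit, its image under `φ` has at most half the height of `z₁`, so by
Schwarz–Pick it is no closer than a third of the distance to `Dᶜ`. A second use of distortion, in
`D`, compares `z₁` with `i`, that is, with `p` (`LoewnerFlow.le_infDist`).

Prime ends: `b` corresponds to infinity before and after the slit is removed. The tip must be shown
to be exactly the boundary filter at `U(t)`, which needs continuity of `φ_t⁻¹` there
(`tendsto_slit_tip`). A length–area argument gives a short crosscut met by the curve just after time
`t`. With the end piece of the slit it would separate the domain inside a small disc, and
`ConformalPair.crosscut_separates` excludes points far from the tip on both sides, by comparing two
branches of a logarithm. -/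

lemma isOpen_halfPlane : IsOpen halfPlane := isOpen_lt continuous_const Complex.continuous_im

/-- An analytic function is locally constant or open at a point; injectivity excludes the first case
because `z` is not isolated. -/
lemma nhds_le_map_of_injOn {f : ℂ → ℂ} {U : Set ℂ} (hU : IsOpen U) (hd : DifferentiableOn ℂ f U)
    (hi : InjOn f U) {z : ℂ} (hz : z ∈ U) : 𝓝 (f z) ≤ map f (𝓝 z) := by
  have hUz : U ∈ 𝓝 z := hU.mem_nhds hz
  rcases (hd.analyticAt hUz).eventually_constant_or_nhds_le_map_nhds with h | h
  · exfalso
    have h2 : ∀ᶠ w in 𝓝 z, w = z := by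
      filter_upwards [h, hUz] with w hw hwU using hi hwU hz hw
    have : ∃ᶠ w in 𝓝[≠] z, w = z := (h2.filter_mono nhdsWithin_le_nhds).frequently
    obtain ⟨w, hw1, hw2⟩ := (this.and_eventually self_mem_nhdsWithin).exists
    exact hw2 hw1
  · exact h

lemma isOpen_image_of_injOn {f : ℂ → ℂ} {U : Set ℂ} (hU : IsOpen U) (hd : DifferentiableOn ℂ f U)
    (hi : InjOn f U) : IsOpen (f '' U) := by
  rw [isOpen_iff_mem_nhds]
  rintro _ ⟨z, hz, rfl⟩
  exact nhds_le_map_of_injOn hU hd hi hz (image_mem_map (hU.mem_nhds hz))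

/-- The inverse of an injective holomorphic map is holomorphic. -/
lemma differentiableOn_of_leftInverse {f g : ℂ → ℂ} {U : Set ℂ} (hU : IsOpen U)
    (hd : DifferentiableOn ℂ f U) (hi : InjOn f U) (hg : ∀ z ∈ U, g (f z) = z) :
    DifferentiableOn ℂ g (f '' U) := by
  have hO := isOpen_image_of_injOn hU hd hi
  have hcont : ∀ z ∈ U, ContinuousAt g (f z) := by
    intro z hz V hV
    rw [hg z hz] at hV
    refine nhds_le_map_of_injOn hU hd hi hz (mem_map.2 ?_)
    filter_upwards [hV, hU.mem_nhds hz] with w hw hwU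
    simpa [hg w hwU] using hw
  have hinv : ∀ w ∈ f '' U, f (g w) = w := by
    rintro _ ⟨z, hz, rfl⟩; rw [hg z hz]
  have hdiff : ∀ z ∈ U, deriv f z ≠ 0 → DifferentiableAt ℂ g (f z) := by
    intro z hz h0
    have hda : HasDerivAt f (deriv f z) (g (f z)) := by
      rw [hg z hz]; exact (hd.differentiableAt (hU.mem_nhds hz)).hasDerivAt
    refine (HasDerivAt.of_local_left_inverse (hcont z hz) hda h0 ?_).differentiableAt
    filter_upwards [hO.mem_nhds (mem_image_of_mem f hz)] with w hw using hinv w hw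
  rintro _ ⟨z, hz, rfl⟩
  have hUz := hU.mem_nhds hz
  have han : AnalyticAt ℂ f z := hd.analyticAt hUz
  -- Zeros of `deriv f` are isolated, so `g` is holomorphic on a punctured neighbourhood of `f z`,
  -- and continuity removes the singularity. Whether `deriv f z` vanishes need not be decided.
  refine (Complex.analyticAt_of_differentiable_on_punctured_nhds_of_continuousAt ?_
    (hcont z hz)).differentiableAt.differentiableWithinAt
  have h1 : ∀ᶠ w in 𝓝[≠] z, deriv f w ≠ 0 := by
    rcases han.deriv.eventually_eq_zero_or_eventually_ne_zero with h | h
    · exfalso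
      obtain ⟨r, hr, hb⟩ := Metric.eventually_nhds_iff_ball.1 (h.and hUz)
      have hconst : ∀ w ∈ ball z r, f w = f z := fun w hw ↦
        (convex_ball z r).is_const_of_fderivWithin_eq_zero (𝕜 := ℂ)
          (hd.mono fun x hx ↦ (hb x hx).2) (fun x hx ↦ by
            rw [fderivWithin_of_isOpen isOpen_ball hx]
            ext; simp [(hb x hx).1]) hw (mem_ball_self hr)
      have h2 : ∀ᶠ w in 𝓝 z, w = z := by
        filter_upwards [ball_mem_nhds z hr] with w hw using hi (hb w hw).2 hz (hconst w hw)
      have : ∃ᶠ w in 𝓝[≠] z, w = z := (h2.filter_mono nhdsWithin_le_nhds).frequently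
      obtain ⟨w, hw1, hw2⟩ := (this.and_eventually self_mem_nhdsWithin).exists
      exact hw2 hw1
    · exact h
  have h3 : Tendsto g (𝓝[≠] (f z)) (𝓝[≠] z) := by
    refine tendsto_nhdsWithin_iff.2 ⟨?_, ?_⟩
    · have := (hcont z hz).tendsto; rw [hg z hz] at this
      exact this.mono_left nhdsWithin_le_nhds
    · filter_upwards [self_mem_nhdsWithin,
        mem_nhdsWithin_of_mem_nhds (hO.mem_nhds (mem_image_of_mem f hz))] with w hw hwU h
      exact hw (by rw [← hinv w hwU, mem_singleton_iff.1 h]; rfl)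
  filter_upwards [h3.eventually h1,
    mem_nhdsWithin_of_mem_nhds (hO.mem_nhds (mem_image_of_mem f hz))] with w hw hwU
  obtain ⟨x, hx, rfl⟩ := hwU
  rw [hg x hx] at hw
  exact hdiff x hx hw

/-- `f : D → D'` and `g : D' → D` are inverse conformal maps of open sets. -/
structure ConformalPair (f g : ℂ → ℂ) (D D' : Set ℂ) : Prop where
  open_source : IsOpen D
  open_target : IsOpen D'
  diff : DifferentiableOn ℂ f D
  diff_symm : DifferentiableOn ℂ g D'
  mapsTo : ∀ z ∈ D, f z ∈ D'
  mapsTo_symm : ∀ w ∈ D', g w ∈ D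
  left_inv : ∀ z ∈ D, g (f z) = z
  right_inv : ∀ w ∈ D', f (g w) = w

namespace ConformalPair
variable {f g f' g' : ℂ → ℂ} {D D' D'' : Set ℂ}

lemma symm (h : ConformalPair f g D D') : ConformalPair g f D' D :=
  ⟨h.2, h.1, h.4, h.3, h.6, h.5, h.8, h.7⟩

lemma injOn (h : ConformalPair f g D D') : InjOn f D := fun x hx y hy hxy ↦ by
  rw [← h.left_inv x hx, hxy, h.left_inv y hy]

lemma image_eq (h : ConformalPair f g D D') : f '' D = D' :=
  Subset.antisymm (image_subset_iff.2 h.mapsTo)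
    fun w hw ↦ ⟨g w, h.mapsTo_symm w hw, h.right_inv w hw⟩

lemma bijOn (h : ConformalPair f g D D') : ConformalBijOn f D D' :=
  ⟨h.diff, h.mapsTo, h.injOn, h.image_eq.symm.subset⟩

lemma trans (h : ConformalPair f g D D') (h' : ConformalPair f' g' D' D'') :
    ConformalPair (f' ∘ f) (g ∘ g') D D'' :=
  ⟨h.1, h'.2, h'.diff.comp h.diff h.mapsTo, h.diff_symm.comp h'.diff_symm h'.mapsTo_symm,
    fun z hz ↦ h'.mapsTo _ (h.mapsTo z hz), fun z hz ↦ h.mapsTo_symm _ (h'.mapsTo_symm z hz),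
    fun z hz ↦ by simp [h'.left_inv _ (h.mapsTo z hz), h.left_inv z hz],
    fun z hz ↦ by simp [h.right_inv _ (h'.mapsTo_symm z hz), h'.right_inv z hz]⟩

/-- Restriction to a relatively open subset and its image. -/
lemma restrict (h : ConformalPair f g D D') {E : Set ℂ} (hE : IsOpen E) (hED : E ⊆ D) :
    ConformalPair f g E (f '' E) :=
  ⟨hE, isOpen_image_of_injOn hE (h.diff.mono hED) (h.injOn.mono hED), h.diff.mono hED,
    h.diff_symm.mono (image_subset_iff.2 fun z hz ↦ h.mapsTo z (hED hz)),
    fun z hz ↦ mem_image_of_mem f hz,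
    by rintro _ ⟨z, hz, rfl⟩; rwa [h.left_inv z (hED hz)],
    fun z hz ↦ h.left_inv z (hED hz),
    by rintro _ ⟨z, hz, rfl⟩; rw [h.left_inv z (hED hz)]⟩

lemma isSimplyConnected (h : ConformalPair f g D D') (hD : IsSimplyConnected D') :
    IsSimplyConnected D := by
  have e : D ≃ₜ D' :=
    { toFun := fun z ↦ ⟨f z, h.mapsTo z z.2⟩
      invFun := fun z ↦ ⟨g z, h.mapsTo_symm z z.2⟩
      left_inv := fun z ↦ Subtype.ext (h.left_inv z z.2)
      right_inv := fun z ↦ Subtype.ext (h.right_inv z z.2)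
      continuous_toFun := (continuousOn_iff_continuous_domRestrict.1
        h.diff.continuousOn).subtype_mk _
      continuous_invFun := (continuousOn_iff_continuous_domRestrict.1
        h.diff_symm.continuousOn).subtype_mk _ }
  exact e.toHomotopyEquiv.simplyConnectedSpace_iff.2 hD

end ConformalPair

lemma ConformalBijOn.pair {f : ℂ → ℂ} {D D' : Set ℂ} (h : ConformalBijOn f D D') (hD : IsOpen D) :
    ConformalPair f (Function.invFunOn f D) D D' := by
  have hl : ∀ z ∈ D, Function.invFunOn f D (f z) = z := h.2.injOn.leftInvOn_invFunOn
  refine ⟨hD, ?_, h.1, ?_, h.2.mapsTo, h.2.surjOn.mapsTo_invFunOn, hl, h.2.surjOn.rightInvOn_invFunOn⟩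
  · rw [← h.2.image_eq]; exact isOpen_image_of_injOn hD h.1 h.2.injOn
  · rw [← h.2.image_eq]; exact differentiableOn_of_leftInverse hD h.1 h.2.injOn hl

/-! ### Maximum principle, Schwarz–Pick and gradient estimates -/

/-- The maximum modulus principle for `exp (-i f)`, whose modulus is `exp (Im f)`. -/
lemma im_le_of_forall_mem_frontier {U : Set ℂ} {f : ℂ → ℂ} {M : ℝ} (hU : Bornology.IsBounded U)
    (hd : DiffContOnCl ℂ f U) (hM : ∀ z ∈ frontier U, (f z).im ≤ M) {z : ℂ} (hz : z ∈ U) :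
    (f z).im ≤ M := by
  have hn : ∀ z, ‖Complex.exp (-Complex.I * f z)‖ = Real.exp (f z).im := by
    intro z; rw [Complex.norm_exp]; simp
  have h1 : DiffContOnCl ℂ (fun z ↦ Complex.exp (-Complex.I * f z)) U :=
    Complex.differentiable_exp.comp_diffContOnCl (hd.const_smul (-Complex.I))
  have := Complex.norm_le_of_forall_mem_frontier_norm_le hU h1
    (C := Real.exp M) (fun z hz ↦ by rw [hn]; exact Real.exp_le_exp.2 (hM z hz))
    (subset_closure hz)
  rw [hn] at this
  exact Real.exp_le_exp.1 this

lemma norm_sub_le_norm_sub_conj {z w : ℂ} (hz : 0 ≤ z.im) (hw : 0 ≤ w.im) :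
    ‖z - w‖ ≤ ‖z - (starRingEnd ℂ) w‖ := by
  rw [← sq_le_sq₀ (norm_nonneg _) (norm_nonneg _), Complex.sq_norm, Complex.sq_norm,
    Complex.normSq_apply, Complex.normSq_apply]
  simp; nlinarith [mul_nonneg hz hw]

lemma sub_conj_ne_zero {z w : ℂ} (hz : 0 < z.im) (hw : 0 ≤ w.im) :
    z - (starRingEnd ℂ) w ≠ 0 := by
  intro h
  have := congrArg Complex.im h
  simp at this; linarith

/-- **Schwarz–Pick** for maps from a disc to the upper half plane. -/
lemma schwarz_pick_ball {f : ℂ → ℂ} {c z : ℂ} {r : ℝ} (hd : DifferentiableOn ℂ f (ball c r))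
    (hf : ∀ z ∈ ball c r, 0 < (f z).im) (hz : z ∈ ball c r) :
    ‖f z - f c‖ * r ≤ ‖z - c‖ * ‖f z - (starRingEnd ℂ) (f c)‖ := by
  have hr : 0 < r := nonempty_ball.1 ⟨z, hz⟩
  have hc := hf c (mem_ball_self hr)
  set F : ℂ → ℂ := fun w ↦ (f w - f c) / (f w - (starRingEnd ℂ) (f c))
  have hF0 : F c = 0 := by simp [F]
  have hFd : DifferentiableOn ℂ F (ball c r) :=
    (hd.sub_const _).div (hd.sub_const _) fun w hw ↦ sub_conj_ne_zero (hf w hw) hc.le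
  have hm : MapsTo F (ball c r) (closedBall (F c) 1) := by
    intro w hw
    rw [hF0, mem_closedBall_zero_iff, norm_div]
    exact div_le_one_of_le₀ (norm_sub_le_norm_sub_conj (hf w hw).le hc.le) (norm_nonneg _)
  have := Complex.dist_le_div_mul_dist_of_mapsTo_ball hFd hm hz
  rw [hF0, dist_zero_right, norm_div, dist_eq_norm, div_le_iff₀ (norm_pos_iff.2
    (sub_conj_ne_zero (hf z hz) hc.le))] at this
  calc _ ≤ (1 / r * ‖z - c‖ * ‖f z - (starRingEnd ℂ) (f c)‖) * r := by gcongr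
    _ = _ := by field_simp

/-- Adding `2Mi` places the values in the upper half plane at heights between `M` and `3M`. The
Schwarz lemma then bounds the derivative by `2 Im p(c) / r`, with `2 Im p(c) ≤ 6M`. -/
lemma norm_deriv_le_of_abs_im_le {f : ℂ → ℂ} {c : ℂ} {r M : ℝ} (hr : 0 < r) (hM : 0 < M)
    (hd : DifferentiableOn ℂ f (ball c r)) (hf : ∀ z ∈ ball c r, |(f z).im| ≤ M) :
    ‖deriv f c‖ ≤ 6 * M / r := by
  have hcb := mem_ball_self (x := c) hr
  set p : ℂ → ℂ := fun w ↦ f w + (2 * M : ℝ) * Complex.I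
  have hpi : ∀ w, (p w).im = (f w).im + 2 * M := by intro w; simp [p]
  have hpp : ∀ w ∈ ball c r, 0 < (p w).im := fun w hw ↦ by
    rw [hpi]; linarith [(abs_le.1 (hf w hw)).1]
  have hpd : DifferentiableOn ℂ p (ball c r) := hd.add_const _
  have hc := hpp c hcb
  set F : ℂ → ℂ := fun w ↦ (p w - p c) / (p w - (starRingEnd ℂ) (p c))
  have hF0 : F c = 0 := by simp [F]
  have hFd : DifferentiableOn ℂ F (ball c r) :=
    (hpd.sub_const _).div (hpd.sub_const _) fun w hw ↦ sub_conj_ne_zero (hpp w hw) hc.le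
  have hm : MapsTo F (ball c r) (closedBall (F c) 1) := by
    intro w hw
    rw [hF0, mem_closedBall_zero_iff, norm_div]
    exact div_le_one_of_le₀ (norm_sub_le_norm_sub_conj (hpp w hw).le hc.le) (norm_nonneg _)
  have h1 := Complex.norm_deriv_le_div_of_mapsTo_ball hFd hm hr
  have hfd : HasDerivAt f (deriv f c) c :=
    (hd.differentiableAt (isOpen_ball.mem_nhds hcb)).hasDerivAt
  have hne := sub_conj_ne_zero hc hc.le
  have hFder : HasDerivAt F (deriv f c / (p c - (starRingEnd ℂ) (p c))) c := by
    have hp1 : HasDerivAt p (deriv f c) c := hfd.add_const _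
    have := (hp1.sub_const (p c)).fun_div (hp1.sub_const ((starRingEnd ℂ) (p c))) hne
    refine this.congr_deriv ?_
    rw [div_eq_div_iff (pow_ne_zero 2 hne) hne]; ring
  rw [hFder.deriv, norm_div, div_le_iff₀ (norm_pos_iff.2 hne)] at h1
  have h2 : ‖p c - (starRingEnd ℂ) (p c)‖ ≤ 6 * M := by
    rw [Complex.sub_conj, norm_mul, Complex.norm_I, mul_one, Complex.norm_real, hpi,
      Real.norm_eq_abs, abs_of_pos (by rw [← hpi]; linarith)]
    linarith [(abs_le.1 (hf c hcb)).2]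
  calc _ ≤ 1 / r * ‖p c - (starRingEnd ℂ) (p c)‖ := h1
    _ ≤ 1 / r * (6 * M) := by gcongr
    _ = _ := by ring

/-! ### Schwarz reflection -/

/-- Morera's theorem: a rectangle meeting the real line is cut along it, and Cauchy's theorem on
each half needs only continuity on the closed rectangle. -/
lemma differentiableOn_of_off_real_line {V : Set ℂ} {f : ℂ → ℂ} (hV : IsOpen V)
    (hc : ContinuousOn f V) (hd : ∀ z ∈ V, z.im ≠ 0 → DifferentiableAt ℂ f z) :
    DifferentiableOn ℂ f V := by
  rw [← Complex.isConservativeOn_and_continuousOn_iff_isDifferentiableOn hV]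
  refine ⟨?_, hc⟩
  intro z w hzw
  rw [← add_eq_zero_iff_eq_neg, Complex.wedgeIntegral_add_wedgeIntegral_eq]
  have key : ∀ a b : ℂ, uIcc a.re b.re ×ℂ uIcc a.im b.im ⊆ V →
      (0 : ℝ) ∉ Ioo (min a.im b.im) (max a.im b.im) →
      (∫ x : ℝ in a.re..b.re, f (x + a.im * Complex.I)) -
      (∫ x : ℝ in a.re..b.re, f (x + b.im * Complex.I)) +
      Complex.I • (∫ y : ℝ in a.im..b.im, f (b.re + y * Complex.I)) -
      Complex.I • (∫ y : ℝ in a.im..b.im, f (a.re + y * Complex.I)) = 0 := by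
    intro a b hab h0
    refine Complex.integral_boundary_rect_eq_zero_of_continuousOn_of_differentiableOn f a b
      (hc.mono hab) fun x hx ↦ ?_
    refine (hd x (hab ?_) fun h ↦ h0 (h ▸ hx.2)).differentiableWithinAt
    exact ⟨Ioo_subset_Icc_self hx.1, Ioo_subset_Icc_self hx.2⟩
  by_cases h0 : (0 : ℝ) ∈ uIcc z.im w.im
  · have hz0 : uIcc z.im 0 ⊆ uIcc z.im w.im := uIcc_subset_uIcc left_mem_uIcc h0
    have hw0 : uIcc 0 w.im ⊆ uIcc z.im w.im := uIcc_subset_uIcc h0 right_mem_uIcc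
    have h1 := key z ⟨w.re, 0⟩ (fun x hx ↦ hzw ⟨hx.1, hz0 hx.2⟩) (by
      intro h; simp only [mem_Ioo, min_lt_iff, lt_max_iff, lt_self_iff_false, or_false] at h
      linarith [h.1, h.2])
    have h2 := key ⟨z.re, 0⟩ w (fun x hx ↦ hzw ⟨hx.1, hw0 hx.2⟩) (by
      intro h; simp only [mem_Ioo, min_lt_iff, lt_max_iff, lt_self_iff_false, false_or] at h
      linarith [h.1, h.2])
    have hint : ∀ a ∈ uIcc z.re w.re, ∀ p q : ℝ, uIcc p q ⊆ uIcc z.im w.im →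
        IntervalIntegrable (fun y : ℝ ↦ f (a + y * Complex.I)) MeasureTheory.volume p q := by
      intro a ha p q hpq
      refine ContinuousOn.intervalIntegrable (hc.comp (by fun_prop) fun y hy ↦ hzw ?_)
      exact ⟨by simpa using ha, by simpa using hpq hy⟩
    have i1 := intervalIntegral.integral_add_adjacent_intervals
      (hint w.re right_mem_uIcc _ _ hz0) (hint w.re right_mem_uIcc _ _ hw0)
    have i2 := intervalIntegral.integral_add_adjacent_intervals
      (hint z.re left_mem_uIcc _ _ hz0) (hint z.re left_mem_uIcc _ _ hw0)
    simp only [smul_eq_mul] at *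
    rw [← i1, ← i2]
    linear_combination h1 + h2
  · exact key z w hzw fun h ↦ h0 (Ioo_subset_Icc_self h)

/-- **Schwarz reflection** across the real line, for a map with locally bounded derivative. -/
lemma exists_reflection {V : Set ℂ} {h : ℂ → ℂ} (hV : IsOpen V)
    (hsymm : ∀ z ∈ V, (starRingEnd ℂ) z ∈ V) (hd : DifferentiableOn ℂ h (V ∩ halfPlane))
    (hb : ∀ x ∈ V, x.im = 0 → ∃ r > 0, ∃ C, ∀ z ∈ ball x r ∩ halfPlane, ‖deriv h z‖ ≤ C)
    (him : ∀ x ∈ V, x.im = 0 → Tendsto (fun z ↦ (h z).im) (𝓝[halfPlane] x) (𝓝 0)) :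
    ∃ F : ℂ → ℂ, DifferentiableOn ℂ F V ∧ EqOn F h (V ∩ halfPlane) ∧
      (∀ z ∈ V, F ((starRingEnd ℂ) z) = (starRingEnd ℂ) (F z)) := by
  have hO : IsOpen (V ∩ halfPlane) := hV.inter isOpen_halfPlane
  have hnhd : ∀ x ∈ V, 𝓝[V ∩ halfPlane] x = 𝓝[halfPlane] x := fun x hx ↦
    nhdsWithin_inter_of_mem (mem_nhdsWithin_of_mem_nhds (hV.mem_nhds hx))
  have hcl : V ∩ {z : ℂ | 0 ≤ z.im} ⊆ closure (V ∩ halfPlane) := by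
    rintro x ⟨hx, hxi⟩
    rw [mem_closure_iff_nhdsWithin_neBot, hnhd x hx, ← mem_closure_iff_nhdsWithin_neBot]
    have : closure halfPlane = {z : ℂ | 0 ≤ z.im} := Complex.closure_setOfPred_lt_im 0
    rw [this]; exact hxi
  have hlim : ∀ x ∈ V ∩ {z : ℂ | 0 ≤ z.im}, ∃ y, Tendsto h (𝓝[V ∩ halfPlane] x) (𝓝 y) := by
    rintro x ⟨hx, hxi⟩
    rcases (show (0:ℝ) ≤ x.im from hxi).eq_or_lt with h0 | h0
    · obtain ⟨r, hr, C, hC⟩ := hb x hx h0.symm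
      obtain ⟨r', hr', hrV⟩ := Metric.isOpen_iff.1 hV x hx
      have hconv : Convex ℝ (ball x (min r r') ∩ halfPlane) :=
        (convex_ball _ _).inter (convex_halfSpace_im_gt 0)
      have hopen : IsOpen (ball x (min r r') ∩ halfPlane) := isOpen_ball.inter isOpen_halfPlane
      have hsub : ball x (min r r') ∩ halfPlane ⊆ V ∩ halfPlane :=
        inter_subset_inter_left _ ((ball_subset_ball (min_le_right _ _)).trans hrV)
      -- A bounded derivative on a convex half disc makes `h` Lipschitz there, so the image of the
      -- boundary filter is Cauchy and `h` has a limit at `x`.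
      have hL : LipschitzOnWith (Real.toNNReal C) h (ball x (min r r') ∩ halfPlane) := by
        refine hconv.lipschitzOnWith_of_nnnorm_deriv_le (𝕜 := ℂ)
          (fun z hz ↦ hd.differentiableAt (hO.mem_nhds (hsub hz))) fun z hz ↦ ?_
        rw [← NNReal.coe_le_coe, coe_nnnorm]
        exact (hC z ⟨ball_subset_ball (min_le_left _ _) hz.1, hz.2⟩).trans (Real.le_coe_toNNReal C)
      have hfil : 𝓝[V ∩ halfPlane] x = 𝓝[ball x (min r r') ∩ halfPlane] x := by
        rw [hnhd x hx, nhdsWithin_inter_of_mem (mem_nhdsWithin_of_mem_nhds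
          (ball_mem_nhds x (lt_min hr hr')))]
      rw [hfil]
      have hne : (𝓝[ball x (min r r') ∩ halfPlane] x).NeBot := by
        rw [← hfil, ← mem_closure_iff_nhdsWithin_neBot]; exact hcl ⟨hx, hxi⟩
      have hca : Cauchy (𝓝[ball x (min r r') ∩ halfPlane] x) := cauchy_nhds.mono nhdsWithin_le_nhds
      exact cauchy_map_iff_exists_tendsto.1 (hca.map_of_le hL.uniformContinuousOn
        (le_principal_iff.2 self_mem_nhdsWithin))
    · have hm : x ∈ V ∩ halfPlane := ⟨hx, h0⟩
      exact ⟨h x, (hd.continuousOn x hm)⟩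
  set E := extendFrom (V ∩ halfPlane) h
  have hEc : ContinuousOn E (V ∩ {z : ℂ | 0 ≤ z.im}) := continuousOn_extendFrom hcl hlim
  have hEeq : EqOn E h (V ∩ halfPlane) := fun z hz ↦
    extendFrom_eq (subset_closure hz) (hd.continuousOn z hz)
  have hEreal : ∀ x ∈ V, x.im = 0 → (E x).im = 0 := by
    intro x hx hx0
    have hm : x ∈ V ∩ {z : ℂ | 0 ≤ z.im} := ⟨hx, hx0.ge⟩
    have h1 := tendsto_extendFrom (hlim x hm)
    rw [hnhd x hx] at h1
    have : (𝓝[halfPlane] x).NeBot := by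
      rw [← hnhd x hx, ← mem_closure_iff_nhdsWithin_neBot]; exact hcl hm
    exact tendsto_nhds_unique ((Complex.continuous_im.tendsto _).comp h1) (him x hx hx0)
  -- The two branches agree on the real line because `E` is real there.
  set F : ℂ → ℂ := fun z ↦ if 0 ≤ z.im then E z else (starRingEnd ℂ) (E ((starRingEnd ℂ) z))
  have hFc : ContinuousOn F V := by
    have hfr : ∀ a ∈ V ∩ frontier {z : ℂ | 0 ≤ z.im},
        E a = (starRingEnd ℂ) (E ((starRingEnd ℂ) a)) := by
      rintro a ⟨haV, ha⟩
      have ha0 : a.im = 0 := by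
        have := Complex.frontier_setOfPred_le_im 0
        rw [this] at ha; exact ha
      rw [Complex.conj_eq_iff_im.2 ha0, Complex.conj_eq_iff_im.2 (hEreal a haV ha0)]
    refine ContinuousOn.if hfr ?_ ?_
    · have : closure {z : ℂ | 0 ≤ z.im} = {z : ℂ | 0 ≤ z.im} :=
        (isClosed_le continuous_const Complex.continuous_im).closure_eq
      rw [this]; exact hEc
    · refine Complex.continuous_conj.comp_continuousOn (hEc.comp
        Complex.continuous_conj.continuousOn ?_)
      rintro a ⟨haV, ha⟩
      refine ⟨hsymm a haV, ?_⟩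
      have : closure {z : ℂ | ¬ 0 ≤ z.im} = {z : ℂ | z.im ≤ 0} := by
        simp only [not_le]; exact Complex.closure_setOfPred_im_lt 0
      rw [this] at ha
      simpa using ha
  have hFu : ∀ z ∈ V ∩ halfPlane, F z = h z := fun z hz ↦ by
    have hz2 : 0 < z.im := hz.2
    simp only [F, if_pos hz2.le]; exact hEeq hz
  refine ⟨F, differentiableOn_of_off_real_line hV hFc ?_, hFu, ?_⟩
  · intro z hz hz0
    rcases lt_or_gt_of_ne hz0 with hlt | hgt
    · have hz' : (starRingEnd ℂ) z ∈ V ∩ halfPlane := ⟨hsymm z hz, by simpa [halfPlane] using hlt⟩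
      have h1 : DifferentiableAt ℂ h ((starRingEnd ℂ) z) := hd.differentiableAt (hO.mem_nhds hz')
      have h2 := h1.conj_conj
      rw [Complex.conj_conj] at h2
      refine h2.congr_of_eventuallyEq ?_
      filter_upwards [hV.mem_nhds hz,
        (isOpen_lt Complex.continuous_im continuous_const).mem_nhds hlt] with w hw1 hw2
      have hw3 : w.im < 0 := hw2
      simp only [F, if_neg hw3.not_ge, Function.comp_apply]
      rw [hEeq ⟨hsymm w hw1, by simpa [halfPlane] using hw3⟩]
    · refine (hd.differentiableAt (hO.mem_nhds ⟨hz, hgt⟩)).congr_of_eventuallyEq ?_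
      filter_upwards [hO.mem_nhds ⟨hz, hgt⟩] with w hw using hFu w hw
  · intro z hz
    rcases lt_trichotomy z.im 0 with h0 | h0 | h0
    · simp [F, h0.le, h0.not_ge]
    · rw [Complex.conj_eq_iff_im.2 h0, eq_comm, Complex.conj_eq_iff_im]
      simp [F, h0, hEreal z hz h0]
    · simp [F, h0.le, h0]

/-! ### Logarithms on discs and a distortion estimate for univalent maps -/

/-- Integrate `f' / f` from the centre; then `f · exp (-L)` has zero derivative and is `1` at the
centre. -/
lemma exists_log_on_ball {f : ℂ → ℂ} {c : ℂ} {r : ℝ} (hd : DifferentiableOn ℂ f (ball c r))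
    (h0 : ∀ z ∈ ball c r, f z ≠ 0) :
    ∃ L : ℂ → ℂ, DifferentiableOn ℂ L (ball c r) ∧ ∀ z ∈ ball c r, Complex.exp (L z) = f z := by
  rcases le_or_gt r 0 with hr | hr
  · exact ⟨0, by simp [ball_eq_empty.2 hr], by simp [ball_eq_empty.2 hr]⟩
  have hdf : DifferentiableOn ℂ (fun z ↦ deriv f z / f z) (ball c r) :=
    (hd.deriv isOpen_ball).div hd h0
  obtain ⟨L, hLc, hL⟩ := hdf.isExactOn_ball.with_val_at c (Complex.log (f c))
  have hLd : DifferentiableOn ℂ L (ball c r) := fun z hz ↦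
    (hL z hz).differentiableAt.differentiableWithinAt
  have hFd : ∀ z ∈ ball c r, HasDerivAt (fun z ↦ f z * Complex.exp (-L z)) 0 z := by
    intro z hz
    have h1 := (hd.differentiableAt (isOpen_ball.mem_nhds hz)).hasDerivAt
    refine (h1.mul ((hL z hz).neg.cexp)).congr_deriv ?_
    have := h0 z hz
    field_simp; simp
  refine ⟨L, hLd, fun z hz ↦ ?_⟩
  have hcb := mem_ball_self (x := c) hr
  have := (convex_ball c r).is_const_of_fderivWithin_eq_zero (𝕜 := ℂ)
    (fun w hw ↦ (hFd w hw).differentiableAt.differentiableWithinAt) (fun w hw ↦ by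
      rw [fderivWithin_of_isOpen isOpen_ball hw]
      ext; simp [(hFd w hw).deriv]) hz hcb
  simp only [Complex.exp_neg, hLc, Complex.exp_log (h0 c hcb), mul_inv_cancel₀ (h0 c hcb)] at this
  exact (eq_of_div_eq_one (by rw [div_eq_mul_inv]; exact this)).symm

/-- Harnack's inequality for a holomorphic map into the upper half plane. -/
lemma im_le_of_harnack {f : ℂ → ℂ} {z : ℂ} {ρ : ℝ} (hd : DifferentiableOn ℂ f (ball 0 1))
    (hf : ∀ z ∈ ball (0 : ℂ) 1, 0 < (f z).im) (hz : ‖z‖ ≤ ρ) (hρ : ρ < 1) :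
    (f z).im ≤ (f 0).im * ((1 + ρ) / (1 - ρ)) := by
  have hzb : z ∈ ball (0 : ℂ) 1 := by simpa using hz.trans_lt hρ
  have h0 := hf 0 (by simp)
  have hρ0 : 0 ≤ ρ := (norm_nonneg z).trans hz
  have h1 := schwarz_pick_ball hd hf hzb
  rw [mul_one, sub_zero] at h1
  have h2 : ‖f z - (starRingEnd ℂ) (f 0)‖ ≤ ‖f z - f 0‖ + 2 * (f 0).im := by
    have : f z - (starRingEnd ℂ) (f 0) = (f z - f 0) + (f 0 - (starRingEnd ℂ) (f 0)) := by ring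
    rw [this]
    refine (norm_add_le _ _).trans (add_le_add_right (le_of_eq ?_) _)
    rw [Complex.sub_conj, norm_mul, Complex.norm_I, mul_one, Complex.norm_real, Real.norm_eq_abs,
      abs_of_pos (by linarith)]
  have h3 : ‖f z - f 0‖ ≤ ρ * (‖f z - f 0‖ + 2 * (f 0).im) :=
    h1.trans (mul_le_mul hz h2 (norm_nonneg _) hρ0)
  have h4 : (f z).im - (f 0).im ≤ ‖f z - f 0‖ := by
    simpa using (le_abs_self _).trans (Complex.abs_im_le_norm (f z - f 0))
  have h5 : 0 < 1 - ρ := by linarith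
  rw [← mul_div_assoc, le_div_iff₀ h5]
  nlinarith

/-- The constant of the distortion estimate `ConformalPair.norm_sub_le_koebeConst`. -/
def koebeConst (ρ : ℝ) : ℝ := (1 + Real.exp (4 * ((1 + ρ) / (1 - ρ)))) ^ 2

lemma koebeConst_pos (ρ : ℝ) : 0 < koebeConst ρ := by unfold koebeConst; positivity

/-- A weak form of the Koebe distortion theorem: if `k` is a boundary point of `Ω` nearest to
`f 0`, then `f z` is at a distance comparable to `|f 0 - k|` from `k`. -/
lemma ConformalPair.norm_sub_le_koebeConst {f g : ℂ → ℂ} {Ω : Set ℂ} {k z : ℂ} {ρ : ℝ}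
    (h : ConformalPair f g (ball 0 1) Ω) (hk : k ∉ Ω) (hball : ball (f 0) ‖f 0 - k‖ ⊆ Ω)
    (hz : ‖z‖ ≤ ρ) (hρ : ρ < 1) : ‖f z - k‖ ≤ koebeConst ρ * ‖f 0 - k‖ := by
  have hzb : z ∈ ball (0 : ℂ) 1 := by simpa using hz.trans_lt hρ
  have h0b : (0 : ℂ) ∈ ball (0 : ℂ) 1 := by simp
  have hρ0 : 0 ≤ ρ := (norm_nonneg z).trans hz
  obtain ⟨L, hLd, hL⟩ := exists_log_on_ball (h.diff.sub_const k) fun w hw h0 ↦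
    hk (sub_eq_zero.1 h0 ▸ h.mapsTo w hw)
  -- Koebe's square root device: `s` is a branch of `√(f - k)`, and since `f` is injective it cannot
  -- take both a value and its negative.
  set s : ℂ → ℂ := fun w ↦ Complex.exp (L w / 2)
  have hsd : DifferentiableOn ℂ s (ball 0 1) := (hLd.div_const 2).cexp
  have hs2 : ∀ w ∈ ball (0 : ℂ) 1, s w ^ 2 = f w - k := by
    intro w hw
    rw [← hL w hw]; simp only [s]; rw [← Complex.exp_nat_mul]; congr 1; push_cast; ring
  have hs0 : ∀ w, s w ≠ 0 := fun w ↦ Complex.exp_ne_zero _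
  have hs0p : 0 < ‖s 0‖ := norm_pos_iff.2 (hs0 0)
  have hd : ‖f 0 - k‖ = ‖s 0‖ ^ 2 := by rw [← hs2 0 h0b, norm_pow]
  -- `|u² - s(0)²| ≤ (1/4)(9/4)|s 0|² < |s 0|²`, so `u² + k` lies in the given disc around `f 0`.
  have hB : ∀ u ∈ ball (s 0) (‖s 0‖ / 4), u ^ 2 + k ∈ Ω := by
    intro u hu
    apply hball
    rw [mem_ball, dist_eq_norm] at hu ⊢
    have e : u ^ 2 + k - f 0 = (u - s 0) * ((u - s 0) + 2 * s 0) := by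
      linear_combination hs2 0 h0b
    rw [e, norm_mul, hd]
    have : ‖(u - s 0) + 2 * s 0‖ ≤ ‖s 0‖ / 4 + 2 * ‖s 0‖ :=
      (norm_add_le _ _).trans (add_le_add hu.le (by simp))
    nlinarith [norm_nonneg (u - s 0), norm_nonneg ((u - s 0) + 2 * s 0)]
  have hsB : EqOn (fun u ↦ s (g (u ^ 2 + k))) id (ball (s 0) (‖s 0‖ / 4)) := by
    refine (convex_ball _ _).isPreconnected.eq_of_sq_eq (y := s 0) ?_ continuousOn_id ?_ ?_
      (mem_ball_self (by positivity)) ?_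
    · exact hsd.continuousOn.comp (h.diff_symm.continuousOn.comp (by fun_prop) hB)
        fun u hu ↦ h.mapsTo_symm _ (hB u hu)
    · intro u hu
      simp only [Pi.pow_apply, id]
      rw [hs2 _ (h.mapsTo_symm _ (hB u hu)), h.right_inv _ (hB u hu)]; ring
    · intro u hu h0
      rw [mem_ball, dist_eq_norm] at hu
      simp only [id] at h0
      rw [h0, zero_sub, norm_neg] at hu; linarith
    · simp only [id]
      rw [hs2 0 h0b, sub_add_cancel, h.left_inv 0 h0b]
  -- If `s w` were this close to `-s 0`, the identity `hsB` at `u = -s w` would give `s w = -s w`.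
  have homit : ∀ w ∈ ball (0 : ℂ) 1, ‖s 0‖ / 4 ≤ ‖s w + s 0‖ := by
    intro w hw
    by_contra! hlt
    have hu : -s w ∈ ball (s 0) (‖s 0‖ / 4) := by
      rw [mem_ball, dist_eq_norm, ← norm_neg]; simpa [add_comm] using hlt
    have := hsB hu
    simp only [id] at this
    rw [neg_sq, hs2 w hw, sub_add_cancel, h.left_inv w hw] at this
    exact hs0 w (by linear_combination this / 2)
  have hne : ∀ w ∈ ball (0 : ℂ) 1, s w + s 0 ≠ 0 := fun w hw h0 ↦ by
    have := homit w hw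
    rw [h0, norm_zero] at this; linarith
  -- By `homit` this logarithm has nonnegative real part. Harnack's inequality is applied to `i (P +
  -- 1)`, the `1` making the imaginary part strictly positive.
  obtain ⟨P, hPd, hP⟩ := exists_log_on_ball (f := fun w ↦ (s w + s 0) / (s 0 / 4))
    ((hsd.add_const _).div_const _) fun w hw ↦
      div_ne_zero (hne w hw) (div_ne_zero (hs0 0) (by norm_num))
  have hPn : ∀ w ∈ ball (0 : ℂ) 1, Real.exp (P w).re = ‖s w + s 0‖ / (‖s 0‖ / 4) := by
    intro w hw
    rw [← Complex.norm_exp, hP w hw]; simp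
  have hPre : ∀ w ∈ ball (0 : ℂ) 1, 0 ≤ (P w).re := by
    intro w hw
    rw [← Real.one_le_exp_iff, hPn w hw, one_le_div (by positivity)]
    exact homit w hw
  have hX := im_le_of_harnack (f := fun w ↦ Complex.I * (P w + 1)) ((hPd.add_const 1).const_mul _)
    (fun w hw ↦ by simp; linarith [hPre w hw]) hz hρ
  simp only [Complex.mul_im, Complex.I_re, Complex.I_im, Complex.add_re, Complex.one_re, zero_mul,
    one_mul, zero_add] at hX
  -- `exp (P 0).re = 2 / (1/4) = 8 < e³`; together with the added `1` this is the `4` in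
  -- `koebeConst`.
  have hP0 : (P 0).re ≤ 3 := by
    have h8 : Real.exp (P 0).re = 8 := by
      rw [hPn 0 h0b, ← two_mul, norm_mul]; field_simp; norm_num
    rw [← Real.exp_le_exp, h8]
    have := Real.exp_one_gt_d9
    have h3 : Real.exp 3 = Real.exp 1 ^ 3 := by rw [← Real.exp_nat_mul]; norm_num
    rw [h3]
    calc (8 : ℝ) = 2 ^ 3 := by norm_num
      _ ≤ Real.exp 1 ^ 3 := by gcongr; linarith
  have hq : 0 ≤ (1 + ρ) / (1 - ρ) := div_nonneg (by linarith) (by linarith)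
  set E := 4 * ((1 + ρ) / (1 - ρ)) with hE
  have hPz : (P z).re ≤ E := by nlinarith
  have h6 : ‖s z + s 0‖ ≤ ‖s 0‖ / 4 * Real.exp E := by
    rw [mul_comm, ← div_le_iff₀ (by positivity), ← hPn z hzb]
    exact Real.exp_le_exp.2 hPz
  have h7 : ‖s z‖ ≤ ‖s 0‖ * (1 + Real.exp E) := by
    have : ‖s z‖ ≤ ‖s z + s 0‖ + ‖s 0‖ := by
      simpa using norm_sub_le (s z + s 0) (s 0)
    nlinarith [Real.exp_pos E]
  rw [← hs2 z hzb, norm_pow, hd, koebeConst, ← mul_pow, mul_comm (1 + Real.exp _)]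
  gcongr

/-! ### Automorphisms of the disc -/

/-- The Schwarz lemma for `f` and for its inverse gives `‖f z‖ = ‖z‖`, which is the equality case
and forces a rotation. -/
lemma ConformalPair.exists_eq_mul {f g : ℂ → ℂ} (h : ConformalPair f g (ball 0 1) (ball 0 1))
    (h0 : f 0 = 0) : ∃ c : ℂ, ‖c‖ = 1 ∧ ∀ z ∈ ball (0 : ℂ) 1, f z = z * c := by
  have hg0 : g 0 = 0 := by
    have := h.left_inv 0 (by simp)
    rwa [h0] at this
  have hf1 : ∀ z ∈ ball (0 : ℂ) 1, ‖f z‖ = ‖z‖ := by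
    intro z hz
    refine le_antisymm (Complex.norm_le_norm_of_mapsTo_ball h.diff
      (fun w hw ↦ ball_subset_closedBall (h.mapsTo w hw)) h0 (by simpa using hz)) ?_
    have := Complex.norm_le_norm_of_mapsTo_ball h.diff_symm
      (fun w hw ↦ ball_subset_closedBall (h.mapsTo_symm w hw)) hg0 (z := f z)
      (by simpa using h.mapsTo z hz)
    rwa [h.left_inv z hz] at this
  have hhalf : (1 / 2 : ℂ) ∈ ball (0 : ℂ) 1 := by simp; norm_num
  obtain ⟨c, hc, he⟩ := Complex.affine_of_mapsTo_ball_of_exists_norm_dslope_eq_div' (R₂ := 1)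
    h.diff (fun w hw ↦ by rw [h0]; exact ball_subset_closedBall (h.mapsTo w hw))
    ⟨1 / 2, hhalf, by
      rw [dslope_of_ne _ (by norm_num), slope_def_module, norm_smul, h0, sub_zero, sub_zero, hf1 _ hhalf]
      norm_num⟩
  refine ⟨c, by simpa using hc, fun z hz ↦ ?_⟩
  simpa [h0] using he hz

/-- The automorphism `z ↦ (z - a) / (1 - ā z)` of the disc. -/
def blaschke (a z : ℂ) : ℂ := (z - a) / (1 - (starRingEnd ℂ) a * z)

lemma one_sub_conj_mul_ne_zero {a z : ℂ} (ha : ‖a‖ < 1) (hz : ‖z‖ ≤ 1) :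
    1 - (starRingEnd ℂ) a * z ≠ 0 := by
  intro h
  have h1 : ‖(starRingEnd ℂ) a * z‖ = 1 := by rw [← sub_eq_zero.1 h]; simp
  rw [norm_mul, RCLike.norm_conj] at h1
  nlinarith [norm_nonneg a, norm_nonneg z]

lemma norm_blaschke_lt_one {a z : ℂ} (ha : ‖a‖ < 1) (hz : ‖z‖ < 1) : ‖blaschke a z‖ < 1 := by
  rw [blaschke, norm_div, div_lt_one (norm_pos_iff.2 (one_sub_conj_mul_ne_zero ha hz.le)),
    ← sq_lt_sq₀ (norm_nonneg _) (norm_nonneg _)]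
  have ha2 : ‖a‖ ^ 2 < 1 := by nlinarith [norm_nonneg a]
  have hz2 : ‖z‖ ^ 2 < 1 := by nlinarith [norm_nonneg z]
  rw [Complex.sq_norm, Complex.normSq_apply] at *
  rw [Complex.sq_norm, Complex.normSq_apply]
  simp
  nlinarith [mul_pos (sub_pos.2 ha2) (sub_pos.2 hz2)]

lemma blaschke_neg_blaschke {a z : ℂ} (ha : ‖a‖ < 1) (hz : ‖z‖ ≤ 1) :
    blaschke (-a) (blaschke a z) = z := by
  have h1 := one_sub_conj_mul_ne_zero ha hz
  have h2 : 1 - (starRingEnd ℂ) a * a ≠ 0 := one_sub_conj_mul_ne_zero ha ha.le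
  unfold blaschke
  have h3 : 1 - (starRingEnd ℂ) (-a) * ((z - a) / (1 - (starRingEnd ℂ) a * z)) =
      (1 - (starRingEnd ℂ) a * a) / (1 - (starRingEnd ℂ) a * z) := by
    simp; field_simp; ring
  rw [h3, sub_neg_eq_add, div_add' _ _ _ h1, div_div_div_cancel_right₀ h1, div_eq_iff h2]
  ring

lemma differentiableAt_blaschke {a z : ℂ} (ha : ‖a‖ < 1) (hz : ‖z‖ ≤ 1) :
    DifferentiableAt ℂ (blaschke a) z := by
  unfold blaschke
  exact (differentiableAt_id.sub_const a).div ((differentiableAt_id.const_mul _).const_sub 1)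
    (one_sub_conj_mul_ne_zero ha hz)

lemma blaschke_pair {a : ℂ} (ha : ‖a‖ < 1) :
    ConformalPair (blaschke a) (blaschke (-a)) (ball 0 1) (ball 0 1) := by
  have ha' : ‖-a‖ < 1 := by simpa using ha
  have hm : ∀ z ∈ ball (0 : ℂ) 1, ‖z‖ < 1 := fun z hz ↦ by simpa using hz
  refine ⟨isOpen_ball, isOpen_ball, fun z hz ↦ ?_, fun z hz ↦ ?_, fun z hz ↦ ?_, fun z hz ↦ ?_,
    fun z hz ↦ blaschke_neg_blaschke ha (hm z hz).le, fun z hz ↦ ?_⟩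
  · exact (differentiableAt_blaschke ha (hm z hz).le).differentiableWithinAt
  · exact (differentiableAt_blaschke ha' (hm z hz).le).differentiableWithinAt
  · simpa using norm_blaschke_lt_one ha (hm z hz)
  · simpa using norm_blaschke_lt_one ha' (hm z hz)
  · simpa using blaschke_neg_blaschke ha' (hm z hz).le

/-- An automorphism of the disc is a homeomorphism up to the boundary. -/
lemma ConformalPair.map_nhdsWithin_ball {f g : ℂ → ℂ}
    (h : ConformalPair f g (ball 0 1) (ball 0 1)) {ζ ξ : ℂ} (hζ : ‖ζ‖ = 1) (hξ : ‖ξ‖ = 1)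
    (ht : Tendsto f (𝓝[ball 0 1] ζ) (𝓝 ξ)) : map f (𝓝[ball 0 1] ζ) = 𝓝[ball 0 1] ξ := by
  have hmem : ∀ z ∈ ball (0 : ℂ) 1, ‖z‖ < 1 := fun z hz ↦ by simpa using hz
  set a := g 0
  have ha : ‖a‖ < 1 := hmem _ (h.mapsTo_symm 0 (by simp))
  have ha' : ‖-a‖ < 1 := by simpa using ha
  -- After precomposition with a Möbius automorphism the map fixes `0` and is a rotation. The
  -- resulting formulas for `f` and `g` are continuous up to the circle.
  have hp := (blaschke_pair ha').trans h
  obtain ⟨c, hc, he⟩ := hp.exists_eq_mul (by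
    simp only [Function.comp_apply, blaschke]
    simp only [sub_neg_eq_add, zero_add, mul_zero, sub_zero, div_one]
    exact h.right_inv 0 (by simp))
  have hc0 : c ≠ 0 := norm_ne_zero_iff.1 (by rw [hc]; norm_num)
  have hf : ∀ z ∈ ball (0 : ℂ) 1, f z = blaschke a z * c := by
    intro z hz
    have := he (blaschke a z) ((blaschke_pair ha).mapsTo z hz)
    rwa [Function.comp_apply, blaschke_neg_blaschke ha (hmem z hz).le] at this
  have hg : ∀ w ∈ ball (0 : ℂ) 1, g w = blaschke (-a) (w / c) := by
    intro w hw
    have h1 := hf (g w) (h.mapsTo_symm w hw)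
    rw [h.right_inv w hw] at h1
    rw [(div_eq_iff hc0).2 h1, blaschke_neg_blaschke ha (hmem _ (h.mapsTo_symm w hw)).le]
  have hnb : (𝓝[ball (0 : ℂ) 1] ζ).NeBot := by
    rw [← mem_closure_iff_nhdsWithin_neBot, closure_ball _ one_ne_zero]; simp [hζ]
  have hval : ξ = blaschke a ζ * c := by
    refine tendsto_nhds_unique ht ?_
    refine Tendsto.congr' (f₁ := fun z ↦ blaschke a z * c) ?_ ?_
    · filter_upwards [self_mem_nhdsWithin] with z hz using (hf z hz).symm
    · exact ((differentiableAt_blaschke ha hζ.le).continuousAt.tendsto.mul_const c).mono_left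
        nhdsWithin_le_nhds
  have hgt : Tendsto g (𝓝[ball 0 1] ξ) (𝓝 ζ) := by
    refine Tendsto.congr' (f₁ := fun w ↦ blaschke (-a) (w / c)) ?_ ?_
    · filter_upwards [self_mem_nhdsWithin] with z hz using (hg z hz).symm
    · have h1 : ContinuousAt (fun w ↦ blaschke (-a) (w / c)) ξ := by
        refine ContinuousAt.comp (g := blaschke (-a)) ?_ (by fun_prop)
        exact (differentiableAt_blaschke ha' (by rw [norm_div, hξ, hc]; norm_num)).continuousAt
      have h2 := h1.tendsto
      rw [hval, mul_div_cancel_right₀ _ hc0, blaschke_neg_blaschke ha hζ.le, ← hval] at h2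
      exact h2.mono_left nhdsWithin_le_nhds
  refine le_antisymm (tendsto_nhdsWithin_iff.2 ⟨ht, ?_⟩) ?_
  · filter_upwards [self_mem_nhdsWithin] with z hz using h.mapsTo z hz
  · intro s hs
    have h1 : Tendsto g (𝓝[ball 0 1] ξ) (𝓝[ball 0 1] ζ) := tendsto_nhdsWithin_iff.2 ⟨hgt, by
      filter_upwards [self_mem_nhdsWithin] with z hz using h.mapsTo_symm z hz⟩
    filter_upwards [h1 (mem_map.1 hs), self_mem_nhdsWithin] with w hw hwb
    simpa [h.right_inv w hwb] using hw

/-! ### Schwarz–Pick in the half plane -/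

/-- This identity converts between the forms of Schwarz–Pick with `a - b` and with `a - b̄`. -/
lemma normSq_sub_conj (a b : ℂ) :
    ‖a - (starRingEnd ℂ) b‖ ^ 2 = ‖a - b‖ ^ 2 + 4 * a.im * b.im := by
  rw [Complex.sq_norm, Complex.sq_norm, Complex.normSq_apply, Complex.normSq_apply]
  simp; ring

lemma norm_sub_div_sub_conj_lt_one {z w : ℂ} (hz : 0 < z.im) (hw : 0 < w.im) :
    ‖(z - w) / (z - (starRingEnd ℂ) w)‖ < 1 := by
  rw [norm_div, div_lt_one (norm_pos_iff.2 (sub_conj_ne_zero hz hw.le)),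
    ← sq_lt_sq₀ (norm_nonneg _) (norm_nonneg _), normSq_sub_conj]
  nlinarith [mul_pos hz hw]

/-- The conformal map of the disc onto the half plane taking `0` to `w`. -/
def discToHalf (w ζ : ℂ) : ℂ := (w - (starRingEnd ℂ) w * ζ) / (1 - ζ)

lemma one_sub_ne_zero_of_mem_ball {ζ : ℂ} (h : ζ ∈ ball (0 : ℂ) 1) : 1 - ζ ≠ 0 := by
  intro h0
  rw [← sub_eq_zero.1 h0] at h; simp at h

lemma discToHalf_im {w ζ : ℂ} (h : ζ ∈ ball (0 : ℂ) 1) :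
    (discToHalf w ζ).im = w.im * (1 - ‖ζ‖ ^ 2) / ‖1 - ζ‖ ^ 2 := by
  have h1 := one_sub_ne_zero_of_mem_ball h
  have h2 : Complex.normSq (1 - ζ) ≠ 0 := (Complex.normSq_pos.2 h1).ne'
  rw [discToHalf, Complex.div_im, Complex.sq_norm, Complex.sq_norm]
  rw [Complex.normSq_apply] at h2
  simp only [Complex.normSq_apply]
  simp at h2 ⊢
  field_simp
  ring

lemma discToHalf_pair {w : ℂ} (hw : 0 < w.im) :
    ConformalPair (discToHalf w) (fun z ↦ (z - w) / (z - (starRingEnd ℂ) w)) (ball 0 1)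
      halfPlane := by
  have hww := sub_conj_ne_zero hw hw.le
  refine ⟨isOpen_ball, isOpen_halfPlane, ?_, ?_, ?_, ?_, ?_, ?_⟩
  · exact ((differentiable_id.const_mul _).const_sub w).differentiableOn.div
      (differentiable_id.const_sub 1).differentiableOn fun z hz ↦ one_sub_ne_zero_of_mem_ball hz
  · exact (differentiableOn_id.sub_const w).div (differentiableOn_id.sub_const _)
      fun z hz ↦ sub_conj_ne_zero hz hw.le
  · intro ζ hζ
    change 0 < (discToHalf w ζ).im
    rw [discToHalf_im hζ]
    have h1 : ‖ζ‖ < 1 := by simpa using hζ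
    have h2 := norm_pos_iff.2 (one_sub_ne_zero_of_mem_ball hζ)
    have : 0 < 1 - ‖ζ‖ ^ 2 := by nlinarith [norm_nonneg ζ]
    positivity
  · intro z hz
    rw [mem_ball_zero_iff]
    exact norm_sub_div_sub_conj_lt_one hz hw
  · intro ζ hζ
    have h1 := one_sub_ne_zero_of_mem_ball hζ
    have e1 : discToHalf w ζ - w = (w - (starRingEnd ℂ) w) * ζ / (1 - ζ) := by
      rw [discToHalf]; field_simp; ring
    have e2 : discToHalf w ζ - (starRingEnd ℂ) w = (w - (starRingEnd ℂ) w) / (1 - ζ) := by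
      rw [discToHalf]; field_simp; ring
    simp only [e1, e2]
    field_simp
  · intro z hz
    have h1 := sub_conj_ne_zero hz hw.le
    rw [discToHalf]
    have e1 : 1 - (z - w) / (z - (starRingEnd ℂ) w) =
        (w - (starRingEnd ℂ) w) / (z - (starRingEnd ℂ) w) := by field_simp; ring
    rw [e1]; field_simp; ring

/-- **Schwarz–Pick** in the upper half plane. -/
lemma schwarz_pick_halfPlane {f : ℂ → ℂ} (hd : DifferentiableOn ℂ f halfPlane)
    (hf : ∀ z ∈ halfPlane, 0 ≤ (f z).im) {z w : ℂ} (hz : 0 < z.im) (hw : 0 < w.im) :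
    ‖f z - (starRingEnd ℂ) (f w)‖ ^ 2 * (z.im * w.im) ≤
      ‖z - (starRingEnd ℂ) w‖ ^ 2 * ((f z).im * (f w).im) := by
  have key : ∀ f : ℂ → ℂ, DifferentiableOn ℂ f halfPlane → (∀ z ∈ halfPlane, 0 < (f z).im) →
      ‖f z - (starRingEnd ℂ) (f w)‖ ^ 2 * (z.im * w.im) ≤
      ‖z - (starRingEnd ℂ) w‖ ^ 2 * ((f z).im * (f w).im) := by
    intro f hd hf
    have hp := discToHalf_pair hw
    have hd' : DifferentiableOn ℂ (f ∘ discToHalf w) (ball 0 1) := hd.comp hp.diff hp.mapsTo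
    have h1 := schwarz_pick_ball hd' (fun ζ hζ ↦ hf _ (hp.mapsTo ζ hζ)) (hp.mapsTo_symm z hz)
    have h0 : discToHalf w 0 = w := by simp [discToHalf]
    simp only [Function.comp_apply, h0, mul_one, sub_zero, hp.right_inv z hz, norm_div] at h1
    have hn := norm_pos_iff.2 (sub_conj_ne_zero hz hw.le)
    rw [div_mul_eq_mul_div, le_div_iff₀ hn] at h1
    have h2 := (sq_le_sq₀ (by positivity) (by positivity)).2 h1
    rw [mul_pow, mul_pow] at h2
    have e1 := normSq_sub_conj z w
    have e2 := normSq_sub_conj (f z) (f w)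
    rw [e1, e2] at h2 ⊢
    nlinarith
  -- Adding `iε` makes the imaginary part positive; with denominators cleared, the inequality
  -- survives `ε → 0` even where `Im f` vanishes.
  have hlim : ∀ ε : ℝ, 0 < ε →
      ‖(f z + ε * Complex.I) - (starRingEnd ℂ) (f w + ε * Complex.I)‖ ^ 2 * (z.im * w.im) ≤
      ‖z - (starRingEnd ℂ) w‖ ^ 2 * ((f z + ε * Complex.I).im * (f w + ε * Complex.I).im) := by
    intro ε hε
    exact key (fun z ↦ f z + ε * Complex.I) (hd.add_const _) fun z hz ↦ by
      simp; linarith [hf z hz]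
  have hL : Tendsto (fun ε : ℝ ↦
      ‖(f z + ε * Complex.I) - (starRingEnd ℂ) (f w + ε * Complex.I)‖ ^ 2 * (z.im * w.im))
      (𝓝[>] 0) (𝓝 (‖f z - (starRingEnd ℂ) (f w)‖ ^ 2 * (z.im * w.im))) := by
    have : Continuous (fun ε : ℝ ↦
      ‖(f z + ε * Complex.I) - (starRingEnd ℂ) (f w + ε * Complex.I)‖ ^ 2 * (z.im * w.im)) := by
      have := Complex.continuous_conj
      fun_prop
    simpa using (this.tendsto 0).mono_left (nhdsWithin_le_nhds (s := Ioi 0))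
  have hR : Tendsto (fun ε : ℝ ↦
      ‖z - (starRingEnd ℂ) w‖ ^ 2 * ((f z + ε * Complex.I).im * (f w + ε * Complex.I).im))
      (𝓝[>] 0) (𝓝 (‖z - (starRingEnd ℂ) w‖ ^ 2 * ((f z).im * (f w).im))) := by
    have : Continuous (fun ε : ℝ ↦ ‖z - (starRingEnd ℂ) w‖ ^ 2 *
      ((f z + ε * Complex.I).im * (f w + ε * Complex.I).im)) := by
      simp only [Complex.add_im, Complex.mul_im, Complex.ofReal_re, Complex.I_im, Complex.ofReal_im,
        Complex.I_re]
      fun_prop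
    simpa using (this.tendsto 0).mono_left (nhdsWithin_le_nhds (s := Ioi 0))
  exact le_of_tendsto_of_tendsto hL hR (eventually_nhdsWithin_of_forall hlim)

/-! ### Hydrodynamically normalized maps of the half plane -/

/-- The neighbourhoods of `∞` in the half plane. -/
def infH : Filter ℂ := cocompact ℂ ⊓ 𝓟 halfPlane

lemma eventually_infH {P : ℂ → Prop} :
    (∀ᶠ z in infH, P z) ↔ ∃ N : ℝ, ∀ z ∈ halfPlane, N ≤ ‖z‖ → P z := by
  rw [infH, eventually_inf_principal, ← Metric.cobounded_eq_cocompact,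
    (hasBasis_cobounded_norm (E := ℂ)).eventually_iff]
  simp only [true_and, mem_ofPred_eq]
  exact exists_congr fun N ↦ ⟨fun h z hz hn ↦ h hn hz, fun h z hn hz ↦ h z hz hn⟩

lemma tendsto_infH {f : ℂ → ℂ} {a : ℂ} : Tendsto f infH (𝓝 a) ↔
    ∀ ε > 0, ∃ N : ℝ, ∀ z ∈ halfPlane, N ≤ ‖z‖ → ‖f z - a‖ < ε := by
  rw [Metric.tendsto_nhds]
  simp only [eventually_infH, dist_eq_norm]

/-- No boundary values on the real line are assumed, so the maximum principle is applied to a disc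
cut off at height `δ`. -/
lemma im_le_of_truncated {f : ℂ → ℂ} {δ N M : ℝ} (hd : DifferentiableOn ℂ f halfPlane) (hδ : 0 < δ)
    (h1 : ∀ z : ℂ, z.im = δ → ‖z‖ ≤ N → (f z).im ≤ M)
    (h2 : ∀ z : ℂ, δ ≤ z.im → ‖z‖ = N → (f z).im ≤ M) {z : ℂ} (hz : δ < z.im) (hzN : ‖z‖ < N) :
    (f z).im ≤ M := by
  set U : Set ℂ := {z | δ < z.im ∧ ‖z‖ < N}
  have hO : IsOpen U := (isOpen_lt continuous_const Complex.continuous_im).inter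
    (isOpen_lt continuous_norm continuous_const)
  have hcl : closure U ⊆ {z | δ ≤ z.im ∧ ‖z‖ ≤ N} := by
    refine closure_minimal (fun z hz ↦ ⟨hz.1.le, hz.2.le⟩) ?_
    exact (isClosed_le continuous_const Complex.continuous_im).inter
      (isClosed_le continuous_norm continuous_const)
  have hb : Bornology.IsBounded U :=
    isBounded_closedBall.subset (fun z hz ↦ by simpa using hz.2.le : U ⊆ closedBall 0 N)
  refine im_le_of_forall_mem_frontier hb ?_ ?_ (z := z) ⟨hz, hzN⟩
  · refine DifferentiableOn.diffContOnCl (hd.mono fun x hx ↦ ?_)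
    exact hδ.trans_le (hcl hx).1
  · intro x hx
    rw [hO.frontier_eq] at hx
    obtain ⟨hx1, hx2⟩ := hcl hx.1
    rcases hx1.eq_or_lt with h | h
    · exact h1 x h.symm hx2
    · rcases hx2.eq_or_lt with h' | h'
      · exact h2 x hx1 h'
      · exact absurd ⟨h, h'⟩ hx.2

/-- `h : ℍ → Ω ⊆ ℍ` is conformal with inverse `G`, `h(w) - w → 0` and `w (h(w) - w) → -c` as
`w → ∞`. -/
structure HydroPair (h G : ℂ → ℂ) (Ω : Set ℂ) (c : ℝ) : Prop extends
    ConformalPair h G halfPlane Ω where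
  subset : Ω ⊆ halfPlane
  mem_infH : Ω ∈ infH
  tendsto : Tendsto (fun w ↦ h w - w) infH (𝓝 0)
  tendsto_inv : Tendsto (fun z ↦ G z - z) infH (𝓝 0)
  hcap : Tendsto (fun w ↦ w * (h w - w)) infH (𝓝 (-(c : ℂ)))

namespace HydroPair
variable {h G : ℂ → ℂ} {Ω : Set ℂ} {c : ℝ}

lemma im_pos (H : HydroPair h G Ω c) {w : ℂ} (hw : 0 < w.im) : 0 < (h w).im :=
  H.subset (H.mapsTo w hw)

lemma diff_sub (H : HydroPair h G Ω c) : DifferentiableOn ℂ (fun w ↦ h w - w) halfPlane :=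
  H.diff.sub differentiableOn_id

/-- Maximum principle for `-Im (h - w)`: it is at most `ε` at height `δ ≤ ε`, because `Im h > 0`,
and on a large circle, because `h(w) - w → 0`. -/
lemma im_le (H : HydroPair h G Ω c) {w : ℂ} (hw : 0 < w.im) : w.im ≤ (h w).im := by
  refine le_of_forall_pos_le_add fun ε hε ↦ ?_
  obtain ⟨N, hN⟩ := tendsto_infH.1 H.tendsto ε hε
  have hδ : 0 < min ε (w.im / 2) := lt_min hε (by linarith)
  have := im_le_of_truncated (f := fun w ↦ -(h w - w)) (δ := min ε (w.im / 2))
    (N := max N (‖w‖ + 1)) (M := ε) H.diff_sub.neg hδ ?_ ?_ (z := w)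
    ((min_le_right _ _).trans_lt (by linarith)) ((lt_add_one _).trans_le (le_max_right _ _))
  · simp at this; linarith
  · intro z hz _
    have := H.im_pos (w := z) (hz ▸ hδ)
    simp
    linarith [min_le_left ε (w.im / 2)]
  · intro z hz hzN
    have h1 := hN z (hδ.trans_le hz) (hzN ▸ le_max_left _ _)
    rw [sub_zero] at h1
    have h2 := (abs_le.1 (Complex.abs_im_le_norm (h z - z))).1
    simp only [Complex.neg_im]
    linarith

lemma tendsto_I_mul_infH : Tendsto (fun y : ℝ ↦ (y : ℂ) * Complex.I) atTop infH := by
  intro s hs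
  obtain ⟨N, hN⟩ := eventually_infH.1 (show ∀ᶠ z in infH, z ∈ s from hs)
  rw [mem_map]
  filter_upwards [eventually_ge_atTop N, eventually_gt_atTop (0 : ℝ)] with y hy hy0
  refine hN _ (by simpa [halfPlane] using hy0) ?_
  rw [norm_mul, Complex.norm_I, mul_one, Complex.norm_real, Real.norm_of_nonneg hy0.le]
  exact hy

/-- Schwarz–Pick for `q = h - id` at the points `w` and `iy`, divided by `y`. As `y → ∞`, `y · Im
q(iy) → c` and `q(iy) → 0`, so the capacity replaces the value at the second point. -/
lemma normSq_sub_mul_im_le (H : HydroPair h G Ω c) {w : ℂ} (hw : 0 < w.im) :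
    ‖h w - w‖ ^ 2 * w.im ≤ c * (h w - w).im := by
  set q : ℂ → ℂ := fun w ↦ h w - w with hq
  have hqi : ∀ z ∈ halfPlane, 0 ≤ (q z).im := fun z hz ↦ by
    simp only [hq, Complex.sub_im]; linarith [H.im_le hz]
  have h1 : ∀ᶠ y : ℝ in atTop,
      ‖q w - (starRingEnd ℂ) (q (y * Complex.I))‖ ^ 2 * w.im ≤
      ‖w * ((y⁻¹ : ℝ) : ℂ) + Complex.I‖ ^ 2 *
        ((q w).im * (-((y * Complex.I) * q (y * Complex.I)).re)) := by
    filter_upwards [eventually_gt_atTop (0 : ℝ)] with y hy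
    have := schwarz_pick_halfPlane H.diff_sub hqi hw (w := y * Complex.I) (by simpa using hy)
    have e1 : w - (starRingEnd ℂ) (y * Complex.I) = y * (w * ((y⁻¹ : ℝ) : ℂ) + Complex.I) := by
      have : (y : ℂ) ≠ 0 := by exact_mod_cast hy.ne'
      simp; field_simp
    have e2 : -((y * Complex.I) * q (y * Complex.I)).re = y * (q (y * Complex.I)).im := by simp
    rw [e1, norm_mul, Complex.norm_real, Real.norm_of_nonneg hy.le] at this
    rw [e2]
    have e3 : ((y : ℂ) * Complex.I).im = y := by simp
    rw [e3] at this
    refine le_of_mul_le_mul_right ?_ hy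
    calc _ = ‖q w - (starRingEnd ℂ) (q (y * Complex.I))‖ ^ 2 * (w.im * y) := by ring
      _ ≤ _ := this
      _ = _ := by ring
  have hT := H.tendsto.comp tendsto_I_mul_infH
  have hC := H.hcap.comp tendsto_I_mul_infH
  have l1 : Tendsto (fun y : ℝ ↦ ‖q w - (starRingEnd ℂ) (q (y * Complex.I))‖ ^ 2 * w.im) atTop
      (𝓝 (‖q w - (starRingEnd ℂ) 0‖ ^ 2 * w.im)) :=
    (((((Complex.continuous_conj.tendsto _).comp hT).const_sub (q w)).norm).pow 2).mul_const _
  have l2 : Tendsto (fun y : ℝ ↦ ‖w * ((y⁻¹ : ℝ) : ℂ) + Complex.I‖ ^ 2 *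
        ((q w).im * (-((y * Complex.I) * q (y * Complex.I)).re))) atTop
      (𝓝 (‖w * ((0 : ℝ) : ℂ) + Complex.I‖ ^ 2 * ((q w).im * (-(-(c : ℂ)).re)))) := by
    refine Tendsto.mul ?_ (Tendsto.const_mul _ ((Complex.continuous_re.tendsto _).comp hC).neg)
    exact ((((Complex.continuous_ofReal.tendsto _).comp
      tendsto_inv_atTop_zero).const_mul w).add_const _).norm.pow 2
  have := le_of_tendsto_of_tendsto l1 l2 h1
  simp [hq] at this ⊢
  linarith

lemma hcap_nonneg (H : HydroPair h G Ω c) : 0 ≤ c := by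
  have hC := (Complex.continuous_re.tendsto _).comp (H.hcap.comp tendsto_I_mul_infH)
  have : (-(c : ℂ)).re ≤ 0 := le_of_tendsto hC (by
    filter_upwards [eventually_gt_atTop (0 : ℝ)] with y hy
    have := H.im_le (w := y * Complex.I) (by simpa using hy)
    simp at this ⊢
    nlinarith)
  simpa using this

/-- The previous inequality divided by `‖h w - w‖`. This displacement bound stands in for the
Loewner differential equation. -/
lemma norm_sub_le_div (H : HydroPair h G Ω c) {w : ℂ} (hw : 0 < w.im) : ‖h w - w‖ ≤ c / w.im := by
  have h1 := H.normSq_sub_mul_im_le hw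
  have h2 := (le_abs_self _).trans (Complex.abs_im_le_norm (h w - w))
  rw [le_div_iff₀ hw]
  rcases (norm_nonneg (h w - w)).eq_or_lt with h0 | h0
  · rw [← h0, zero_mul]; exact H.hcap_nonneg
  · refine le_of_mul_le_mul_left ?_ h0
    nlinarith [H.hcap_nonneg]

end HydroPair

/-! ### Normalized maps outside the hull: boundary behaviour and reflection. -/

/-- Radius outside which `h` is controlled when `ℍ \ h(ℍ)` lies in the disc of radius `δ` and `h`
has half-plane capacity `c`. -/
def hullRad (δ c : ℝ) : ℝ := 150 * (δ + √c)

lemma hullRad_pos {δ c : ℝ} (hδ : 0 < δ) : 0 < hullRad δ c := by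
  unfold hullRad; positivity

lemma convex_im_ge (y : ℝ) : Convex ℝ {z : ℂ | y ≤ z.im} := convex_halfSpace_im_ge y

namespace HydroPair
variable {h G : ℂ → ℂ} {Ω : Set ℂ} {c δ : ℝ}

lemma symm_im_pos (H : HydroPair h G Ω c) {z : ℂ} (hz : z ∈ Ω) : 0 < (G z).im :=
  H.mapsTo_symm z hz

lemma symm_im_le (H : HydroPair h G Ω c) {z : ℂ} (hz : z ∈ Ω) : (G z).im ≤ z.im := by
  have := H.im_le (H.symm_im_pos hz)
  rwa [H.right_inv z hz] at this

/-- On the disc of radius `Im z / 2` about `z`, which avoids the hull, both `Im G(w)` and `Im w` lie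
in `(0, (3/2) Im z]`. The gradient estimate gives `6 · (3/2) / (1/2) = 18`. -/
lemma norm_deriv_symm_sub_le (H : HydroPair h G Ω c)
    (hΩ : ∀ z ∈ halfPlane, δ < ‖z‖ → z ∈ Ω) {z : ℂ} (hz : 0 < z.im) (hzn : 2 * δ ≤ ‖z‖) :
    ‖deriv (fun z ↦ G z - z) z‖ ≤ 18 := by
  have him : z.im ≤ ‖z‖ := (le_abs_self _).trans (Complex.abs_im_le_norm z)
  have hb : ∀ w ∈ ball z (z.im / 2), w ∈ Ω ∧ w.im ≤ 3 / 2 * z.im := by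
    intro w hw
    rw [mem_ball, dist_eq_norm] at hw
    have h1 := abs_le.1 ((Complex.abs_im_le_norm (w - z)).trans hw.le)
    rw [Complex.sub_im] at h1
    have h2 : ‖z‖ - ‖w - z‖ ≤ ‖w‖ := by
      have := norm_sub_norm_le z (z - w)
      rw [sub_sub_cancel, norm_sub_rev] at this
      linarith
    refine ⟨hΩ w ?_ (by linarith), by linarith [h1.2]⟩
    change 0 < w.im
    linarith [h1.1]
  have := norm_deriv_le_of_abs_im_le (f := fun z ↦ G z - z) (c := z) (r := z.im / 2)
    (M := 3 / 2 * z.im) (by linarith) (by linarith)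
    ((H.diff_symm.sub differentiableOn_id).mono fun w hw ↦ (hb w hw).1) fun w hw ↦ by
      have h1 := H.symm_im_pos (hb w hw).1
      have h2 := H.symm_im_le (hb w hw).1
      rw [Complex.sub_im, abs_le]
      constructor <;> linarith [(hb w hw).2]
  refine this.trans (le_of_eq ?_)
  field_simp; norm_num

lemma norm_symm_sub_sub_le (H : HydroPair h G Ω c) (hδ : 0 < δ)
    (hΩ : ∀ z ∈ halfPlane, δ < ‖z‖ → z ∈ Ω) {s : Set ℂ} (hs : Convex ℝ s)
    (hsub : ∀ z ∈ s, 0 < z.im ∧ 2 * δ ≤ ‖z‖) {z w : ℂ} (hz : z ∈ s) (hw : w ∈ s) :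
    ‖(G w - w) - (G z - z)‖ ≤ 18 * ‖w - z‖ := by
  refine hs.norm_image_sub_le_of_norm_deriv_le (f := fun z ↦ G z - z) (fun x hx ↦ ?_)
    (fun x hx ↦ H.norm_deriv_symm_sub_le hΩ (hsub x hx).1 (hsub x hx).2) hz hw
  have hxΩ : x ∈ Ω := hΩ x (hsub x hx).1 (by linarith [(hsub x hx).2])
  exact (H.diff_symm.differentiableAt (H.open_target.mem_nhds hxΩ)).sub differentiableAt_id

/-- `G - id` is small at one high point `z₀`, and its derivative is bounded off the disc of radius
`2δ`. The bound travels to `z` along a segment in `{Im ≥ 2δ}` followed by a vertical one, both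
outside that disc. -/
lemma norm_symm_le (H : HydroPair h G Ω c) (hδ : 0 < δ)
    (hΩ : ∀ z ∈ halfPlane, δ < ‖z‖ → z ∈ Ω) {z : ℂ} (hz : 0 < z.im) (hzn : ‖z‖ = 2 * δ) :
    ‖G z‖ ≤ hullRad δ c := by
  have hc := H.hcap_nonneg
  have hsc : √c * √c = c := Real.mul_self_sqrt hc
  have hs0 := Real.sqrt_nonneg c
  -- At this height the displacement `c / Y` is at most `√c`, and `h (Y i)` lies above height `2δ`.
  set Y : ℝ := 2 * δ + √c with hY
  have hY0 : 0 < Y := by positivity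
  set w₀ : ℂ := Y * Complex.I
  have hw₀i : w₀.im = Y := by simp [w₀]
  have hw₀n : ‖w₀‖ = Y := by
    simp [w₀, abs_of_pos hY0]
  have hw₀ : 0 < w₀.im := hw₀i ▸ hY0
  set z₀ := h w₀
  have hz₀Ω : z₀ ∈ Ω := H.mapsTo w₀ hw₀
  have hz₀ : 2 * δ ≤ z₀.im := by linarith [H.im_le hw₀]
  have hf₀ : ‖G z₀ - z₀‖ ≤ √c := by
    rw [H.left_inv w₀ hw₀, norm_sub_rev]
    refine (H.norm_sub_le_div hw₀).trans ?_
    rw [hw₀i, div_le_iff₀ hY0]; nlinarith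
  have hz₀n : ‖z₀‖ ≤ 2 * δ + 2 * √c := by
    have h1 : ‖z₀‖ ≤ ‖z₀ - w₀‖ + ‖w₀‖ := by simpa using norm_add_le (z₀ - w₀) w₀
    have h2 : ‖z₀ - w₀‖ ≤ √c := by
      rw [H.left_inv w₀ hw₀, norm_sub_rev] at hf₀; exact hf₀
    linarith
  set z₁ : ℂ := z + (2 * δ : ℝ) * Complex.I
  have hz₁i : z₁.im = z.im + 2 * δ := by simp [z₁]
  have hd1 : ‖z₁ - z‖ = 2 * δ := by
    simp [z₁, abs_of_pos hδ]
  have h1 := H.norm_symm_sub_sub_le hδ hΩ (s := {x | x.re = z.re ∧ z.im ≤ x.im})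
    (z := z₁) (w := z)
    ((convex_hyperplane (f := Complex.re) Complex.reLm.isLinear z.re).inter (convex_im_ge z.im))
    (fun x hx ↦ ⟨hz.trans_le hx.2, by
      rw [← hzn, ← sq_le_sq₀ (norm_nonneg _) (norm_nonneg _), Complex.sq_norm, Complex.sq_norm,
        Complex.normSq_apply, Complex.normSq_apply, hx.1]
      nlinarith [hx.2]⟩) ⟨by simp [z₁], by rw [hz₁i]; linarith⟩ ⟨rfl, le_rfl⟩
  have h2 := H.norm_symm_sub_sub_le hδ hΩ (s := {x | 2 * δ ≤ x.im}) (z := z₀) (w := z₁)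
    (convex_im_ge _) (fun x (hx : 2 * δ ≤ x.im) ↦ ⟨by linarith,
      hx.trans ((le_abs_self _).trans (Complex.abs_im_le_norm x))⟩) hz₀
      (show 2 * δ ≤ z₁.im by rw [hz₁i]; linarith)
  rw [norm_sub_rev z z₁, hd1] at h1
  have hz₁n : ‖z₁‖ ≤ 4 * δ := by
    have : ‖z₁‖ ≤ ‖z₁ - z‖ + ‖z‖ := by simpa using norm_add_le (z₁ - z) z
    linarith
  have h3 : ‖z₁ - z₀‖ ≤ 6 * δ + 2 * √c := (norm_sub_le _ _).trans (by linarith)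
  have h4 : ‖G z‖ ≤ ‖(G z - z) - (G z₁ - z₁)‖ + ‖(G z₁ - z₁) - (G z₀ - z₀)‖ + ‖G z₀ - z₀‖ + ‖z‖ := by
    have e : G z = ((G z - z) - (G z₁ - z₁)) + ((G z₁ - z₁) - (G z₀ - z₀)) + (G z₀ - z₀) + z := by ring
    conv_lhs => rw [e]
    exact (norm_add_le _ _).trans (add_le_add_left ((norm_add_le _ _).trans
      (add_le_add_left (norm_add_le _ _) _)) _)
  -- The pieces add up to `18 · 2δ + 18 (6δ + 2√c) + √c + 2δ = 146δ + 37√c`.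
  unfold hullRad
  linarith

lemma continuousAt (H : HydroPair h G Ω c) {w : ℂ} (hw : 0 < w.im) : ContinuousAt h w :=
  (H.diff.differentiableAt (isOpen_halfPlane.mem_nhds hw)).continuousAt

/-- Otherwise, moving outwards along the ray through `w`, `‖h‖` would take the value `2δ` at a point
of modulus at least `‖w‖`, contrary to `norm_symm_le`. -/
lemma lt_norm (H : HydroPair h G Ω c) (hδ : 0 < δ) (hΩ : ∀ z ∈ halfPlane, δ < ‖z‖ → z ∈ Ω)
    {w : ℂ} (hw : 0 < w.im) (hwn : hullRad δ c < ‖w‖) : 2 * δ < ‖h w‖ := by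
  by_contra! hle
  have hw0 : 0 < ‖w‖ := (hullRad_pos hδ).trans hwn
  obtain ⟨N, hN⟩ := tendsto_infH.1 H.tendsto 1 one_pos
  set t₁ : ℝ := 1 + (|N| + 2 * δ + 1) / ‖w‖
  have ht₁ : 1 ≤ t₁ := le_add_of_nonneg_right (by positivity)
  have him : ∀ t : ℝ, 1 ≤ t → 0 < (t * w).im := fun t ht ↦ by simp; nlinarith
  have hnm : ∀ t : ℝ, 1 ≤ t → ‖(t : ℂ) * w‖ = t * ‖w‖ := fun t ht ↦ by
    rw [norm_mul, Complex.norm_real, Real.norm_of_nonneg (by linarith)]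
  have hcont : ContinuousOn (fun t : ℝ ↦ ‖h (t * w)‖) (Icc 1 t₁) := fun t ht ↦ by
    refine (ContinuousAt.norm ?_).continuousWithinAt
    exact ContinuousAt.comp (g := h) (H.continuousAt (him t ht.1)) (by fun_prop)
  have hend : 2 * δ ≤ ‖h (t₁ * w)‖ := by
    have e : ‖(t₁ : ℂ) * w‖ = ‖w‖ + (|N| + 2 * δ + 1) := by
      rw [hnm t₁ ht₁]; simp only [t₁]; field_simp
    have h1 := hN (t₁ * w) (him t₁ ht₁) (by rw [e]; linarith [le_abs_self N])
    rw [sub_zero] at h1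
    have h2 := norm_sub_norm_le (t₁ * w) (t₁ * w - h (t₁ * w))
    rw [sub_sub_cancel, norm_sub_rev] at h2
    linarith [abs_nonneg N]
  obtain ⟨t, ht, hte⟩ := intermediate_value_Icc ht₁ hcont
    (show 2 * δ ∈ Icc _ _ from ⟨by simpa using hle, hend⟩)
  have h1 := H.norm_symm_le hδ hΩ (H.im_pos (him t ht.1)) hte
  rw [H.left_inv _ (him t ht.1), hnm t ht.1] at h1
  nlinarith [ht.1]

lemma exists_norm_le (H : HydroPair h G Ω c) (N : ℝ) :
    ∃ M, ∀ w ∈ halfPlane, ‖w‖ ≤ N → ‖h w‖ ≤ M := by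
  obtain ⟨K, hK⟩ := tendsto_infH.1 H.tendsto_inv 1 one_pos
  refine ⟨max K (N + 1), fun w hw hwN ↦ ?_⟩
  by_contra! hlt
  have h1 := hK (h w) (H.im_pos hw) ((le_max_left _ _).trans hlt.le)
  rw [sub_zero, H.left_inv w hw] at h1
  have h2 := norm_sub_norm_le (h w) (h w - w)
  rw [sub_sub_cancel, norm_sub_rev] at h2
  linarith [le_max_right K (N + 1)]

/-- The boundary values of `h` beyond `hullRad` are real: otherwise `h w` would lie in a compact
subset of `Ω`, where `Im G` has a positive minimum. -/
lemma exists_im_lt (H : HydroPair h G Ω c) (hδ : 0 < δ) (hΩ : ∀ z ∈ halfPlane, δ < ‖z‖ → z ∈ Ω)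
    (N : ℝ) {η : ℝ} (hη : 0 < η) : ∃ m > 0, ∀ w ∈ halfPlane, hullRad δ c < ‖w‖ → ‖w‖ ≤ N →
      w.im < m → (h w).im < η := by
  obtain ⟨M, hM⟩ := H.exists_norm_le N
  set K : Set ℂ := {z | η ≤ z.im ∧ 2 * δ ≤ ‖z‖ ∧ ‖z‖ ≤ M}
  have hKΩ : K ⊆ Ω := fun z hz ↦ hΩ z (hη.trans_le hz.1) (by linarith [hz.2.1])
  have hKc : IsCompact K := by
    refine Metric.isCompact_of_isClosed_isBounded ?_
      (isBounded_closedBall.subset (fun z hz ↦ by simpa using hz.2.2 : K ⊆ closedBall 0 M))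
    exact (isClosed_le continuous_const Complex.continuous_im).inter
      ((isClosed_le continuous_const continuous_norm).inter
      (isClosed_le continuous_norm continuous_const))
  have hGc : ContinuousOn (fun z ↦ (G z).im) K :=
    Complex.continuous_im.comp_continuousOn (H.diff_symm.continuousOn.mono hKΩ)
  have : ∃ m > 0, ∀ z ∈ K, m ≤ (G z).im := by
    rcases K.eq_empty_or_nonempty with he | hne
    · exact ⟨1, one_pos, by simp [he]⟩
    · obtain ⟨z, hz, hmin⟩ := hKc.exists_isMinOn hne hGc
      exact ⟨(G z).im, H.symm_im_pos (hKΩ hz), fun x hx ↦ hmin hx⟩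
  obtain ⟨m, hm, hmK⟩ := this
  refine ⟨m, hm, fun w hw hwn hwN hwm ↦ ?_⟩
  by_contra! hlt
  have := hmK (h w) ⟨hlt, (H.lt_norm hδ hΩ hw hwn).le, hM w hw hwN⟩
  rw [H.left_inv w hw] at this
  linarith

/-- The Stieltjes property: `σ (w - σ a) (h(w) - w)` has nonpositive imaginary part. -/
lemma im_mul_nonpos (H : HydroPair h G Ω c) (hδ : 0 < δ) (hΩ : ∀ z ∈ halfPlane, δ < ‖z‖ → z ∈ Ω)
    {σ : ℝ} (hσ : σ = 1 ∨ σ = -1) {w : ℂ} (hw : 0 < w.im) :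
    (σ * w.re - hullRad δ c) * (h w - w).im + σ * w.im * (h w - w).re ≤ 0 := by
  set a := hullRad δ c
  -- Maximum principle for `Im f`. Near the real line its main term is `(σ x - a) · Im (h - w)`: for
  -- `σ x ≤ a` it is nonpositive, and for `σ x > a` it is small because `Im h` is. At infinity `f`
  -- tends to the real number `-σ c`.
  set f : ℂ → ℂ := fun w ↦ ((σ : ℂ) * w - (a : ℂ)) * (h w - w)
  have hf : ∀ w, (f w).im = (σ * w.re - a) * (h w - w).im + σ * w.im * (h w - w).re := by
    intro w; simp [f]
  rw [← hf]
  refine le_of_forall_pos_le_add fun ε hε ↦ ?_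
  rw [zero_add]
  have hσa : |σ| = 1 := by rcases hσ with rfl | rfl <;> simp
  have hlim : Tendsto f infH (𝓝 (-(σ * c : ℝ))) := by
    have h1 := (H.hcap.const_mul (σ : ℂ)).sub (H.tendsto.const_mul (a : ℂ))
    refine (h1.congr fun w ↦ ?_).trans (by simp)
    simp only [f]; ring
  obtain ⟨N₀, hN₀⟩ := tendsto_infH.1 hlim ε hε
  set N := max N₀ (‖w‖ + 1)
  have hN0 : 0 < N := lt_of_lt_of_le (by positivity) (le_max_right _ _)
  obtain ⟨M, hM⟩ := H.exists_norm_le N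
  have hQ : ∀ z ∈ halfPlane, ‖z‖ ≤ N → ‖h z - z‖ ≤ |M| + N := fun z hz hzN ↦
    (norm_sub_le _ _).trans (add_le_add ((hM z hz hzN).trans (le_abs_self M)) hzN)
  set Q := |M| + N
  have hQ0 : 0 < Q := by positivity
  obtain ⟨m, hm, hmI⟩ := H.exists_im_lt hδ hΩ N (η := ε / (2 * N)) (by positivity)
  -- The truncation height lies below `m`, where `Im h` is controlled, below `w`, and is small
  -- enough that the term `σ · d · Re (h - w)` costs at most `ε / 2`.
  set d := min (m / 2) (min (ε / (2 * Q)) (w.im / 2))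
  have hd0 : 0 < d := lt_min (by linarith) (lt_min (by positivity) (by linarith))
  have hd1 : d < m := (min_le_left _ _).trans_lt (by linarith)
  have hd2 : d * Q ≤ ε / 2 := by
    calc d * Q ≤ ε / (2 * Q) * Q := by
          gcongr; exact (min_le_right _ _).trans (min_le_left _ _)
      _ = ε / 2 := by field_simp
  have hd3 : d < w.im := ((min_le_right _ _).trans (min_le_right _ _)).trans_lt (by linarith)
  refine im_le_of_truncated (N := N) (δ := d) ?_ hd0 ?_ ?_ hd3
    ((lt_add_one _).trans_le (le_max_right _ _))
  · exact ((differentiable_id.const_mul _).sub_const _).differentiableOn.mul H.diff_sub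
  · intro z hz hzN
    have hzH : z ∈ halfPlane := by change 0 < z.im; linarith
    rw [hf, hz]
    have hre : σ * d * (h z - z).re ≤ d * Q := by
      have h1 := (Complex.abs_re_le_norm (h z - z)).trans (hQ z hzH hzN)
      calc σ * d * (h z - z).re ≤ |σ * d * (h z - z).re| := le_abs_self _
        _ = d * |(h z - z).re| := by rw [abs_mul, abs_mul, hσa, abs_of_pos hd0, one_mul]
        _ ≤ d * Q := by gcongr
    have hq0 : 0 ≤ (h z - z).im := by rw [Complex.sub_im]; linarith [H.im_le hzH]
    rcases le_or_gt (σ * z.re) a with hle | hgt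
    · have : (σ * z.re - a) * (h z - z).im ≤ 0 := mul_nonpos_of_nonpos_of_nonneg (by linarith) hq0
      linarith
    · have hzn : σ * z.re ≤ ‖z‖ := by
        calc σ * z.re ≤ |σ * z.re| := le_abs_self _
          _ = |z.re| := by rw [abs_mul, hσa, one_mul]
          _ ≤ ‖z‖ := Complex.abs_re_le_norm z
      have h1 := hmI z hzH (by linarith) hzN (by linarith)
      have h2 : (σ * z.re - a) * (h z - z).im ≤ N * (ε / (2 * N)) := by
        refine mul_le_mul ?_ ?_ hq0 hN0.le
        · linarith [hullRad_pos (c := c) hδ]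
        · rw [Complex.sub_im]; linarith
      have h3 : N * (ε / (2 * N)) = ε / 2 := by field_simp
      linarith
  · intro z hz hzN
    have h1 := hN₀ z (hd0.trans_le hz) (hzN ▸ le_max_left _ _)
    have h2 := (abs_le.1 ((Complex.abs_im_le_norm _).trans h1.le)).2
    simpa using h2

/-- In `im_mul_nonpos` the first term is now nonnegative, so the second is nonpositive: `h` moves
such points back towards the hull. -/
lemma re_le_of_lt (H : HydroPair h G Ω c) (hδ : 0 < δ) (hΩ : ∀ z ∈ halfPlane, δ < ‖z‖ → z ∈ Ω)
    {σ : ℝ} (hσ : σ = 1 ∨ σ = -1) {w : ℂ} (hw : 0 < w.im) (hre : hullRad δ c < σ * w.re) :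
    σ * (h w).re ≤ σ * w.re := by
  have h1 := H.im_mul_nonpos hδ hΩ hσ hw
  have h2 : 0 ≤ (σ * w.re - hullRad δ c) * (h w - w).im :=
    mul_nonneg (by linarith) (by rw [Complex.sub_im]; linarith [H.im_le hw])
  have h3 : w.im * (σ * (h w - w).re) ≤ 0 := by linarith
  have := nonpos_of_mul_nonpos_right h3 hw
  rw [Complex.sub_re] at this
  linarith

/-- The Stieltjes property bounds `s · Im (h - w)` by `M · Im w`. This linear vanishing at the real
line supplies the derivative bound needed for reflection. -/
lemma im_sub_le (H : HydroPair h G Ω c) (hδ : 0 < δ) (hΩ : ∀ z ∈ halfPlane, δ < ‖z‖ → z ∈ Ω)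
    {w : ℂ} (hw : 0 < w.im) {M s : ℝ} (hs : 0 < s) (hre : hullRad δ c + s ≤ |w.re|)
    (hM : ‖h w - w‖ ≤ M) : (h w).im ≤ (1 + M / s) * w.im := by
  obtain ⟨σ, hσ, hσr⟩ : ∃ σ : ℝ, (σ = 1 ∨ σ = -1) ∧ σ * w.re = |w.re| := by
    rcases abs_choice w.re with h | h
    · exact ⟨1, Or.inl rfl, by rw [h, one_mul]⟩
    · exact ⟨-1, Or.inr rfl, by rw [h]; ring⟩
  have h1 := H.im_mul_nonpos hδ hΩ hσ hw
  have hq0 : 0 ≤ (h w - w).im := by rw [Complex.sub_im]; linarith [H.im_le hw]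
  have h2 : -(σ * (h w - w).re) ≤ M := by
    have h3 := (Complex.abs_re_le_norm (h w - w)).trans hM
    rcases hσ with rfl | rfl
    · linarith [(abs_le.1 h3).1]
    · linarith [(abs_le.1 h3).2]
  have h4 : s * (h w - w).im ≤ w.im * M := by
    calc s * (h w - w).im ≤ (σ * w.re - hullRad δ c) * (h w - w).im := by
          gcongr; rw [hσr]; linarith
      _ ≤ w.im * (-(σ * (h w - w).re)) := by linarith
      _ ≤ _ := by gcongr
  have h5 : (h w - w).im ≤ M / s * w.im := by
    rw [div_mul_eq_mul_div, le_div_iff₀ hs]; linarith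
  rw [Complex.sub_im] at h5
  linarith

/-- The map `h` extends by reflection to a neighbourhood of `∞`. -/
lemma exists_extension (H : HydroPair h G Ω c) (hδ : 0 < δ)
    (hΩ : ∀ z ∈ halfPlane, δ < ‖z‖ → z ∈ Ω) :
    ∃ F : ℂ → ℂ, DifferentiableOn ℂ F {w | hullRad δ c < ‖w‖} ∧
      (∀ w ∈ halfPlane, hullRad δ c < ‖w‖ → F w = h w) ∧
      (∀ w, hullRad δ c < ‖w‖ → 2 * δ ≤ ‖F w‖) ∧ Tendsto F (cocompact ℂ) (cocompact ℂ) := by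
  set a := hullRad δ c
  have ha : 0 < a := hullRad_pos hδ
  set V : Set ℂ := {w | a < ‖w‖}
  have hV : IsOpen V := isOpen_lt continuous_const continuous_norm
  have hlin : ∀ x ∈ V, x.im = 0 → ∃ r > 0, ∃ C > 0, ∀ w ∈ ball x r ∩ halfPlane,
      (h w).im ≤ C * w.im := by
    intro x hx hx0
    have hxn : ‖x‖ = |x.re| := by
      rw [← sq_eq_sq₀ (norm_nonneg _) (abs_nonneg _), Complex.sq_norm, Complex.normSq_apply, hx0,
        sq_abs]
      ring
    have hxV : a < |x.re| := hxn ▸ hx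
    obtain ⟨M, hM⟩ := H.exists_norm_le (‖x‖ + (|x.re| - a) / 2)
    set Q := |M| + (‖x‖ + (|x.re| - a) / 2)
    have hQ : 0 ≤ Q := by
      have := abs_nonneg M; have := norm_nonneg x
      simp only [Q]; linarith
    refine ⟨(|x.re| - a) / 2, by linarith, 1 + Q / ((|x.re| - a) / 2), ?_, ?_⟩
    · have : 0 ≤ Q / ((|x.re| - a) / 2) := div_nonneg hQ (by linarith)
      linarith
    · rintro w ⟨hw, hwH⟩
      rw [mem_ball, dist_eq_norm] at hw
      have hwn : ‖w‖ ≤ ‖x‖ + (|x.re| - a) / 2 := by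
        have : ‖w‖ ≤ ‖w - x‖ + ‖x‖ := by simpa using norm_add_le (w - x) x
        linarith
      refine H.im_sub_le hδ hΩ hwH (by linarith) ?_
        ((norm_sub_le _ _).trans (add_le_add ((hM w hwH hwn).trans (le_abs_self M)) hwn))
      have h1 := (Complex.abs_re_le_norm (w - x)).trans hw.le
      rw [Complex.sub_re] at h1
      have h2 := abs_sub_abs_le_abs_sub x.re w.re
      rw [abs_sub_comm] at h2
      change a + _ ≤ _
      linarith
  -- On the disc of radius `Im z` about `z` one has `0 < Im h ≤ 2C · Im z`, so the gradient estimate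
  -- gives `12 C`.
  have hb₁ : ∀ x ∈ V, x.im = 0 → ∃ r > 0, ∃ C, ∀ z ∈ ball x r ∩ halfPlane, ‖deriv h z‖ ≤ C := by
    intro x hx hx0
    obtain ⟨r, hr, C, hC, hb⟩ := hlin x hx hx0
    refine ⟨r / 2, by linarith, 12 * C, fun z ⟨hz, hzH⟩ ↦ ?_⟩
    have hzi : 0 < z.im := hzH
    rw [mem_ball, dist_eq_norm] at hz
    have hzr : z.im < r / 2 := by
      have := (Complex.abs_im_le_norm (z - x)).trans_lt hz
      rw [Complex.sub_im, hx0, sub_zero] at this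
      exact (le_abs_self _).trans_lt this
    have hsub : ∀ w ∈ ball z z.im, w ∈ ball x r ∩ halfPlane ∧ w.im ≤ 2 * z.im := by
      intro w hw
      rw [mem_ball, dist_eq_norm] at hw
      have h1 := abs_lt.1 ((Complex.abs_im_le_norm (w - z)).trans_lt hw)
      rw [Complex.sub_im] at h1
      refine ⟨⟨?_, ?_⟩, by linarith⟩
      · rw [mem_ball, dist_eq_norm]
        have : ‖w - x‖ ≤ ‖w - z‖ + ‖z - x‖ := by simpa using norm_add_le (w - z) (z - x)
        linarith
      · change 0 < w.im; linarith
    refine (norm_deriv_le_of_abs_im_le (r := z.im) (M := C * (2 * z.im)) hzi (by positivity)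
      (H.diff.mono fun w hw ↦ (hsub w hw).1.2) fun w hw ↦ ?_).trans (le_of_eq ?_)
    · rw [abs_of_pos (H.im_pos (hsub w hw).1.2)]
      exact (hb w (hsub w hw).1).trans (by gcongr; exact (hsub w hw).2)
    · field_simp; norm_num
  have hb₂ : ∀ x ∈ V, x.im = 0 → Tendsto (fun z ↦ (h z).im) (𝓝[halfPlane] x) (𝓝 0) := by
    intro x hx hx0
    obtain ⟨r, hr, C, hC, hb⟩ := hlin x hx hx0
    have hlim : Tendsto (fun w : ℂ ↦ C * w.im) (𝓝[halfPlane] x) (𝓝 0) := by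
      have : Continuous fun w : ℂ ↦ C * w.im := by fun_prop
      simpa [hx0] using (this.tendsto x).mono_left (nhdsWithin_le_nhds (s := halfPlane))
    refine squeeze_zero' ?_ ?_ hlim
    · filter_upwards [self_mem_nhdsWithin] with w hw using (H.im_pos hw).le
    · filter_upwards [self_mem_nhdsWithin, mem_nhdsWithin_of_mem_nhds (ball_mem_nhds x hr)]
        with w hw hwb using hb w ⟨hwb, hw⟩
  obtain ⟨F, hFd, hFe, hFc⟩ := exists_reflection (V := V) (h := h) hV
    (fun z hz ↦ by simpa [V] using hz) (H.diff.mono inter_subset_right) hb₁ hb₂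
  -- A closed condition on `F w - w`, invariant under conjugation, passes from the half plane to the
  -- real line by continuity and to the lower half plane by symmetry.
  have hext : ∀ (S : Set ℂ) (P : Set ℂ), IsClosed P → IsOpen S → S ⊆ V →
      (∀ z ∈ S, (starRingEnd ℂ) z ∈ S) → (∀ w ∈ S ∩ halfPlane, (w, F w) ∈ {p : ℂ × ℂ | p.2 - p.1 ∈ P}) →
      (∀ p ∈ P, (starRingEnd ℂ) p ∈ P) → ∀ w ∈ S, F w - w ∈ P := by
    intro S P hP hS hSV hSs hSP hPs w hw
    rcases lt_trichotomy w.im 0 with h0 | h0 | h0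
    · have := hPs _ (hSP ((starRingEnd ℂ) w) ⟨hSs w hw, by simpa [halfPlane] using h0⟩)
      rw [hFc w (hSV hw)] at this
      simpa using this
    · have hcl : (𝓝[halfPlane] w).NeBot := by
        rw [← mem_closure_iff_nhdsWithin_neBot]
        have : closure halfPlane = {z : ℂ | 0 ≤ z.im} := Complex.closure_setOfPred_lt_im 0
        rw [this]; exact h0.ge
      have hc : Tendsto (fun w ↦ F w - w) (𝓝[halfPlane] w) (𝓝 (F w - w)) :=
        ((hFd.continuousOn.continuousAt (hV.mem_nhds (hSV hw))).sub continuousAt_id).tendsto.mono_left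
          nhdsWithin_le_nhds
      refine hP.mem_of_tendsto hc ?_
      filter_upwards [self_mem_nhdsWithin, mem_nhdsWithin_of_mem_nhds (hS.mem_nhds hw)]
        with z hz hzS using hSP z ⟨hzS, hz⟩
    · exact hSP w ⟨hw, h0⟩
  refine ⟨F, hFd, fun w hw hwn ↦ hFe ⟨hwn, hw⟩, ?_, ?_⟩
  · intro w hw
    rcases lt_trichotomy w.im 0 with h0 | h0 | h0
    · have h1 : (starRingEnd ℂ) w ∈ V ∩ halfPlane := ⟨by simpa [V] using hw, by simpa [halfPlane] using h0⟩
      have h2 := H.lt_norm hδ hΩ h1.2 h1.1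
      rw [← hFe h1, hFc w hw, RCLike.norm_conj] at h2
      exact h2.le
    · have hcl : (𝓝[halfPlane] w).NeBot := by
        rw [← mem_closure_iff_nhdsWithin_neBot]
        have : closure halfPlane = {z : ℂ | 0 ≤ z.im} := Complex.closure_setOfPred_lt_im 0
        rw [this]; exact h0.ge
      have hc : Tendsto (fun w ↦ ‖F w‖) (𝓝[halfPlane] w) (𝓝 ‖F w‖) :=
        (hFd.continuousOn.continuousAt (hV.mem_nhds hw)).norm.tendsto.mono_left nhdsWithin_le_nhds
      refine ge_of_tendsto hc ?_
      filter_upwards [self_mem_nhdsWithin, mem_nhdsWithin_of_mem_nhds (hV.mem_nhds hw)] with z hz hzV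
      rw [hFe ⟨hzV, hz⟩]
      exact (H.lt_norm hδ hΩ hz hzV).le
    · rw [hFe ⟨hw, h0⟩]
      exact (H.lt_norm hδ hΩ h0 hw).le
  · obtain ⟨N, hN⟩ := tendsto_infH.1 H.tendsto 1 one_pos
    have hS := hext {w | max N a < ‖w‖} (closedBall 0 1) isClosed_closedBall
      (isOpen_lt continuous_const continuous_norm) (fun w hw ↦ (le_max_right N a).trans_lt (show max N a < ‖w‖ from hw))
      (fun z hz ↦ by simpa using hz) (fun w hw ↦ by
        have h1 := hN w hw.2 ((le_max_left N a).trans hw.1.le)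
        rw [← hFe ⟨(le_max_right N a).trans_lt hw.1, hw.2⟩] at h1
        simpa using h1.le) (fun p hp ↦ by simpa using hp)
    rw [← Metric.cobounded_eq_cocompact, ← tendsto_norm_atTop_iff_cobounded]
    refine tendsto_atTop_mono' _ ?_ (tendsto_norm_cobounded_atTop.atTop_add
      (tendsto_const_nhds (x := (-1 : ℝ))))
    have hev : ∀ᶠ w in Bornology.cobounded ℂ, max N a < ‖w‖ :=
      tendsto_norm_cobounded_atTop.eventually (eventually_gt_atTop _)
    filter_upwards [hev] with w hw
    have h1 := hS w hw
    rw [mem_closedBall_zero_iff] at h1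
    have h2 := norm_sub_norm_le w (w - F w)
    rw [sub_sub_cancel, norm_sub_rev] at h2
    linarith

end HydroPair

/-! ### Polar coordinates in the half plane -/

/-- The strip `0 < Im ζ < π`, mapped onto the half plane by the exponential. -/
def piStrip : Set ℂ := {ζ | 0 < ζ.im ∧ ζ.im < Real.pi}

lemma convex_piStrip : Convex ℝ piStrip :=
  (convex_halfSpace_im_gt 0).inter (convex_halfSpace_im_lt Real.pi)

lemma isOpen_piStrip : IsOpen piStrip :=
  (isOpen_lt continuous_const Complex.continuous_im).inter
    (isOpen_lt Complex.continuous_im continuous_const)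

lemma log_mem_piStrip {z : ℂ} (hz : 0 < z.im) : Complex.log z ∈ piStrip := by
  have h1 : 0 ≤ z.arg := Complex.arg_nonneg_iff.2 hz.le
  have h2 : z.arg ≠ 0 := fun h ↦ hz.ne' (Complex.arg_eq_zero_iff.1 h).2
  have h3 : z.arg ≠ Real.pi := fun h ↦ hz.ne' (Complex.arg_eq_pi_iff.1 h).2
  refine ⟨?_, ?_⟩ <;> rw [Complex.log_im]
  · exact lt_of_le_of_ne h1 (Ne.symm h2)
  · exact lt_of_le_of_ne (Complex.arg_le_pi z) h3

lemma exp_mem_halfPlane {ζ : ℂ} (hζ : ζ ∈ piStrip) : Complex.exp ζ ∈ halfPlane := by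
  change 0 < (Complex.exp ζ).im
  rw [Complex.exp_im]
  exact mul_pos (Real.exp_pos _) (Real.sin_pos_of_pos_of_lt_pi hζ.1 hζ.2)

lemma ne_zero_of_mem_halfPlane {z : ℂ} (hz : z ∈ halfPlane) : z ≠ 0 := by
  rintro rfl; exact lt_irrefl (0 : ℝ) hz

lemma expPair : ConformalPair Complex.exp Complex.log piStrip halfPlane :=
  ⟨isOpen_piStrip, isOpen_halfPlane, Complex.differentiable_exp.differentiableOn,
    fun _ hz ↦ (Complex.differentiableAt_log (Or.inr (ne_of_gt hz))).differentiableWithinAt,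
    fun _ h ↦ exp_mem_halfPlane h, fun _ h ↦ log_mem_piStrip h,
    fun _ h ↦ Complex.log_exp (by linarith [h.1, Real.pi_pos]) h.2.le,
    fun _ h ↦ Complex.exp_log (ne_zero_of_mem_halfPlane h)⟩

/-- In logarithmic coordinates this set is a convex half strip. -/
lemma isPreconnected_halfPlane_norm_gt (N : ℝ) : IsPreconnected {z | z ∈ halfPlane ∧ N < ‖z‖} := by
  rcases le_or_gt N 0 with h | h
  · have : {z | z ∈ halfPlane ∧ N < ‖z‖} = halfPlane :=
      Subset.antisymm (fun z hz ↦ hz.1)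
        fun z hz ↦ ⟨hz, h.trans_lt (norm_pos_iff.2 (ne_zero_of_mem_halfPlane hz))⟩
    rw [this]
    exact (convex_halfSpace_im_gt 0).isPreconnected
  · have : {z | z ∈ halfPlane ∧ N < ‖z‖} = Complex.exp '' (piStrip ∩ {ζ | Real.log N < ζ.re}) := by
      ext z
      constructor
      · rintro ⟨hz, hN⟩
        refine ⟨Complex.log z, ⟨log_mem_piStrip hz, ?_⟩, Complex.exp_log (ne_zero_of_mem_halfPlane hz)⟩
        change Real.log N < _
        rw [Complex.log_re]
        exact Real.log_lt_log h hN
      · rintro ⟨ζ, ⟨h1, h2⟩, rfl⟩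
        refine ⟨exp_mem_halfPlane h1, ?_⟩
        rw [Complex.norm_exp]
        exact (Real.log_lt_iff_lt_exp h).1 h2
    rw [this]
    exact (convex_piStrip.inter (convex_halfSpace_re_gt _)).isPreconnected.image _
      Complex.continuous_exp.continuousOn

/-! ### Construction of normalized maps -/

lemma norm_le_add_of_sub_le {a b : ℂ} {r : ℝ} (h : ‖a - b‖ ≤ r) : ‖a‖ ≤ ‖b‖ + r := by
  have := norm_add_le (a - b) b
  rw [sub_add_cancel] at this
  linarith

lemma tendsto_infH_infH_of_sub {G : ℂ → ℂ} (h : Tendsto (fun z ↦ G z - z) infH (𝓝 0))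
    (hm : ∀ᶠ z in infH, G z ∈ halfPlane) : Tendsto G infH infH := by
  intro s hs
  obtain ⟨N, hN⟩ := eventually_infH.1 (show ∀ᶠ z in infH, z ∈ s from hs)
  obtain ⟨M, hM⟩ := tendsto_infH.1 h 1 one_pos
  obtain ⟨M', hM'⟩ := eventually_infH.1 hm
  refine mem_map.2 (eventually_infH.2 ⟨max (max M M') (N + 1), fun z hz hzn ↦ ?_⟩)
  have h1 := hM z hz (((le_max_left _ _).trans (le_max_left _ _)).trans hzn)
  rw [sub_zero, norm_sub_rev] at h1
  refine hN _ (hM' z hz (((le_max_right _ _).trans (le_max_left _ _)).trans hzn)) ?_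
  linarith [norm_le_add_of_sub_le h1.le, le_max_right (max M M') (N + 1)]

/-- The hypothesis controls `h` only at points with large image. If `‖h w‖ ≤ M` for some `‖w‖ > M +
1`, connectedness yields `x` with `‖x‖ > M + 1` and `‖h x‖ = M`, but `G` moves `h x` by less than
`1`. -/
lemma ConformalPair.tendsto_infH {h G : ℂ → ℂ} {Ω : Set ℂ} (H : ConformalPair h G halfPlane Ω)
    (hsub : Ω ⊆ halfPlane) (hΩ : Ω ∈ infH) (hG : Tendsto (fun z ↦ G z - z) infH (𝓝 0)) :
    Tendsto h infH infH := by
  obtain ⟨M₁, hM₁⟩ := _root_.tendsto_infH.1 hG 1 one_pos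
  obtain ⟨M₂, hM₂⟩ := eventually_infH.1 (show ∀ᶠ z in infH, z ∈ Ω from hΩ)
  have key : ∀ M, M₁ ≤ M → M₂ ≤ M → 0 ≤ M → ∀ w ∈ halfPlane, M + 1 < ‖w‖ → M < ‖h w‖ := by
    intro M h1 h2 h0 w hw hwn
    by_contra! hle
    set y : ℂ := ((M + 3 : ℝ) : ℂ) * Complex.I
    have hyn : ‖y‖ = M + 3 := by
      rw [norm_mul, Complex.norm_I, mul_one, Complex.norm_real, Real.norm_of_nonneg (by linarith)]
    have hyH : y ∈ halfPlane := by
      have : y.im = M + 3 := by simp [y]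
      change 0 < y.im; linarith
    have hyΩ : y ∈ Ω := hM₂ y hyH (by linarith)
    have hGy := hM₁ y hyH (by linarith)
    rw [sub_zero, norm_sub_rev] at hGy
    obtain ⟨x, ⟨hxH, hxn⟩, hx⟩ := (isPreconnected_halfPlane_norm_gt (M + 1)).intermediate_value
      (f := fun w ↦ ‖h w‖) ⟨hw, hwn⟩
      (show G y ∈ {z | z ∈ halfPlane ∧ M + 1 < ‖z‖} from ⟨H.mapsTo_symm y hyΩ, by
        linarith [norm_le_add_of_sub_le hGy.le]⟩)
      (H.diff.continuousOn.norm.mono fun z hz ↦ hz.1)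
      (show M ∈ Icc _ _ from ⟨hle, by rw [H.right_inv y hyΩ, hyn]; linarith⟩)
    replace hx : ‖h x‖ = M := hx
    have := hM₁ (h x) (hsub (H.mapsTo x hxH)) (by rw [hx]; exact h1)
    rw [sub_zero, H.left_inv x hxH] at this
    have := norm_le_add_of_sub_le this.le
    linarith
  intro s hs
  obtain ⟨N, hN⟩ := eventually_infH.1 (show ∀ᶠ z in infH, z ∈ s from hs)
  refine mem_map.2 (eventually_infH.2 ⟨max (max M₁ M₂) (max N 0) + 2, fun w hw hwn ↦ ?_⟩)
  have := key (max (max M₁ M₂) (max N 0)) ((le_max_left _ _).trans (le_max_left _ _))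
    ((le_max_right _ _).trans (le_max_left _ _)) ((le_max_right _ _).trans (le_max_right _ _))
    w hw (by linarith)
  exact hN _ (hsub (H.mapsTo w hw))
    (((le_max_left _ _).trans (le_max_right _ _)).trans this.le)

/-- Substituting `w = G z`, so `z = h w`, turns `w (h w - w)` into `-(z (G z - z) + (G z - z)²)` up
to sign-free terms that vanish: the square tends to `0`, with the sign chosen so that both sides
agree. -/
lemma ConformalPair.hydroPair {h G : ℂ → ℂ} {Ω : Set ℂ} {c : ℝ}
    (H : ConformalPair h G halfPlane Ω) (hsub : Ω ⊆ halfPlane) (hΩ : Ω ∈ infH)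
    (hG : Tendsto (fun z ↦ G z - z) infH (𝓝 0))
    (hc : Tendsto (fun z ↦ z * (G z - z)) infH (𝓝 (c : ℂ))) : HydroPair h G Ω c := by
  have ht := H.tendsto_infH hsub hΩ hG
  have hev : ∀ᶠ w in infH, w ∈ halfPlane := mem_inf_of_right (mem_principal_self _)
  refine { H with subset := hsub, mem_infH := hΩ, tendsto_inv := hG, tendsto := ?_, hcap := ?_ }
  · have h1 := (hG.comp ht).neg
    rw [neg_zero] at h1
    refine h1.congr' ?_
    filter_upwards [hev] with w hw
    simp [H.left_inv w hw]
  · have h1 := ((hc.comp ht).add ((hG.comp ht).pow 2)).neg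
    rw [zero_pow two_ne_zero, add_zero] at h1
    refine h1.congr' ?_
    filter_upwards [hev] with w hw
    simp only [Function.comp_apply, H.left_inv w hw]
    ring

/-- Conjugation by a real shift preserves the capacity; it serves to centre a small hull at the
driving value. -/
lemma HydroPair.translate {h G : ℂ → ℂ} {Ω : Set ℂ} {c : ℝ} (H : HydroPair h G Ω c) (u : ℝ) :
    HydroPair (fun w ↦ h (w + u) - u) (fun z ↦ G (z + u) - u) {z | z + u ∈ Ω} c := by
  have hu : Tendsto (fun z : ℂ ↦ z + u) infH infH := by
    intro s hs
    obtain ⟨N, hN⟩ := eventually_infH.1 (show ∀ᶠ z in infH, z ∈ s from hs)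
    refine mem_map.2 (eventually_infH.2 ⟨N + |u|, fun z hz hzn ↦ hN _ ?_ ?_⟩)
    · simpa [halfPlane] using hz
    · have : ‖z‖ ≤ ‖z + u‖ + |u| := norm_le_add_of_sub_le (by simp)
      linarith
  have hH : ∀ z ∈ halfPlane, z + u ∈ halfPlane := fun z hz ↦ by simpa [halfPlane] using hz
  have hH' : ∀ z ∈ halfPlane, z - u ∈ halfPlane := fun z hz ↦ by simpa [halfPlane] using hz
  refine ConformalPair.hydroPair ⟨isOpen_halfPlane, ?_, ?_, ?_, ?_, ?_, ?_, ?_⟩ ?_ ?_ ?_ ?_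
  · exact H.open_target.preimage (by fun_prop)
  · exact (H.diff.comp (by fun_prop) hH).sub_const _
  · exact (H.diff_symm.comp (f := fun z : ℂ ↦ z + u) (s := {z : ℂ | z + u ∈ Ω})
      (by fun_prop) fun z hz ↦ hz).sub_const _
  · intro w hw
    change h (w + u) - u + u ∈ Ω
    rw [sub_add_cancel]; exact H.mapsTo _ (hH w hw)
  · exact fun z hz ↦ hH' _ (H.mapsTo_symm _ hz)
  · intro w hw; simp [H.left_inv _ (hH w hw)]
  · intro z hz
    have : z + u ∈ Ω := hz
    simp [H.right_inv _ this]
  · intro z hz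
    have := hH' _ (H.subset hz)
    rwa [add_sub_cancel_right] at this
  · exact hu H.mem_infH
  · exact (H.tendsto_inv.comp hu).congr fun z ↦ by simp; ring
  · have hcap : Tendsto (fun z ↦ z * (G z - z)) infH (𝓝 (c : ℂ)) := by
      have hm : ∀ᶠ z in infH, z ∈ Ω := H.mem_infH
      have ht : Tendsto G infH infH := tendsto_infH_infH_of_sub H.tendsto_inv
        (hm.mono fun z hz ↦ H.mapsTo_symm z hz)
      have h1 := ((H.hcap.comp ht).add ((H.tendsto_inv).pow 2)).neg
      rw [zero_pow two_ne_zero, add_zero, neg_neg] at h1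
      refine h1.congr' ?_
      filter_upwards [hm] with z hz
      simp only [Function.comp_apply, H.right_inv z hz]
      ring
    have h1 := (hcap.comp hu).sub ((H.tendsto_inv.comp hu).const_mul (u : ℂ))
    rw [mul_zero, sub_zero] at h1
    refine h1.congr fun z ↦ ?_
    simp only [Function.comp_apply]; ring

/-! ### The Loewner flow of a simple curve, studied through finite time increments. -/

/-- The chordal Loewner chain of a simple curve `κ` in the half plane on the time interval
`[0, τ)`. -/
structure LoewnerFlow (κ : ℝ → ℂ) (τ : ℝ) (g : ℝ → ℂ → ℂ) (U : ℝ → ℝ) : Prop where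
  cont : ContinuousOn κ (Ioo 0 τ)
  inj : InjOn κ (Ioo 0 τ)
  mem : ∀ t ∈ Ioo 0 τ, κ t ∈ halfPlane
  start : Tendsto κ (𝓝[>] 0) (𝓝 0)
  mappingOut : ∀ t ∈ Ico 0 τ, IsMappingOut (κ '' Ioc 0 t) (g t)
  hcap : ∀ t ∈ Ico 0 τ,
    Tendsto (fun z ↦ z * (g t z - z)) (atInfinity (κ '' Ioc 0 t)) (𝓝 ((2 * t : ℝ) : ℂ))
  right : ∀ s ∈ Ico 0 τ, Tendsto (fun u ↦ g s (κ u)) (𝓝[>] s) (𝓝 (U s : ℂ))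

namespace LoewnerFlow
variable {κ : ℝ → ℂ} {τ : ℝ} {g : ℝ → ℂ → ℂ} {U : ℝ → ℝ}

/-- The complement of the hull at time `t`. -/
def dom (κ : ℝ → ℂ) (t : ℝ) : Set ℂ := halfPlane \ κ '' Ioc 0 t

/-- The inverse of `g_t`. -/
def inv (κ : ℝ → ℂ) (g : ℝ → ℂ → ℂ) (t : ℝ) : ℂ → ℂ := Function.invFunOn (g t) (dom κ t)

/-- Adding the starting point `0` closes the hull; as `0` is not in the half plane, the domain is
unaffected. -/
lemma isCompact_insert (L : LoewnerFlow κ τ g U) {t : ℝ} (ht : t ∈ Ico 0 τ) :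
    IsCompact (insert 0 (κ '' Ioc 0 t)) := by
  have hc : ContinuousOn (Function.update κ 0 0) (Icc 0 t) := by
    intro s hs
    rcases hs.1.eq_or_lt with h0 | h0
    · rw [← h0, continuousWithinAt_update_same]
      refine L.start.mono_left (nhdsWithin_mono _ fun x hx ↦ ?_)
      exact lt_of_le_of_ne hx.1.1 (Ne.symm hx.2)
    · rw [continuousWithinAt_update_of_ne h0.ne']
      exact (L.cont.continuousAt (Ioo_mem_nhds h0 (hs.2.trans_lt ht.2))).continuousWithinAt
  convert isCompact_Icc.image_of_continuousOn hc using 1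
  rw [← Icc_union_Ioc_eq_Icc le_rfl ht.1, image_union, Icc_self, image_singleton,
    Function.update_self, singleton_union]
  congr 1
  exact image_congr fun x hx ↦ (Function.update_of_ne hx.1.ne' _ _).symm

lemma dom_eq (t : ℝ) : dom κ t = halfPlane \ insert 0 (κ '' Ioc 0 t) := by
  ext z
  simp only [dom, Set.mem_sdiff, mem_insert_iff, not_or]
  exact ⟨fun h ↦ ⟨h.1, ne_zero_of_mem_halfPlane h.1, h.2⟩, fun h ↦ ⟨h.1, h.2.2⟩⟩

lemma isOpen_dom (L : LoewnerFlow κ τ g U) {t : ℝ} (ht : t ∈ Ico 0 τ) : IsOpen (dom κ t) := by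
  rw [dom_eq]
  exact isOpen_halfPlane.sdiff (L.isCompact_insert ht).isClosed

lemma dom_anti {s t : ℝ} (hst : s ≤ t) : dom κ t ⊆ dom κ s :=
  sdiff_subset_sdiff_right (image_mono (Ioc_subset_Ioc_right hst))

lemma pair (L : LoewnerFlow κ τ g U) {t : ℝ} (ht : t ∈ Ico 0 τ) :
    ConformalPair (g t) (inv κ g t) (dom κ t) halfPlane :=
  (L.mappingOut t ht).1.pair (L.isOpen_dom ht)

lemma dom_mem_infH (L : LoewnerFlow κ τ g U) {t : ℝ} (ht : t ∈ Ico 0 τ) : dom κ t ∈ infH := by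
  rw [dom_eq]
  exact inter_mem (mem_inf_of_right (mem_principal_self _))
    (mem_inf_of_left (L.isCompact_insert ht).compl_mem_cocompact)

lemma atInfinity_eq (L : LoewnerFlow κ τ g U) {t : ℝ} (ht : t ∈ Ico 0 τ) :
    atInfinity (κ '' Ioc 0 t) = infH := by
  refine le_antisymm (inf_le_inf_left _ (principal_mono.2 sdiff_subset)) ?_
  exact le_inf inf_le_left (le_principal_iff.2 (L.dom_mem_infH ht))

lemma tendsto_sub (L : LoewnerFlow κ τ g U) {t : ℝ} (ht : t ∈ Ico 0 τ) :
    Tendsto (fun z ↦ g t z - z) infH (𝓝 0) := by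
  rw [← L.atInfinity_eq ht]; exact (L.mappingOut t ht).2

lemma tendsto_mul_sub (L : LoewnerFlow κ τ g U) {t : ℝ} (ht : t ∈ Ico 0 τ) :
    Tendsto (fun z ↦ z * (g t z - z)) infH (𝓝 ((2 * t : ℝ) : ℂ)) := by
  rw [← L.atInfinity_eq ht]; exact L.hcap t ht

lemma hydro (L : LoewnerFlow κ τ g U) {t : ℝ} (ht : t ∈ Ico 0 τ) :
    HydroPair (inv κ g t) (g t) (dom κ t) (2 * t) :=
  (L.pair ht).symm.hydroPair sdiff_subset (L.dom_mem_infH ht) (L.tendsto_sub ht)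
    (L.tendsto_mul_sub ht)

/-- The transition map from time `t` back to time `s`. -/
lemma transition (L : LoewnerFlow κ τ g U) {s t : ℝ} (hs : 0 ≤ s) (hst : s ≤ t) (ht : t < τ) :
    HydroPair (g s ∘ inv κ g t) (g t ∘ inv κ g s) (g s '' dom κ t) (2 * (t - s)) := by
  have hs' : s ∈ Ico 0 τ := ⟨hs, hst.trans_lt ht⟩
  have ht' : t ∈ Ico 0 τ := ⟨hs.trans hst, ht⟩
  have hp := (L.pair ht').symm.trans ((L.pair hs').restrict (L.isOpen_dom ht') (dom_anti hst))
  have hsT : Tendsto (inv κ g s) infH infH := (L.pair hs').symm.tendsto_infH sdiff_subset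
    (L.dom_mem_infH hs') (L.tendsto_sub hs')
  have hev : ∀ᶠ w in infH, w ∈ halfPlane := mem_inf_of_right (mem_principal_self _)
  have h1 := (L.tendsto_sub ht').comp hsT
  refine hp.hydroPair ?_ ?_ ?_ ?_
  · exact image_subset_iff.2 fun z hz ↦ (L.pair hs').mapsTo z (dom_anti hst hz)
  · have : ∀ᶠ w in infH, inv κ g s w ∈ dom κ t := hsT (L.dom_mem_infH ht')
    filter_upwards [this, hev] with w hw hwH
    exact ⟨_, hw, (L.pair hs').right_inv w hwH⟩
  · have h2 := h1.add (L.hydro hs').tendsto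
    rw [add_zero] at h2
    exact h2.congr fun w ↦ by simp
  · have h3 := (L.tendsto_mul_sub ht').comp hsT
    -- Additivity of capacity: with `v = inv κ g s w`, `w (g t v - w) = v (g t v - v) - (v - w)(g t
    -- v - v) + w (v - w)`, with limits `2t`, `0` and `-2s`.
    have h4 := (h3.sub ((L.hydro hs').tendsto.mul h1)).add (L.hydro hs').hcap
    rw [zero_mul, sub_zero] at h4
    refine (h4.congr fun w ↦ ?_).trans (le_of_eq ?_)
    · simp only [Function.comp_apply]; ring
    · congr 1; push_cast; ring

lemma norm_sub_le (L : LoewnerFlow κ τ g U) {s t : ℝ} (hs : 0 ≤ s) (hst : s ≤ t) (ht : t < τ)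
    {z : ℂ} (hz : z ∈ dom κ t) : ‖g s z - g t z‖ ≤ 2 * (t - s) / (g t z).im := by
  have hp := L.pair ⟨hs.trans hst, ht⟩
  have := (L.transition hs hst ht).norm_sub_le_div (hp.mapsTo z hz)
  rwa [Function.comp_apply, hp.left_inv z hz] at this

lemma im_anti (L : LoewnerFlow κ τ g U) {s t : ℝ} (hs : 0 ≤ s) (hst : s ≤ t) (ht : t < τ)
    {z : ℂ} (hz : z ∈ dom κ t) : (g t z).im ≤ (g s z).im := by
  have hp := L.pair ⟨hs.trans hst, ht⟩
  have := (L.transition hs hst ht).im_le (hp.mapsTo z hz)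
  rwa [Function.comp_apply, hp.left_inv z hz] at this

lemma im_pos (L : LoewnerFlow κ τ g U) {t : ℝ} (ht : t ∈ Ico 0 τ) {z : ℂ} (hz : z ∈ dom κ t) :
    0 < (g t z).im := (L.pair ht).mapsTo z hz

lemma zero_eq (L : LoewnerFlow κ τ g U) (hτ : 0 < τ) {z : ℂ} (hz : z ∈ halfPlane) : g 0 z = z := by
  have h0 : (0 : ℝ) ∈ Ico 0 τ := ⟨le_rfl, hτ⟩
  have hz' : z ∈ dom κ 0 := by simpa [dom] using hz
  have := (L.hydro h0).norm_sub_le_div (L.im_pos h0 hz')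
  rw [(L.pair h0).left_inv z hz', mul_zero, zero_div] at this
  exact (sub_eq_zero.1 (norm_le_zero_iff.1 this)).symm

/-- Since `Im (g s z)` decreases in `s`, the displacement bound is uniform on `[0, t]` and gives a
Lipschitz estimate. -/
lemma continuousOn_time (L : LoewnerFlow κ τ g U) {t : ℝ} (ht : t ∈ Ico 0 τ) {z : ℂ}
    (hz : z ∈ dom κ t) : ContinuousOn (fun s ↦ g s z) (Icc 0 t) := by
  have hy := L.im_pos ht hz
  have key : ∀ s ∈ Icc 0 t, ∀ s' ∈ Icc 0 t, s ≤ s' →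
      dist (g s z) (g s' z) ≤ 2 / (g t z).im * dist s s' := by
    intro s hs s' hs' hss
    have hz' := dom_anti hs'.2 hz
    have h1 := L.norm_sub_le hs.1 hss (hs'.2.trans_lt ht.2) hz'
    have h2 := L.im_anti hs'.1 hs'.2 ht.2 hz
    rw [dist_eq_norm, dist_comm, Real.dist_eq, abs_of_nonneg (by linarith)]
    refine h1.trans ?_
    rw [div_mul_eq_mul_div]
    exact div_le_div_of_nonneg_left (by linarith) hy h2
  have hL : LipschitzOnWith (Real.toNNReal (2 / (g t z).im)) (fun s ↦ g s z) (Icc 0 t) := by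
    refine LipschitzOnWith.of_dist_le_mul fun s hs s' hs' ↦ ?_
    rw [Real.coe_toNNReal _ (by positivity)]
    rcases le_total s s' with h | h
    · exact key s hs s' hs' h
    · rw [dist_comm, dist_comm s s']; exact key s' hs' s hs h
  exact hL.continuousOn

/-- A finite-difference form of `d(Im g)²/dt ≥ -4`, propagated along `[0, t]` by a continuity
argument; the constant `8` leaves room for second-order terms. -/
lemma sq_im_le (L : LoewnerFlow κ τ g U) {t : ℝ} (ht : t ∈ Ico 0 τ) {z : ℂ}
    (hz : z ∈ dom κ t) : z.im ^ 2 ≤ (g t z).im ^ 2 + 8 * t := by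
  have hy := L.im_pos ht hz
  have hτ : 0 < τ := ht.1.trans_lt ht.2
  have hc := L.continuousOn_time ht hz
  set S : Set ℝ := {s | z.im ^ 2 ≤ (g s z).im ^ 2 + 8 * s}
  have hcl : IsClosed (S ∩ Icc 0 t) := by
    have : S ∩ Icc 0 t = {s ∈ Icc 0 t | z.im ^ 2 ≤ (g s z).im ^ 2 + 8 * s} := by
      ext x; simp [S, and_comm]
    rw [this]
    refine isClosed_Icc.isClosed_le continuousOn_const ?_
    exact ((Complex.continuous_im.comp_continuousOn hc).pow 2).add (by fun_prop)
  refine hcl.Icc_subset_of_forall_mem_nhdsWithin ?_ ?_ (⟨ht.1, le_rfl⟩ : t ∈ Icc 0 t)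
  · simp [S, L.zero_eq hτ hz.1]
  · rintro s ⟨hsS, hs⟩
    -- With this step size `s' - s < y'²`, hence `d ≤ 2y'` and `d² ≤ 4(s' - s)`. So `(y' + d)² ≤ y'²
    -- + 8(s' - s)`.
    have hset : Ioo s (min t (s + (g t z).im ^ 2)) ∈ 𝓝[>] s :=
      Ioo_mem_nhdsGT (lt_min hs.2 (by linarith [pow_pos hy 2]))
    filter_upwards [hset] with s' hs'
    have hs't : s' < t := hs'.2.trans_le (min_le_left _ _)
    have h0 : 0 ≤ s' := hs.1.trans hs'.1.le
    have hz' := dom_anti hs't.le hz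
    have h1 := L.norm_sub_le hs.1 hs'.1.le (hs't.trans ht.2) hz'
    have h2 := (le_abs_self _).trans ((Complex.abs_im_le_norm _).trans h1)
    rw [Complex.sub_im] at h2
    have h3 := L.im_anti h0 hs't.le ht.2 hz
    have h3' := L.im_anti hs.1 hs.2.le ht.2 hz
    set y' := (g s' z).im
    set y := (g s z).im
    have hy' : 0 < y' := hy.trans_le h3
    set d := 2 * (s' - s) / y'
    have hd : d * y' = 2 * (s' - s) := by simp only [d]; field_simp
    have hd0 : 0 ≤ d := div_nonneg (by linarith [hs'.1]) hy'.le
    have hd2 : d * d ≤ 4 * (s' - s) := by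
      have h4 : s' - s ≤ y' * y' := by
        have := hs'.2.trans_le (min_le_right _ _)
        nlinarith
      have h5 : d ≤ 2 * y' := by
        refine le_of_mul_le_mul_right ?_ hy'
        rw [hd]; nlinarith
      nlinarith
    have h6 : y ^ 2 ≤ (y' + d) ^ 2 := pow_le_pow_left₀ (hy.le.trans h3') (by linarith) 2
    change z.im ^ 2 ≤ y' ^ 2 + 8 * s'
    have hsS' : z.im ^ 2 ≤ y ^ 2 + 8 * s := hsS
    nlinarith

lemma exists_hullRad_lt {η : ℝ} (hη : 0 < η) : ∃ δ > 0, ∃ r > 0, ∀ c ≤ r, hullRad δ c < η := by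
  refine ⟨η / 600, by positivity, (η / 600) ^ 2, by positivity, fun c hc ↦ ?_⟩
  have : √c ≤ η / 600 := by
    rw [← Real.sqrt_sq (show 0 ≤ η / 600 by positivity)]
    exact Real.sqrt_le_sqrt hc
  unfold hullRad; linarith

/-- Points to the right of the driving function move to the right (`σ = 1`), and symmetrically
on the left (`σ = -1`). -/
lemma re_mono (L : LoewnerFlow κ τ g U) {t : ℝ} (ht : t ∈ Ico 0 τ) {z : ℂ} (hz : z ∈ dom κ t)
    {σ m : ℝ} (hσ : σ = 1 ∨ σ = -1) (hU : ∀ s ∈ Icc 0 t, σ * U s < m) (hzm : m ≤ σ * z.re) :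
    σ * z.re ≤ σ * (g t z).re := by
  have hτ : 0 < τ := ht.1.trans_lt ht.2
  have hc := L.continuousOn_time ht hz
  set S : Set ℝ := {s | σ * z.re ≤ σ * (g s z).re}
  have hcX : ContinuousOn (fun s ↦ σ * (g s z).re) (Icc 0 t) :=
    continuousOn_const.mul (Complex.continuous_re.comp_continuousOn hc)
  have hcl : IsClosed (S ∩ Icc 0 t) := by
    have : S ∩ Icc 0 t = {s ∈ Icc 0 t | σ * z.re ≤ σ * (g s z).re} := by
      ext x; simp [S, and_comm]
    rw [this]
    exact isClosed_Icc.isClosed_le continuousOn_const hcX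
  refine hcl.Icc_subset_of_forall_mem_nhdsWithin ?_ ?_ (⟨ht.1, le_rfl⟩ : t ∈ Icc 0 t)
  · simp [S, L.zero_eq hτ hz.1]
  · rintro s ⟨hsS, hs⟩
    have hsS' : σ * z.re ≤ σ * (g s z).re := hsS
    have hsτ : s ∈ Ico 0 τ := ⟨hs.1, hs.2.trans ht.2⟩
    set η := σ * (g s z).re - σ * U s
    have hη : 0 < η := by
      have := hU s ⟨hs.1, hs.2.le⟩
      simp only [η]; linarith
    -- `z` is at distance at least `η` from the driving value; over a short time the new hull has
    -- control radius below `η / 2`, so it pushes the point away.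
    obtain ⟨δ, hδ, r, hr, hrad⟩ := exists_hullRad_lt (half_pos hη)
    have hright := (Metric.tendsto_nhds.1 (L.right s hsτ)) δ hδ
    obtain ⟨u₀, hu₀, hu₀'⟩ := mem_nhdsGT_iff_exists_Ioo_subset.1 hright
    have hX : ∀ᶠ s' in 𝓝[>] s, σ * (g s z).re - η / 2 < σ * (g s' z).re := by
      have h1 : ContinuousWithinAt (fun s ↦ σ * (g s z).re) (Ioo s t) s :=
        (hcX s ⟨hs.1, hs.2.le⟩).mono (Ioo_subset_Icc_self.trans (Icc_subset_Icc_left hs.1))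
      have h2 : Tendsto (fun s ↦ σ * (g s z).re) (𝓝[>] s) (𝓝 (σ * (g s z).re)) := by
        rw [← nhdsWithin_Ioo_eq_nhdsGT hs.2]; exact h1
      exact h2.eventually (lt_mem_nhds (by linarith))
    have hset : Ioo s (min t (min u₀ (s + r / 2))) ∈ 𝓝[>] s :=
      Ioo_mem_nhdsGT (lt_min hs.2 (lt_min hu₀ (by linarith)))
    filter_upwards [hset, hX] with s' hs' hX'
    have hs't : s' < t := hs'.2.trans_le (min_le_left _ _)
    have hs'u : s' < u₀ := hs'.2.trans_le ((min_le_right _ _).trans (min_le_left _ _))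
    have hs'r : s' < s + r / 2 := hs'.2.trans_le ((min_le_right _ _).trans (min_le_right _ _))
    have hz' := dom_anti hs't.le hz
    have hs'τ : s' ∈ Ico 0 τ := ⟨hs.1.trans hs'.1.le, hs't.trans ht.2⟩
    have hT := (L.transition hs.1 hs'.1.le (hs't.trans ht.2)).translate (U s)
    -- The increment hull consists of the points `g s (κ v)` with `s < v ≤ s'`, all within `δ` of `U
    -- s`.
    have hΩ : ∀ x ∈ halfPlane, δ < ‖x‖ → x ∈ {x | x + (U s : ℂ) ∈ g s '' dom κ s'} := by
      intro x hx hxn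
      have hxu : x + (U s : ℂ) ∈ halfPlane := by simpa [halfPlane] using hx
      refine ⟨inv κ g s (x + U s), ?_, (L.pair hsτ).right_inv _ hxu⟩
      have hd := (L.pair hsτ).mapsTo_symm _ hxu
      refine ⟨hd.1, ?_⟩
      rintro ⟨v, hv, hve⟩
      have hvs : s < v := by
        by_contra! hle
        exact hd.2 ⟨v, ⟨hv.1, hle⟩, hve⟩
      have : dist (g s (κ v)) (U s) < δ := hu₀' ⟨hvs, hv.2.trans_lt hs'u⟩
      rw [hve, (L.pair hsτ).right_inv _ hxu, dist_eq_norm, add_sub_cancel_right] at this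
      linarith
    have hw : 0 < (g s' z - U s).im := by simpa using L.im_pos hs'τ hz'
    have hre := hT.re_le_of_lt hδ hΩ hσ hw (by
      have h1 := hrad (2 * (s' - s)) (by linarith)
      simp only [Complex.sub_re, Complex.ofReal_re]
      rw [mul_sub σ]
      simp only [η] at *
      linarith)
    simp only [sub_add_cancel, Function.comp_apply, (L.pair hs'τ).left_inv z hz', Complex.sub_re,
      Complex.ofReal_re] at hre
    change σ * z.re ≤ σ * (g s' z).re
    linarith

lemma curve_mem_dom (L : LoewnerFlow κ τ g U) {s u : ℝ} (hs : 0 ≤ s) (hsu : s < u) (hu : u < τ) :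
    κ u ∈ dom κ s := by
  refine ⟨L.mem u ⟨hs.trans_lt hsu, hu⟩, ?_⟩
  rintro ⟨v, hv, hve⟩
  have := L.inj ⟨hv.1, hv.2.trans_lt (hsu.trans hu)⟩ ⟨hs.trans_lt hsu, hu⟩ hve
  linarith [hv.2]

lemma tendsto_right (L : LoewnerFlow κ τ g U) {s : ℝ} (hs : s ∈ Ioo 0 τ) :
    Tendsto κ (𝓝[>] s) (𝓝 (κ s)) :=
  (L.cont.continuousAt (Ioo_mem_nhds hs.1 hs.2)).tendsto.mono_left nhdsWithin_le_nhds

/-- Apply the flow estimates to `κ u` with `u ↓ s`, where `g s (κ u) → U s`. If `σ · Re κ(s) > m`,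
then `re_mono` would give `σ · U s > m`; the limit of `sq_im_le` gives `(Im κ(s))² ≤ 8s`. -/
lemma norm_le (L : LoewnerFlow κ τ g U) {m : ℝ} {s : ℝ} (hs : s ∈ Ioo 0 τ)
    (hU : ∀ s' ∈ Icc 0 s, |U s'| < m) : ‖κ s‖ ≤ m + √(8 * s) := by
  have hs' : s ∈ Ico 0 τ := ⟨hs.1.le, hs.2⟩
  have hev : ∀ᶠ u in 𝓝[>] s, κ u ∈ dom κ s := by
    filter_upwards [Ioo_mem_nhdsGT hs.2] with u hu using L.curve_mem_dom hs.1.le hu.1 hu.2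
  have hre : ∀ σ : ℝ, (σ = 1 ∨ σ = -1) → σ * (κ s).re ≤ m := by
    intro σ hσ
    by_contra! hlt
    have hUσ : ∀ s' ∈ Icc 0 s, σ * U s' < m := by
      intro s' h'
      have := abs_lt.1 (hU s' h')
      rcases hσ with rfl | rfl <;> linarith
    have hl : Tendsto (fun u ↦ σ * (κ u).re) (𝓝[>] s) (𝓝 (σ * (κ s).re)) :=
      ((Complex.continuous_re.tendsto _).comp (L.tendsto_right hs)).const_mul σ
    have hr : Tendsto (fun u ↦ σ * (g s (κ u)).re) (𝓝[>] s) (𝓝 (σ * (U s : ℂ).re)) :=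
      ((Complex.continuous_re.tendsto _).comp (L.right s hs')).const_mul σ
    have := le_of_tendsto_of_tendsto hl hr (by
      filter_upwards [hev, hl.eventually (lt_mem_nhds hlt)] with u hu hum
      exact L.re_mono hs' hu hσ hUσ hum.le)
    rw [Complex.ofReal_re] at this
    linarith [hUσ s ⟨hs.1.le, le_rfl⟩]
  have him : (κ s).im ^ 2 ≤ 8 * s := by
    have hl : Tendsto (fun u ↦ (κ u).im ^ 2) (𝓝[>] s) (𝓝 ((κ s).im ^ 2)) :=
      ((Complex.continuous_im.tendsto _).comp (L.tendsto_right hs)).pow 2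
    have hr : Tendsto (fun u ↦ (g s (κ u)).im ^ 2 + 8 * s) (𝓝[>] s)
        (𝓝 ((U s : ℂ).im ^ 2 + 8 * s)) :=
      (((Complex.continuous_im.tendsto _).comp (L.right s hs')).pow 2).add_const _
    have := le_of_tendsto_of_tendsto hl hr (by
      filter_upwards [hev] with u hu using L.sq_im_le hs' hu)
    simpa using this
  refine (Complex.norm_le_abs_re_add_abs_im _).trans (add_le_add ?_ ?_)
  · rw [abs_le]
    constructor
    · have := hre (-1) (Or.inr rfl); linarith
    · have := hre 1 (Or.inl rfl); linarith
  · exact Real.abs_le_sqrt him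

end LoewnerFlow

/-! ### Short crosscuts of a bounded domain -/

open MeasureTheory in
lemma volume_image_eq_lintegral {k : ℂ → ℂ} {E : Set ℂ} (hE : IsOpen E)
    (hd : DifferentiableOn ℂ k E) (hi : InjOn k E) :
    volume (k '' E) = ∫⁻ z in E, ENNReal.ofReal (‖deriv k z‖ ^ 2) := by
  rw [← lintegral_abs_det_fderiv_eq_addHaar_image volume hE.measurableSet
    (f' := fun z ↦ deriv k z • (1 : ℂ →L[ℝ] ℂ)) (fun z hz ↦
      ((hd.differentiableAt (hE.mem_nhds hz)).hasDerivAt.complexToReal_fderiv).hasFDerivWithinAt)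
    hi]
  congr 1
  ext z
  congr 1
  have : (deriv k z • (1 : ℂ →L[ℝ] ℂ)).det = Algebra.norm ℝ (deriv k z) := by
    rw [Algebra.norm_apply]
    congr 1
  rw [this, Algebra.norm_complex_apply, Complex.normSq_eq_norm_sq, abs_of_nonneg (by positivity)]

/-- The part of the strip over the interval `(-n-1, -n)`. -/
def stripCell (n : ℕ) : Set ℂ := Ioo (-(n : ℝ) - 1) (-n) ×ℂ Ioo 0 Real.pi

lemma stripCell_subset (n : ℕ) : stripCell n ⊆ piStrip := fun _ hz ↦ hz.2

lemma isOpen_stripCell (n : ℕ) : IsOpen (stripCell n) := isOpen_Ioo.reProdIm isOpen_Ioo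

lemma pairwise_disjoint_stripCell : Pairwise fun m n ↦ Disjoint (stripCell m) (stripCell n) := by
  have key : ∀ m n : ℕ, m < n → Disjoint (stripCell m) (stripCell n) := by
    intro m n h
    refine Set.disjoint_left.2 fun z hm hn ↦ ?_
    have h1 : (m : ℝ) + 1 ≤ n := by exact_mod_cast h
    have := hm.1.1
    have := hn.1.2
    linarith
  intro m n h
  rcases lt_or_gt_of_ne h with h | h
  · exact key m n h
  · exact (key n m h).symm

open MeasureTheory in
-- The cell has width one, so some vertical line carries at most the average, which is the image
-- area by the change of variables.
lemma exists_lintegral_vertical_le {k : ℂ → ℂ} (n : ℕ)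
    (hd : DifferentiableOn ℂ k (stripCell n)) (hi : InjOn k (stripCell n)) :
    ∃ x ∈ Ioo (-(n : ℝ) - 1) (-n), ∫⁻ θ in Ioo 0 Real.pi,
      ENNReal.ofReal (‖deriv k (x + θ * Complex.I)‖ ^ 2) ≤ volume (k '' stripCell n) := by
  have hm : Measurable fun z : ℂ ↦ ENNReal.ofReal (‖deriv k z‖ ^ 2) := by
    have := measurable_deriv k
    fun_prop
  have hme : Measurable fun p : ℝ × ℝ ↦ (p.1 + p.2 * Complex.I : ℂ) := by fun_prop
  have hF := hm.comp hme
  have hvol : volume (Ioo (-(n : ℝ) - 1) (-n)) = 1 := by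
    rw [Real.volume_Ioo]; norm_num
  obtain ⟨x, hx, hle⟩ := exists_le_setLAverage (μ := volume) (s := Ioo (-(n : ℝ) - 1) (-n))
    (f := fun x : ℝ ↦ ∫⁻ θ in Ioo 0 Real.pi, ENNReal.ofReal (‖deriv k (x + θ * Complex.I)‖ ^ 2))
    (by rw [hvol]; simp) (by rw [hvol]; simp) (hF.lintegral_prod_right').aemeasurable
  refine ⟨x, hx, hle.trans (le_of_eq ?_)⟩
  rw [setLAverage_eq, hvol, div_one, volume_image_eq_lintegral (isOpen_stripCell n) hd hi,
    ← (Complex.volume_preserving_equiv_real_prod.symm).setLIntegral_comp_preimage_emb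
      Complex.measurableEquivRealProd.symm.measurableEmbedding]
  have : Complex.measurableEquivRealProd.symm ⁻¹' stripCell n
      = Ioo (-(n : ℝ) - 1) (-n) ×ˢ Ioo 0 Real.pi := by
    ext p; simp [stripCell, Complex.mem_reProdIm]
  rw [this]
  have h2 := setLIntegral_prod (μ := volume) (ν := volume) (s := Ioo (-(n : ℝ) - 1) (-n))
    (t := Ioo 0 Real.pi) _ hF.aemeasurable
  rw [Measure.volume_eq_prod] 
  refine Eq.trans h2.symm ?_
  refine lintegral_congr fun p ↦ ?_
  simp only [Function.comp_apply]
  congr 4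
  apply Complex.ext <;> simp

open MeasureTheory in
-- The images are disjoint in a bounded set, so their areas are summable.
lemma tendsto_volume_image_stripCell {k l : ℂ → ℂ} {Ω : Set ℂ} (h : ConformalPair k l piStrip Ω)
    (hΩ : Bornology.IsBounded Ω) :
    Tendsto (fun n ↦ volume (k '' stripCell n)) atTop (𝓝 0) := by
  refine ENNReal.tendsto_atTop_zero_of_tsum_ne_top ?_
  rw [← measure_iUnion]
  · refine ne_top_of_le_ne_top hΩ.measure_lt_top.ne (measure_mono (iUnion_subset fun n ↦ ?_))
    rintro _ ⟨z, hz, rfl⟩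
    exact h.mapsTo z (stripCell_subset n hz)
  · intro m n hmn
    exact (pairwise_disjoint_stripCell hmn).image h.injOn (stripCell_subset m) (stripCell_subset n)
  · intro n
    exact (isOpen_image_of_injOn (isOpen_stripCell n) (h.diff.mono (stripCell_subset n))
      (h.injOn.mono (stripCell_subset n))).measurableSet

lemma add_mul_I_mem_piStrip {x θ : ℝ} (hθ : θ ∈ Ioo 0 Real.pi) :
    (x + θ * Complex.I : ℂ) ∈ piStrip := by
  simpa [piStrip] using hθ

open MeasureTheory in
/-- The length–area estimate: far out in the strip there are vertical crosscuts whose images are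
arbitrarily short. -/
lemma ConformalPair.exists_short_crosscut {k l : ℂ → ℂ} {Ω : Set ℂ}
    (h : ConformalPair k l piStrip Ω) (hΩ : Bornology.IsBounded Ω) {ε : ℝ} (hε : 0 < ε) (X : ℝ) :
    ∃ x < X, ∀ θ₁ ∈ Ioo 0 Real.pi, ∀ θ₂ ∈ Ioo 0 Real.pi,
      ‖k (x + θ₁ * Complex.I) - k (x + θ₂ * Complex.I)‖ ≤ ε * √|θ₁ - θ₂| := by
  have hev := (tendsto_volume_image_stripCell h hΩ).eventually
    (gt_mem_nhds (show (0 : ENNReal) < ENNReal.ofReal (ε ^ 2) by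
      rw [ENNReal.ofReal_pos]; positivity))
  obtain ⟨n, hn, hnX⟩ := (hev.and (eventually_ge_atTop ⌈-X⌉₊)).exists
  obtain ⟨x, hx, hint⟩ := exists_lintegral_vertical_le n (h.diff.mono (stripCell_subset n))
    (h.injOn.mono (stripCell_subset n))
  have hxX : x < X := by
    have := Nat.le_of_ceil_le hnX
    linarith [hx.2]
  refine ⟨x, hxX, ?_⟩
  have hc' : ContinuousOn (fun θ : ℝ ↦ deriv k (x + θ * Complex.I)) (Ioo 0 Real.pi) := by
    have h1 : ContinuousOn (deriv k) piStrip := (h.diff.deriv h.open_source).continuousOn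
    exact h1.comp (by fun_prop) fun θ hθ ↦ add_mul_I_mem_piStrip hθ
  have hder : ∀ θ ∈ Ioo 0 Real.pi, HasDerivAt (fun θ : ℝ ↦ k (x + θ * Complex.I))
      (deriv k (x + θ * Complex.I) * Complex.I) θ := by
    intro θ hθ
    have h1 := (h.diff.differentiableAt
      (h.open_source.mem_nhds (add_mul_I_mem_piStrip (x := x) hθ))).hasDerivAt
    have h2 : HasDerivAt (fun θ : ℝ ↦ (x + θ * Complex.I : ℂ)) Complex.I θ := by
      have := (Complex.ofRealCLM.hasDerivAt (x := θ)).mul_const Complex.I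
      simpa using this.const_add (x : ℂ)
    exact h1.comp θ h2
  have key : ∀ θ₁ ∈ Ioo 0 Real.pi, ∀ θ₂ ∈ Ioo 0 Real.pi, θ₁ < θ₂ →
      ‖k (x + θ₂ * Complex.I) - k (x + θ₁ * Complex.I)‖ ≤ ε * √(θ₂ - θ₁) := by
    intro θ₁ h₁ θ₂ h₂ hlt
    have hsub : uIcc θ₁ θ₂ ⊆ Ioo 0 Real.pi := by
      rw [uIcc_of_le hlt.le]; exact Icc_subset_Ioo h₁.1 h₂.2
    have hcc := hc'.mono hsub
    rw [← intervalIntegral.integral_eq_sub_of_hasDerivAt (fun θ hθ ↦ hder θ (hsub hθ))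
      (hcc.mul continuousOn_const).intervalIntegrable]
    have hs : 0 < √(θ₂ - θ₁) := Real.sqrt_pos.2 (by linarith)
    -- Cauchy–Schwarz in the form `x ≤ x² / (2c) + c / 2`, with the `c` that balances the two
    -- integrated terms.
    set c := ε / √(θ₂ - θ₁) with hcdef
    have hc0 : 0 < c := by positivity
    have hi1 : IntervalIntegrable (fun θ : ℝ ↦ ‖deriv k (x + θ * Complex.I)‖ ^ 2) volume θ₁ θ₂ :=
      (hcc.norm.pow 2).intervalIntegrable
    have hsq : ∫ θ in θ₁..θ₂, ‖deriv k (x + θ * Complex.I)‖ ^ 2 ≤ ε ^ 2 := by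
      rw [intervalIntegral.integral_of_le hlt.le, integral_eq_lintegral_of_nonneg_ae
        (ae_of_all _ fun _ ↦ by positivity) hi1.1.aestronglyMeasurable]
      refine ENNReal.toReal_le_of_le_ofReal (by positivity) ?_
      refine (lintegral_mono_set ?_).trans (hint.trans hn.le)
      exact Ioc_subset_Icc_self.trans (Icc_subset_Ioo h₁.1 h₂.2)
    calc ‖∫ θ in θ₁..θ₂, deriv k (x + θ * Complex.I) * Complex.I‖
        ≤ ∫ θ in θ₁..θ₂, (‖deriv k (x + θ * Complex.I)‖ ^ 2 / (2 * c) + c / 2) := by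
          refine intervalIntegral.norm_integral_le_of_norm_le hlt.le (ae_of_all _ fun θ _ ↦ ?_)
            ((hi1.div_const _).add intervalIntegrable_const)
          rw [norm_mul, Complex.norm_I, mul_one, div_add_div _ _ (by positivity) two_ne_zero,
            le_div_iff₀ (by positivity)]
          nlinarith [sq_nonneg (‖deriv k (x + θ * Complex.I)‖ - c)]
      _ = (∫ θ in θ₁..θ₂, ‖deriv k (x + θ * Complex.I)‖ ^ 2) / (2 * c) + c / 2 * (θ₂ - θ₁) := by
          rw [intervalIntegral.integral_add (hi1.div_const _) intervalIntegrable_const,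
            intervalIntegral.integral_div, intervalIntegral.integral_const, smul_eq_mul, mul_comm (c / 2)]
      _ ≤ ε ^ 2 / (2 * c) + c / 2 * (θ₂ - θ₁) := by gcongr
      _ = ε * √(θ₂ - θ₁) := by
          have h3 : θ₂ - θ₁ = √(θ₂ - θ₁) ^ 2 := (Real.sq_sqrt (by linarith)).symm
          rw [hcdef, h3, Real.sqrt_sq hs.le]
          field_simp
          ring
  intro θ₁ h₁ θ₂ h₂
  rcases lt_trichotomy θ₁ θ₂ with hlt | rfl | hlt
  · rw [norm_sub_rev, abs_sub_comm, abs_of_pos (by linarith)]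
    exact key θ₁ h₁ θ₂ h₂ hlt
  · simp
  · rw [abs_of_pos (by linarith)]
    exact key θ₂ h₂ θ₁ h₁ hlt

/-! ### Continuous logarithms and crosscuts -/

/-- The function `z ↦ z - c` has a continuous logarithm on `E`. -/
def HasLogOn (E : Set ℂ) (c : ℂ) : Prop :=
  ∃ L : ℂ → ℂ, ContinuousOn L E ∧ ∀ z ∈ E, Complex.exp (L z) = z - c

lemma HasLogOn.mono {E F : Set ℂ} {c : ℂ} (h : HasLogOn F c) (hEF : E ⊆ F) : HasLogOn E c := by
  obtain ⟨L, hL, he⟩ := h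
  exact ⟨L, hL.mono hEF, fun z hz ↦ he z (hEF hz)⟩

lemma hasLogOn_ball {w c : ℂ} {r : ℝ} (hc : c ∉ ball w r) : HasLogOn (ball w r) c := by
  obtain ⟨L, hL, he⟩ := exists_log_on_ball (f := fun z ↦ z - c) (c := w) (r := r) (by fun_prop)
    fun z hz h ↦ hc (by rwa [← sub_eq_zero.1 h])
  exact ⟨L, hL.continuousOn, he⟩

/-- The quotient `(z - c') / (z - c)` lies in the unit disc about `1`, so its principal logarithm
corrects the given one. -/
lemma HasLogOn.of_dist_lt {E : Set ℂ} {c c' : ℂ} (h : HasLogOn E c)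
    (hd : ∀ z ∈ E, dist c' c < dist z c) : HasLogOn E c' := by
  obtain ⟨L, hL, he⟩ := h
  have hne : ∀ z ∈ E, z - c ≠ 0 := fun z hz h0 ↦ by
    have := hd z hz
    rw [sub_eq_zero.1 h0, dist_self] at this
    exact this.not_ge dist_nonneg
  have hsl : ∀ z ∈ E, (z - c') / (z - c) ∈ Complex.slitPlane := by
    intro z hz
    have : (z - c') / (z - c) = 1 + (c - c') / (z - c) := by
      have := hne z hz
      field_simp; ring
    rw [this]
    refine Complex.mem_slitPlane_of_norm_lt_one ?_
    rw [norm_div, div_lt_one (norm_pos_iff.2 (hne z hz)), ← dist_eq_norm, ← dist_eq_norm, dist_comm]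
    exact hd z hz
  refine ⟨fun z ↦ L z + Complex.log ((z - c') / (z - c)), hL.add ?_, fun z hz ↦ ?_⟩
  · refine ContinuousOn.clog (ContinuousOn.div (by fun_prop) (by fun_prop) hne) hsl
  · rw [Complex.exp_add, he z hz, Complex.exp_log (Complex.slitPlane_ne_zero (hsl z hz)),
      mul_div_cancel₀ _ (hne z hz)]

/-- By `of_dist_lt`, in both directions, existence of a logarithm is locally constant in `c` off the
closed set `E`. -/
lemma IsPreconnected.hasLogOn {E Q : Set ℂ} (hQ : IsPreconnected Q) (hE : IsClosed E)
    (hEQ : Disjoint E Q) {c c' : ℂ} (hc : c ∈ Q) (hc' : c' ∈ Q) (h : HasLogOn E c) :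
    HasLogOn E c' := by
  refine (hQ.induction₂ (fun a b ↦ HasLogOn E a ↔ HasLogOn E b) ?_ (fun a b d _ _ _ h1 h2 ↦ h1.trans h2)
    (fun a b _ _ h1 ↦ h1.symm) hc hc').1 h
  intro a ha
  have haE : Eᶜ ∈ 𝓝 a := hE.isOpen_compl.mem_nhds (Set.disjoint_right.1 hEQ ha)
  obtain ⟨ε, hε, hb⟩ := Metric.mem_nhds_iff.1 haE
  filter_upwards [mem_nhdsWithin_of_mem_nhds (ball_mem_nhds a (half_pos hε))] with b hb'
  rw [mem_ball] at hb'
  have hfar : ∀ z ∈ E, ε ≤ dist z a := fun z hz ↦ by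
    by_contra! hlt; exact hb hlt hz
  refine ⟨fun h ↦ h.of_dist_lt fun z hz ↦ ?_, fun h ↦ h.of_dist_lt fun z hz ↦ ?_⟩
  · linarith [hfar z hz]
  · have := dist_triangle z b a
    rw [dist_comm]
    linarith [hfar z hz]

/-- Two logarithms of one number differ by a multiple of `2πi`, so a continuous choice is locally
constant. -/
lemma IsPreconnected.eq_of_exp_eq {X : Type*} [TopologicalSpace X] {E : Set X} {f : X → ℂ} {a : ℂ}
    (hE : IsPreconnected E) (hf : ContinuousOn f E) (he : ∀ x ∈ E, Complex.exp (f x) = a)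
    {x y : X} (hx : x ∈ E) (hy : y ∈ E) : f x = f y := by
  refine hE.induction₂ (fun x y ↦ f x = f y) ?_ (fun a b d _ _ _ h1 h2 ↦ h1.trans h2)
    (fun a b _ _ h1 ↦ h1.symm) hx hy
  intro x hx
  filter_upwards [(hf x hx).eventually (ball_mem_nhds (f x) one_pos), self_mem_nhdsWithin]
    with y hy hyE
  obtain ⟨n, hn⟩ := Complex.exp_eq_exp_iff_exists_int.1 ((he x hx).trans (he y hyE).symm)
  have h1 : ‖(n : ℂ) * (2 * Real.pi * Complex.I)‖ < 1 := by
    have hy' : dist (f y) (f x) < 1 := hy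
    rwa [dist_comm, dist_eq_norm, hn, add_sub_cancel_left] at hy'
  rw [norm_mul, norm_mul, norm_mul, Complex.norm_I, Complex.norm_intCast, Complex.norm_real,
    Real.norm_eq_abs, abs_of_pos Real.pi_pos] at h1
  have h2 : |(n : ℝ)| < 1 := by
    norm_num at h1
    nlinarith [Real.pi_gt_three, abs_nonneg (n : ℝ)]
  have h3 : n = 0 := by
    have : |n| < 1 := by exact_mod_cast h2
    exact Int.abs_lt_one_iff.1 this
  simpa [h3] using hn

lemma ConformalPair.deriv_ne_zero {f g : ℂ → ℂ} {D D' : Set ℂ} (h : ConformalPair f g D D') {z : ℂ}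
    (hz : z ∈ D) : deriv f z ≠ 0 := by
  intro h0
  have h1 := (h.diff.differentiableAt (h.open_source.mem_nhds hz)).hasDerivAt
  have h2 := (h.diff_symm.differentiableAt (h.open_target.mem_nhds (h.mapsTo z hz))).hasDerivAt
  have h3 := h2.comp z h1
  have h4 : HasDerivAt (g ∘ f) 1 z := by
    refine (hasDerivAt_id z).congr_of_eventuallyEq ?_
    filter_upwards [h.open_source.mem_nhds hz] with w hw using h.left_inv w hw
  have := h3.unique h4
  rw [h0, mul_zero] at this
  exact zero_ne_one this

/-- By injectivity the difference quotient never vanishes. Its logarithm compares the change of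
argument of `f z - f c` with that of `z - c`. -/
lemma ConformalPair.exists_log_slope {f g : ℂ → ℂ} {D D' : Set ℂ} (h : ConformalPair f g D D')
    {c : ℂ} {r : ℝ} (hr : 0 < r) (hc : ball c r ⊆ D) :
    ∃ M : ℂ → ℂ, ContinuousOn M (ball c r) ∧
      ∀ z ∈ ball c r, Complex.exp (M z) * (z - c) = f z - f c := by
  have hd : DifferentiableOn ℂ (dslope f c) (ball c r) :=
    (Complex.differentiableOn_dslope (ball_mem_nhds c hr)).2 (h.diff.mono hc)
  obtain ⟨M, hM, he⟩ := exists_log_on_ball hd fun z hz h0 ↦ by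
    rcases eq_or_ne z c with rfl | hne
    · rw [dslope_same] at h0
      exact h.deriv_ne_zero (hc hz) h0
    · have := sub_smul_dslope f c z
      rw [h0, smul_zero] at this
      exact hne (h.injOn (hc hz) (hc (mem_ball_self hr)) (sub_eq_zero.1 this.symm))
  refine ⟨M, hM.continuousOn, fun z hz ↦ ?_⟩
  rw [he z hz, ← sub_smul_dslope f c z, smul_eq_mul, mul_comm]

/-- The points of the strip on one side of the vertical line through `ζ₀`, together with `ζ₀`. -/
def stripSide (s : ℝ) (ζ₀ : ℂ) : Set ℂ :=
  {ζ | ζ ∈ piStrip ∧ (ζ = ζ₀ ∨ 0 < s * (ζ.re - ζ₀.re))}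

lemma isPreconnected_stripSide {s : ℝ} {ζ₀ : ℂ} (h₀ : ζ₀ ∈ piStrip) :
    IsPreconnected (stripSide s ζ₀) := by
  have hst : StarConvex ℝ ζ₀ (stripSide s ζ₀) := by
    intro y hy a b ha hb hab
    refine ⟨convex_piStrip h₀ hy.1 ha hb hab, ?_⟩
    have ha' : a = 1 - b := by linarith
    rcases hb.eq_or_lt with hb0 | hb0
    · left; simp [ha', ← hb0]
    rcases hy.2 with rfl | h
    · left; rw [← add_smul, hab, one_smul]
    · right
      have : s * ((a • ζ₀ + b • y).re - ζ₀.re) = b * (s * (y.re - ζ₀.re)) := by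
        simp [ha']; ring
      rw [this]; positivity
  exact (hst.isPathConnected ⟨h₀, Or.inl rfl⟩).isConnected.isPreconnected

/-- Change of `log (z - k ζ₀)` from the top to the bottom of a small circle around `ζ₀`, along
the half circle on the left (`s = 1`) or on the right (`s = -1`). -/
lemma ConformalPair.exists_log_halfCircle {k l : ℂ → ℂ} {Ω : Set ℂ} (h : ConformalPair k l piStrip Ω)
    {ζ₀ ζ₁ w : ℂ} {ρ r s : ℝ} (hρ : 0 < ρ) {J : Set ℂ} (hs : s = 1 ∨ s = -1)
    (hball : ∀ ζ ∈ closedBall ζ₀ ρ, ζ ∈ piStrip ∧ k ζ ∈ ball w r)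
    (hJ : IsClosed J) (hJB : J ⊆ ball w r) (hJs : ∀ ζ ∈ stripSide s ζ₀, k ζ ∉ J)
    (hζ₁ : ζ₁ ∈ stripSide s ζ₀) (hk : k ζ₁ ∉ ball w r) {M : ℂ → ℂ}
    (hM : ContinuousOn M (closedBall ζ₀ ρ))
    (hMe : ∀ ζ ∈ closedBall ζ₀ ρ, Complex.exp (M ζ) * (ζ - ζ₀) = k ζ - k ζ₀) :
    ∃ L : ℂ → ℂ, ContinuousOn L J ∧ (∀ z ∈ J, Complex.exp (L z) = z - k ζ₀) ∧
      L (k (ζ₀ - ρ * Complex.I)) - L (k (ζ₀ + ρ * Complex.I))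
        = M (ζ₀ - ρ * Complex.I) - M (ζ₀ + ρ * Complex.I) + s * Real.pi * Complex.I := by
  have h₀ : ζ₀ ∈ piStrip := (hball ζ₀ (mem_closedBall_self hρ.le)).1
  set α : ℝ → ℂ := fun θ ↦ ζ₀ + ρ * Complex.I * Complex.exp (s * θ * Complex.I) with hα
  have hαc : Continuous α := by fun_prop
  have hαn : ∀ θ, α θ - ζ₀ = ρ * Complex.I * Complex.exp (s * θ * Complex.I) := fun θ ↦ by simp [hα]
  have hαb : ∀ θ, ‖α θ - ζ₀‖ = ρ := by
    intro θ
    rw [hαn, norm_mul, norm_mul, Complex.norm_I, Complex.norm_real, Real.norm_eq_abs, abs_of_pos hρ]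
    have : (s * θ * Complex.I : ℂ) = ((s * θ : ℝ) : ℂ) * Complex.I := by push_cast; ring
    rw [this, Complex.norm_exp_ofReal_mul_I]; ring
  have hαB : ∀ θ, α θ ∈ closedBall ζ₀ ρ := fun θ ↦ by
    rw [mem_closedBall, dist_eq_norm, hαb]
  have hαs : ∀ θ ∈ Icc 0 Real.pi, s * ((α θ).re - ζ₀.re) ≤ 0 := by
    intro θ hθ
    have h1 : (α θ).re - ζ₀.re = -(ρ * Real.sin (s * θ)) := by
      rw [← Complex.sub_re, hαn]
      have : (s * θ * Complex.I : ℂ) = ((s * θ : ℝ) : ℂ) * Complex.I := by push_cast; ring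
      rw [this]
      generalize s * θ = φ
      rw [Complex.exp_mul_I, ← Complex.ofReal_cos, ← Complex.ofReal_sin]
      simp [Complex.sin_ofReal_re]
    have h2 : 0 ≤ ρ * Real.sin θ := mul_nonneg hρ.le (Real.sin_nonneg_of_nonneg_of_le_pi hθ.1 hθ.2)
    rw [h1]
    rcases hs with rfl | rfl
    · simpa using h2
    · simpa using h2
  have hkc : ContinuousOn (fun θ ↦ k (α θ)) univ :=
    h.diff.continuousOn.comp hαc.continuousOn fun θ _ ↦ (hball _ (hαB θ)).1
  have hkc' : Continuous fun θ ↦ k (α θ) := continuousOn_univ.1 hkc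
  -- The half circle lies opposite to `stripSide`, so the image of `stripSide` joins `k ζ₀` to a
  -- point outside the disc without meeting `E`. A logarithm based at the outside point exists on
  -- the disc and can be transported to `k ζ₀`.
  set E := J ∪ (fun θ ↦ k (α θ)) '' Icc 0 Real.pi with hE
  have hEc : IsClosed E := hJ.union (isCompact_Icc.image hkc').isClosed
  have hEB : E ⊆ ball w r := by
    refine union_subset hJB ?_
    rintro _ ⟨θ, -, rfl⟩
    exact (hball _ (hαB θ)).2
  have hsub : stripSide s ζ₀ ⊆ piStrip := fun _ hz ↦ hz.1
  have hQ : IsPreconnected (k '' stripSide s ζ₀) :=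
    (isPreconnected_stripSide h₀).image _ (h.diff.continuousOn.mono hsub)
  have hdisj : Disjoint E (k '' stripSide s ζ₀) := by
    rw [Set.disjoint_left]
    rintro z hz ⟨ζ, hζ, rfl⟩
    rcases hz with hz | ⟨θ, hθ, hz⟩
    · exact hJs ζ hζ hz
    · have : α θ = ζ := h.injOn (hball _ (hαB θ)).1 hζ.1 hz
      rw [← this] at hζ
      rcases hζ.2 with h1 | h1
      · have := hαb θ
        rw [h1, sub_self, norm_zero] at this
        linarith
      · linarith [hαs θ hθ]
  obtain ⟨L, hL, he⟩ := hQ.hasLogOn hEc hdisj (mem_image_of_mem k hζ₁)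
    (mem_image_of_mem k (⟨h₀, Or.inl rfl⟩ : ζ₀ ∈ stripSide s ζ₀)) ((hasLogOn_ball hk).mono hEB)
  refine ⟨L, hL.mono subset_union_left, fun z hz ↦ he z (Or.inl hz), ?_⟩
  -- Along the half circle `log (k α - k ζ₀)` is `M + log (α - ζ₀)` up to a constant, and the second
  -- term contributes `s π i`.
  have hconst := isPreconnected_Icc.eq_of_exp_eq (E := Icc 0 Real.pi) (a := ρ * Complex.I)
    (f := fun θ ↦ L (k (α θ)) - M (α θ) - s * θ * Complex.I) (x := Real.pi) (y := 0) ?_ ?_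
    ⟨Real.pi_pos.le, le_rfl⟩ ⟨le_rfl, Real.pi_pos.le⟩
  · have hα0 : α 0 = ζ₀ + ρ * Complex.I := by simp [hα]
    have hαπ : α Real.pi = ζ₀ - ρ * Complex.I := by
      have : Complex.exp (s * Real.pi * Complex.I) = -1 := by
        rcases hs with rfl | rfl
        · simp
        · simp [Complex.exp_neg, Complex.exp_pi_mul_I]
      simp only [hα, this]; ring
    simp only [hα0, hαπ, Complex.ofReal_zero, mul_zero, zero_mul, sub_zero] at hconst
    linear_combination hconst
  · refine ((hL.comp hkc'.continuousOn fun θ hθ ↦ Or.inr ⟨θ, hθ, rfl⟩).sub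
      (hM.comp hαc.continuousOn fun θ _ ↦ hαB θ)).sub (by fun_prop)
  · intro θ hθ
    have h1 := hMe _ (hαB θ)
    rw [Complex.exp_sub, Complex.exp_sub, he _ (Or.inr ⟨θ, hθ, rfl⟩), ← h1, hαn,
      mul_div_cancel_left₀ _ (Complex.exp_ne_zero _), mul_div_cancel_right₀ _ (Complex.exp_ne_zero _)]

/-- A crosscut together with a connected set in the complement separates the domain: it cannot
happen that the crosscut and that set lie in a disc, while both sides of the crosscut leave it. -/
lemma ConformalPair.crosscut_separates {k l : ℂ → ℂ} {Ω : Set ℂ} (h : ConformalPair k l piStrip Ω)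
    {x r : ℝ} {w : ℂ} {σ : ℝ → ℂ} (hσ : ContinuousOn σ (Icc 0 Real.pi))
    (hσk : ∀ θ ∈ Ioo 0 Real.pi, σ θ = k (x + θ * Complex.I)) {J₀ : Set ℂ} (hJc : IsClosed J₀)
    (hJp : IsPreconnected J₀) (hJΩ : Disjoint J₀ Ω) (h0 : σ 0 ∈ J₀) (hπ : σ Real.pi ∈ J₀)
    (hJB : J₀ ⊆ ball w r) (hσB : ∀ θ ∈ Icc 0 Real.pi, σ θ ∈ ball w r) {ζ₁ ζ₂ : ℂ}
    (h₁ : ζ₁ ∈ piStrip) (h₂ : ζ₂ ∈ piStrip) (hx₁ : ζ₁.re < x) (hx₂ : x < ζ₂.re)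
    (hk₁ : k ζ₁ ∉ ball w r) (hk₂ : k ζ₂ ∉ ball w r) : False := by
  have hpi := Real.pi_pos
  have hmid : Real.pi / 2 ∈ Ioo 0 Real.pi := ⟨by linarith, by linarith⟩
  set ζ₀ : ℂ := x + (Real.pi / 2 : ℝ) * Complex.I with hζ₀
  have hz₀ : ζ₀ ∈ piStrip := add_mul_I_mem_piStrip hmid
  have hre : ζ₀.re = x := by simp [hζ₀]
  have hcont : ContinuousAt k ζ₀ := (h.diff.differentiableAt (h.open_source.mem_nhds hz₀)).continuousAt
  have hk0 : k ζ₀ ∈ ball w r := by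
    rw [hζ₀, ← hσk _ hmid]; exact hσB _ (Ioo_subset_Icc_self hmid)
  obtain ⟨ρ, hρ, hρb⟩ := Metric.nhds_basis_closedBall.mem_iff.1
    (inter_mem (h.open_source.mem_nhds hz₀) (hcont (isOpen_ball.mem_nhds hk0)))
  obtain ⟨M, hM, hMe⟩ := h.exists_log_slope hρ fun z hz ↦ (hρb (ball_subset_closedBall hz)).1
  have hhalf : closedBall ζ₀ (ρ / 2) ⊆ ball ζ₀ ρ := closedBall_subset_ball (by linarith)
  have hball : ∀ ζ ∈ closedBall ζ₀ (ρ / 2), ζ ∈ piStrip ∧ k ζ ∈ ball w r :=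
    fun ζ hζ ↦ hρb (ball_subset_closedBall (hhalf hζ))
  have htopζ : ζ₀ + (ρ / 2 : ℝ) * Complex.I ∈ closedBall ζ₀ (ρ / 2) := by
    simp [abs_of_pos hρ]
  have hbotζ : ζ₀ - (ρ / 2 : ℝ) * Complex.I ∈ closedBall ζ₀ (ρ / 2) := by
    simp [abs_of_pos hρ]
  have htop : Real.pi / 2 + ρ / 2 ∈ Ioo 0 Real.pi := by
    have := (hball _ htopζ).1
    simpa [piStrip, hζ₀] using this
  have hbot : Real.pi / 2 - ρ / 2 ∈ Ioo 0 Real.pi := by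
    have := (hball _ hbotζ).1
    simpa [piStrip, hζ₀, -sub_pos] using this
  have hsub1 : Icc 0 (Real.pi / 2 - ρ / 2) ⊆ Icc 0 Real.pi := Icc_subset_Icc_right hbot.2.le
  have hsub2 : Icc (Real.pi / 2 + ρ / 2) Real.pi ⊆ Icc 0 Real.pi := Icc_subset_Icc_left htop.1.le
  -- The crosscut with a gap around its midpoint `ζ₀`, closed up through `J₀`; this set is connected
  -- and misses both sides of the crosscut.
  set J := J₀ ∪ σ '' Icc 0 (Real.pi / 2 - ρ / 2) ∪ σ '' Icc (Real.pi / 2 + ρ / 2) Real.pi with hJ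
  have hJcl : IsClosed J :=
    (hJc.union (isCompact_Icc.image_of_continuousOn (hσ.mono hsub1)).isClosed).union
      (isCompact_Icc.image_of_continuousOn (hσ.mono hsub2)).isClosed
  have hJpre : IsPreconnected J := by
    refine IsPreconnected.union (σ Real.pi) (Or.inl hπ) ⟨Real.pi, ⟨htop.2.le, le_rfl⟩, rfl⟩ ?_
      (isPreconnected_Icc.image _ (hσ.mono hsub2))
    exact IsPreconnected.union (σ 0) h0 ⟨0, ⟨le_rfl, hbot.1.le⟩, rfl⟩ hJp
      (isPreconnected_Icc.image _ (hσ.mono hsub1))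
  have hJball : J ⊆ ball w r := by
    refine union_subset (union_subset hJB ?_) ?_
    · rintro _ ⟨θ, hθ, rfl⟩; exact hσB θ (hsub1 hθ)
    · rintro _ ⟨θ, hθ, rfl⟩; exact hσB θ (hsub2 hθ)
  have hσJ : ∀ θ ∈ Icc 0 Real.pi, θ ≠ Real.pi / 2 → ∀ s, ∀ ζ ∈ stripSide s ζ₀, k ζ ≠ σ θ := by
    intro θ hθ hne s ζ hζ heq
    rcases hθ.1.eq_or_lt with h1 | h1
    · rw [← h1] at heq
      exact Set.disjoint_left.1 hJΩ h0 (heq ▸ h.mapsTo ζ hζ.1)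
    rcases hθ.2.eq_or_lt with h3 | h3
    · rw [h3] at heq
      exact Set.disjoint_left.1 hJΩ hπ (heq ▸ h.mapsTo ζ hζ.1)
    rw [hσk θ ⟨h1, h3⟩] at heq
    have h4 := h.injOn hζ.1 (add_mul_I_mem_piStrip ⟨h1, h3⟩) heq
    rcases hζ.2 with h5 | h5
    · apply hne
      have := congrArg Complex.im (h4.symm.trans h5)
      simpa [hζ₀] using this
    · rw [h4, hre] at h5
      simp at h5
  have hJs : ∀ s, ∀ ζ ∈ stripSide s ζ₀, k ζ ∉ J := by
    rintro s ζ hζ ((h1 | ⟨θ, hθ, h1⟩) | ⟨θ, hθ, h1⟩)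
    · exact Set.disjoint_left.1 hJΩ h1 (h.mapsTo ζ hζ.1)
    · exact hσJ θ (hsub1 hθ) (by rintro rfl; linarith [hθ.2]) s ζ hζ h1.symm
    · exact hσJ θ (hsub2 hθ) (by rintro rfl; linarith [hθ.1]) s ζ hζ h1.symm
  have hMc := hM.mono hhalf
  have hMe' := fun ζ hζ ↦ hMe ζ (hhalf hζ)
  obtain ⟨L, hL, he, hv⟩ := h.exists_log_halfCircle (half_pos hρ) (Or.inl rfl) hball hJcl hJball
    (hJs 1) (ζ₁ := ζ₂) ⟨h₂, Or.inr (by rw [hre]; linarith)⟩ hk₂ hMc hMe'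
  obtain ⟨L', hL', he', hv'⟩ := h.exists_log_halfCircle (half_pos hρ) (Or.inr rfl) hball hJcl hJball
    (hJs (-1)) (ζ₁ := ζ₁) ⟨h₁, Or.inr (by rw [hre]; linarith)⟩ hk₁ hMc hMe'
  have htJ : k (ζ₀ + (ρ / 2 : ℝ) * Complex.I) ∈ J := by
    refine Or.inr ⟨_, ⟨le_rfl, htop.2.le⟩, ?_⟩
    rw [hσk _ htop, hζ₀]; congr 1; push_cast; ring
  have hbJ : k (ζ₀ - (ρ / 2 : ℝ) * Complex.I) ∈ J := by
    refine Or.inl (Or.inr ⟨_, ⟨hbot.1.le, le_rfl⟩, ?_⟩)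
    rw [hσk _ hbot, hζ₀]; congr 1; push_cast; ring
  have hne : ∀ z ∈ J, z - k ζ₀ ≠ 0 := fun z hz ↦ by
    rw [← he z hz]; exact Complex.exp_ne_zero _
  -- The two logarithms differ by a constant on connected `J`, yet their changes from the top to the
  -- bottom of the gap differ by `2πi`.
  have := hJpre.eq_of_exp_eq (f := fun z ↦ L z - L' z) (a := 1) (hL.sub hL') (fun z hz ↦ by
    rw [Complex.exp_sub, he z hz, he' z hz, div_self (hne z hz)]) htJ hbJ
  have hfin : (Real.pi : ℂ) * Complex.I = 0 := by
    push_cast at this hv hv'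
    linear_combination (1 / 2) * (hv' - hv - this)
  simp [Real.pi_ne_zero] at hfin

/-! ### The tip of a slit -/

/-- A Hölder continuous map on an open interval extends continuously to the closed interval. -/
lemma exists_continuousOn_Icc_of_norm_sub_le {F : ℝ → ℂ} {a b ε : ℝ} (hab : a < b) (hε : 0 < ε)
    (hF : ∀ x ∈ Ioo a b, ∀ y ∈ Ioo a b, ‖F x - F y‖ ≤ ε * √|x - y|) :
    ∃ σ : ℝ → ℂ, ContinuousOn σ (Icc a b) ∧ ∀ x ∈ Ioo a b, σ x = F x := by
  have huc : UniformContinuousOn F (Ioo a b) := by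
    rw [Metric.uniformContinuousOn_iff]
    intro e he
    refine ⟨(e / ε) ^ 2, by positivity, fun x hx y hy hxy ↦ ?_⟩
    rw [dist_eq_norm]
    refine (hF x hx y hy).trans_lt ?_
    have h1 : √|x - y| < e / ε := (Real.sqrt_lt' (by positivity)).2 (by rwa [← Real.dist_eq])
    calc ε * √|x - y| < ε * (e / ε) := mul_lt_mul_of_pos_left h1 hε
      _ = e := by field_simp
  have hlim : ∀ f : Filter ℝ, f.NeBot → ∀ c, f ≤ 𝓝 c → Ioo a b ∈ f → ∃ e, Tendsto F f (𝓝 e) := by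
    intro f hf c hc hm
    exact CompleteSpace.complete ((cauchy_nhds.mono hc).map_of_le huc (le_principal_iff.2 hm))
  obtain ⟨la, hla⟩ := hlim (𝓝[>] a) inferInstance a nhdsWithin_le_nhds (Ioo_mem_nhdsGT hab)
  obtain ⟨lb, hlb⟩ := hlim (𝓝[<] b) inferInstance b nhdsWithin_le_nhds (Ioo_mem_nhdsLT hab)
  refine ⟨extendFrom (Ioo a b) F, continuousOn_Icc_extendFrom_Ioo huc.continuousOn hla hlb,
    fun x hx ↦ ?_⟩
  exact extendFrom_extends huc.continuousOn x hx

/-- If the limit were in `Ω`, continuity of the inverse would put the endpoint of the vertical line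
inside the open strip. -/
lemma ConformalPair.notMem_of_tendsto_vertical {k l : ℂ → ℂ} {Ω : Set ℂ}
    (h : ConformalPair k l piStrip Ω) {x θ₀ : ℝ} {e : ℂ} {f : Filter ℝ} [f.NeBot]
    (hf : f ≤ 𝓝 θ₀) (hm : ∀ᶠ θ in f, θ ∈ Ioo 0 Real.pi) (hθ₀ : θ₀ ∉ Ioo 0 Real.pi)
    (ht : Tendsto (fun θ : ℝ ↦ k (x + θ * Complex.I)) f (𝓝 e)) : e ∉ Ω := by
  intro he
  have h1 : Tendsto l (𝓝 e) (𝓝 (l e)) :=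
    (h.diff_symm.differentiableAt (h.open_target.mem_nhds he)).continuousAt
  have h2 : Tendsto (fun θ : ℝ ↦ (x + θ * Complex.I : ℂ)) f (𝓝 (l e)) := by
    refine (h1.comp ht).congr' ?_
    filter_upwards [hm] with θ hθ using h.left_inv _ (add_mul_I_mem_piStrip hθ)
  have h3 : Tendsto (fun θ : ℝ ↦ (x + θ * Complex.I : ℂ)) f (𝓝 (x + θ₀ * Complex.I)) := by
    have : Continuous fun θ : ℝ ↦ (x + θ * Complex.I : ℂ) := by fun_prop
    exact (this.tendsto θ₀).mono_left hf
  have h4 := h.mapsTo_symm e he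
  rw [tendsto_nhds_unique h2 h3] at h4
  apply hθ₀
  simpa [piStrip] using h4

/-- Let the slit `γ(0, t]` of `D` be removed by `h⁻¹`. If the tip corresponds to the real point
`0`, then `h` is continuous there. -/
lemma tendsto_slit_tip {D : Set ℂ} (hD : IsOpen D) (hb : Bornology.IsBounded D) {γ : ℝ → ℂ}
    {t τ : ℝ} (ht : 0 < t) (htτ : t < τ) (hγ : ContinuousOn γ (Ioo 0 τ)) (hi : InjOn γ (Ioo 0 τ))
    (hγD : ∀ s ∈ Ioo 0 τ, γ s ∈ D)
    (hstart : ∀ s ∈ Ioo 0 t, ∃ ε > 0, ∀ u ∈ Ioc 0 s, ε ≤ dist (γ u) (γ t))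
    {h G : ℂ → ℂ} (hp : ConformalPair h G halfPlane (slitDomain D γ t))
    (hG : Tendsto G (𝓝[slitDomain D γ t] (γ t)) (𝓝 0)) :
    Tendsto h (𝓝[halfPlane] 0) (𝓝 (γ t)) := by
  set Ω := slitDomain D γ t with hΩ
  set k := h ∘ Complex.exp with hk
  set l := Complex.log ∘ G with hl
  have hkl : ConformalPair k l piStrip Ω := expPair.trans hp
  have htI : t ∈ Ioo 0 τ := ⟨ht, htτ⟩
  have hγt : γ t ∉ Ω := fun h ↦ h.2 ⟨t, ⟨ht, le_rfl⟩, rfl⟩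
  have hγc : ContinuousAt γ t := hγ.continuousAt (Ioo_mem_nhds ht htτ)
  have hγΩ : ∀ u ∈ Ioo t τ, γ u ∈ Ω := by
    intro u hu
    refine ⟨hγD u ⟨ht.trans hu.1, hu.2⟩, ?_⟩
    rintro ⟨v, hv, hve⟩
    have := hi ⟨hv.1, hv.2.trans_lt htτ⟩ ⟨ht.trans hu.1, hu.2⟩ hve
    linarith [hv.2, hu.1]
  have hγr : Tendsto γ (𝓝[>] t) (𝓝[Ω] (γ t)) := by
    refine tendsto_nhdsWithin_iff.2 ⟨hγc.tendsto.mono_left nhdsWithin_le_nhds, ?_⟩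
    filter_upwards [Ioo_mem_nhdsGT htτ] with u hu using hγΩ u hu
  have hGγ : Tendsto (fun u ↦ G (γ u)) (𝓝[>] t) (𝓝 0) := hG.comp hγr
  -- Suppose images of points arbitrarily near `0` stay at distance `ε₀` from the tip. A short
  -- crosscut around `0`, met by the curve after time `t`, lies with the last piece of the slit in a
  -- small disc at the tip, while points on both sides of it have images off that disc.
  by_contra hnot
  rw [Metric.tendsto_nhds] at hnot
  push Not at hnot
  obtain ⟨ε₀, hε₀, hfreq⟩ := hnot
  have hfar : 0 < dist (h Complex.I) (γ t) := by
    refine dist_pos.2 fun heq ↦ hγt ?_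
    rw [← heq]
    exact hp.mapsTo _ (by simp [halfPlane])
  obtain ⟨ε₁, hε₁, hballD⟩ := Metric.isOpen_iff.1 hD (γ t) (hγD t htI)
  set ε := min ε₀ (min (dist (h Complex.I) (γ t)) ε₁) with hεdef
  have hε : 0 < ε := lt_min hε₀ (lt_min hfar hε₁)
  have hεε₀ : ε ≤ ε₀ := min_le_left _ _
  have hεfar : ε ≤ dist (h Complex.I) (γ t) := (min_le_right _ _).trans (min_le_left _ _)
  have hεε₁ : ε ≤ ε₁ := (min_le_right _ _).trans (min_le_right _ _)
  -- a piece of the slit near its tip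
  obtain ⟨s₀, hs₀, hs₀b⟩ := mem_nhdsLT_iff_exists_Ioo_subset.1
    ((hγc.tendsto.mono_left nhdsWithin_le_nhds) (ball_mem_nhds (γ t) hε))
  obtain ⟨s, hs1, hs2⟩ := exists_between (max_lt hs₀ ht)
  have hs : s ∈ Ioo 0 t := ⟨(le_max_right _ _).trans_lt hs1, hs2⟩
  have hsIcc : Icc s t ⊆ Ioo 0 τ := fun u hu ↦ ⟨hs.1.trans_le hu.1, hu.2.trans_lt htτ⟩
  have hJB : γ '' Icc s t ⊆ ball (γ t) ε := by
    rintro _ ⟨u, hu, rfl⟩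
    rcases hu.2.eq_or_lt with rfl | h'
    · exact mem_ball_self hε
    · exact hs₀b ⟨((le_max_left _ _).trans_lt hs1).trans_le hu.1, h'⟩
  obtain ⟨ε₂, hε₂, hstart₂⟩ := hstart s hs
  -- Keeping the crosscut within `ε₂` of the tip ensures that its ends meet the slit only in `γ [s,
  -- t]`.
  set ε' := min ε ε₂ with hε'def
  have hε' : 0 < ε' := lt_min hε hε₂
  -- a short crosscut that the curve passes
  have hnear : ∀ᶠ u in 𝓝[>] t, u < τ ∧ dist (γ u) (γ t) < ε' / 4 := by
    filter_upwards [Ioo_mem_nhdsGT htτ, (hγr.mono_right nhdsWithin_le_nhds).eventually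
      (ball_mem_nhds (γ t) (show 0 < ε' / 4 by positivity))] with u hu hu'
    exact ⟨hu.2, hu'⟩
  obtain ⟨u₁, hu₁, hu₁'⟩ := mem_nhdsGT_iff_exists_Ioc_subset.1 hnear
  have hu₁τ : u₁ < τ := (hu₁' ⟨hu₁, le_rfl⟩).1
  set ε₃ := ε' / (4 * √Real.pi) with hε₃def
  have hpi : 0 < √Real.pi := Real.sqrt_pos.2 Real.pi_pos
  have hε₃ : 0 < ε₃ := by positivity
  obtain ⟨x, hx, hxH⟩ := hkl.exists_short_crosscut (hb.subset sdiff_subset) hε₃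
    (min 0 (l (γ u₁)).re)
  have hx0 : x < 0 := hx.trans_le (min_le_left _ _)
  have hxu₁ : x < (l (γ u₁)).re := hx.trans_le (min_le_right _ _)
  have hnormG : ∀ u ∈ Ioo t τ, 0 < ‖G (γ u)‖ := fun u hu ↦
    norm_pos_iff.2 (ne_zero_of_mem_halfPlane (hp.mapsTo_symm _ (hγΩ u hu)))
  have hlre : ∀ u, (l (γ u)).re = Real.log ‖G (γ u)‖ := fun u ↦ by
    simp [hl, Complex.log_re]
  -- Just after `t` the curve is inside the crosscut, since `G (γ u) → 0`, and at `u₁` it is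
  -- outside. The crossing point places the whole short crosscut near the tip.
  obtain ⟨u₂, hu₂, hu₂'⟩ : ∃ u₂ ∈ Ioo t u₁, ‖G (γ u₂)‖ < Real.exp x := by
    have h1 : ∀ᶠ u in 𝓝[>] t, ‖G (γ u)‖ < Real.exp x :=
      (tendsto_norm_zero.comp hGγ).eventually (gt_mem_nhds (Real.exp_pos x))
    obtain ⟨u, hu⟩ := (h1.and (Ioo_mem_nhdsGT hu₁)).exists
    exact ⟨u, hu.2, hu.1⟩
  obtain ⟨u, hu, hux⟩ : ∃ u ∈ Icc u₂ u₁, (l (γ u)).re = x := by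
    have hc : ContinuousOn (fun u ↦ (l (γ u)).re) (Icc u₂ u₁) := by
      refine Complex.continuous_re.comp_continuousOn ?_
      refine hkl.diff_symm.continuousOn.comp (hγ.mono fun v hv ↦
        ⟨ht.trans (hu₂.1.trans_le hv.1), hv.2.trans_lt hu₁τ⟩) fun v hv ↦ ?_
      exact hγΩ v ⟨hu₂.1.trans_le hv.1, hv.2.trans_lt hu₁τ⟩
    have hmem : x ∈ Icc (l (γ u₂)).re (l (γ u₁)).re := by
      refine ⟨?_, hxu₁.le⟩
      rw [hlre, Real.log_le_iff_le_exp (hnormG u₂ ⟨hu₂.1, hu₂.2.trans hu₁τ⟩)]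
      exact hu₂'.le
    obtain ⟨u, hu, hux⟩ := intermediate_value_Icc hu₂.2.le hc hmem
    exact ⟨u, hu, hux⟩
  have hut : u ∈ Ioc t u₁ := ⟨hu₂.1.trans_le hu.1, hu.2⟩
  have huΩ : γ u ∈ Ω := hγΩ u ⟨hut.1, hut.2.trans_lt hu₁τ⟩
  have hud : dist (γ u) (γ t) < ε' / 4 := (hu₁' hut).2
  have hlu := hkl.mapsTo_symm _ huΩ
  obtain ⟨θ₁, hθ₁, hγu⟩ : ∃ θ ∈ Ioo 0 Real.pi, k (x + θ * Complex.I) = γ u := by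
    refine ⟨(l (γ u)).im, hlu, ?_⟩
    rw [← hux, Complex.re_add_im, hkl.right_inv _ huΩ]
  obtain ⟨σ, hσ, hσk⟩ := exists_continuousOn_Icc_of_norm_sub_le
    (F := fun θ : ℝ ↦ k (x + θ * Complex.I)) Real.pi_pos hε₃ hxH
  have hclose : ∀ θ ∈ Icc 0 Real.pi, dist (σ θ) (γ t) ≤ ε' / 2 := by
    have h1 : MapsTo σ (Ioo 0 Real.pi) (closedBall (γ t) (ε' / 2)) := by
      intro θ hθ
      rw [mem_closedBall, hσk θ hθ]
      refine (dist_triangle _ (γ u) _).trans ?_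
      have h2 : dist (k (x + θ * Complex.I)) (γ u) ≤ ε' / 4 := by
        rw [← hγu, dist_eq_norm]
        refine (hxH θ hθ θ₁ hθ₁).trans ?_
        have h3 : √|θ - θ₁| ≤ √Real.pi := by
          refine Real.sqrt_le_sqrt (abs_le.2 ⟨?_, ?_⟩) <;> linarith [hθ.1, hθ.2, hθ₁.1, hθ₁.2]
        calc ε₃ * √|θ - θ₁| ≤ ε₃ * √Real.pi := by gcongr
          _ = ε' / 4 := by rw [hε₃def]; field_simp
      linarith
    have h4 := h1.closure_of_continuousOn (by rwa [closure_Ioo Real.pi_pos.ne])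
    rw [closure_Ioo Real.pi_pos.ne, isClosed_closedBall.closure_eq] at h4
    exact h4
  have hε'ε : ε' ≤ ε := min_le_left _ _
  have hend : ∀ θ ∈ Icc 0 Real.pi, σ θ ∉ Ω → σ θ ∈ γ '' Icc s t := by
    intro θ hθ hn
    have hd := hclose θ hθ
    have hD' : σ θ ∈ D := hballD (mem_ball.2 (by linarith))
    have : σ θ ∈ γ '' Ioc 0 t := by
      by_contra hc
      exact hn ⟨hD', hc⟩
    obtain ⟨v, hv, hve⟩ := this
    refine ⟨v, ⟨?_, hv.2⟩, hve⟩
    by_contra! hlt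
    have h1 := hstart₂ v ⟨hv.1, hlt.le⟩
    rw [hve] at h1
    have : ε' ≤ ε₂ := min_le_right _ _
    linarith
  have hσ0 : σ 0 ∉ Ω := by
    refine hkl.notMem_of_tendsto_vertical (x := x) (θ₀ := 0) (f := 𝓝[>] 0) nhdsWithin_le_nhds
      (Ioo_mem_nhdsGT Real.pi_pos) (by simp) ?_
    have h1 : Tendsto σ (𝓝[>] 0) (𝓝 (σ 0)) := by
      have := (hσ 0 ⟨le_rfl, Real.pi_pos.le⟩).mono Ioo_subset_Icc_self
      rwa [ContinuousWithinAt, nhdsWithin_Ioo_eq_nhdsGT Real.pi_pos] at this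
    refine h1.congr' ?_
    filter_upwards [Ioo_mem_nhdsGT Real.pi_pos] with θ hθ using hσk θ hθ
  have hσπ : σ Real.pi ∉ Ω := by
    refine hkl.notMem_of_tendsto_vertical (x := x) (θ₀ := Real.pi) (f := 𝓝[<] Real.pi)
      nhdsWithin_le_nhds (Ioo_mem_nhdsLT Real.pi_pos) (by simp) ?_
    have h1 : Tendsto σ (𝓝[<] Real.pi) (𝓝 (σ Real.pi)) := by
      have := (hσ Real.pi ⟨Real.pi_pos.le, le_rfl⟩).mono Ioo_subset_Icc_self
      rwa [ContinuousWithinAt, nhdsWithin_Ioo_eq_nhdsLT Real.pi_pos] at this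
    refine h1.congr' ?_
    filter_upwards [Ioo_mem_nhdsLT Real.pi_pos] with θ hθ using hσk θ hθ
  -- a point inside the crosscut whose image is far from the tip
  obtain ⟨w, hwd, hwH, hwx⟩ : ∃ w, ε₀ ≤ dist (h w) (γ t) ∧ w ∈ halfPlane ∧ ‖w‖ < Real.exp x := by
    have h1 : ∀ᶠ w : ℂ in 𝓝[halfPlane] 0, w ∈ halfPlane ∧ ‖w‖ < Real.exp x := by
      filter_upwards [self_mem_nhdsWithin, mem_nhdsWithin_of_mem_nhds
        (ball_mem_nhds (0 : ℂ) (Real.exp_pos x))] with w hw hw'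
      exact ⟨hw, by simpa using hw'⟩
    obtain ⟨w, hw⟩ := (hfreq.and_eventually h1).exists
    exact ⟨w, hw.1, hw.2.1, hw.2.2⟩
  have hγcpt : IsCompact (γ '' Icc s t) := isCompact_Icc.image_of_continuousOn (hγ.mono hsIcc)
  have hkw : k (Complex.log w) = h w := by
    simp [hk, Complex.exp_log (ne_zero_of_mem_halfPlane hwH)]
  have hkI : k (Complex.log Complex.I) = h Complex.I := by
    simp [hk, Complex.exp_log Complex.I_ne_zero]
  refine hkl.crosscut_separates (x := x) (r := ε) (w := γ t) hσ hσk hγcpt.isClosed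
    (isPreconnected_Icc.image _ (hγ.mono hsIcc)) ?_ (hend 0 ⟨le_rfl, Real.pi_pos.le⟩ hσ0)
    (hend _ ⟨Real.pi_pos.le, le_rfl⟩ hσπ) hJB (fun θ hθ ↦ ?_) (ζ₁ := Complex.log w)
    (ζ₂ := Complex.log Complex.I) (log_mem_piStrip hwH) (log_mem_piStrip (by simp)) ?_ ?_ ?_ ?_
  · rw [Set.disjoint_left]
    rintro _ ⟨v, hv, rfl⟩ hv'
    exact hv'.2 ⟨v, ⟨hs.1.trans_le hv.1, hv.2⟩, rfl⟩
  · rw [mem_ball]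
    linarith [hclose θ hθ]
  · rw [Complex.log_re, Real.log_lt_iff_lt_exp (norm_pos_iff.2 (ne_zero_of_mem_halfPlane hwH))]
    exact hwx
  · rw [Complex.log_re]; simpa using hx0
  · rw [hkw, mem_ball, not_lt]; linarith
  · rw [hkI, mem_ball, not_lt]; linarith

/-! ### Prime ends as images of boundary filters of the half plane -/

lemma ConformalPair.map_eq {f g : ℂ → ℂ} {D D' : Set ℂ} (h : ConformalPair f g D D')
    {A B : Filter ℂ} (hB : D' ∈ B) (hf : Tendsto f A B) (hg : Tendsto g B A) : map f A = B := by
  refine le_antisymm hf fun s hs ↦ ?_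
  have h1 : ∀ᶠ w in B, f (g w) ∈ s := hg hs
  filter_upwards [h1, hB] with w hw hwD
  rwa [h.right_inv w hwD] at hw

lemma ConformalPair.map_symm_map {f g : ℂ → ℂ} {D D' : Set ℂ} (h : ConformalPair f g D D')
    {A : Filter ℂ} (hA : D ∈ A) : map g (map f A) = A := by
  rw [map_map]
  conv_rhs => rw [← map_id (f := A)]
  refine Filter.map_congr ?_
  filter_upwards [hA] with z hz using h.left_inv z hz

lemma halfPlane_mem_infH : halfPlane ∈ infH := mem_inf_of_right (mem_principal_self _)

lemma tendsto_infH_iff {f : ℂ → ℂ} {A : Filter ℂ} :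
    Tendsto f A infH ↔ Tendsto f A (cocompact ℂ) ∧ ∀ᶠ z in A, f z ∈ halfPlane := by
  rw [infH, tendsto_inf, tendsto_principal]

lemma one_mem_closure_ball {ζ : ℂ} (hζ : ‖ζ‖ = 1) : (𝓝[ball (0 : ℂ) 1] ζ).NeBot := by
  refine mem_closure_iff_nhdsWithin_neBot.1 ?_
  rw [closure_ball _ one_ne_zero]
  simp [hζ]

lemma tendsto_discToHalf_one {w : ℂ} (hw : 0 < w.im) :
    Tendsto (discToHalf w) (𝓝[ball 0 1] 1) infH := by
  refine tendsto_infH_iff.2 ⟨?_, ?_⟩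
  · rw [← Metric.cobounded_eq_cocompact, ← tendsto_norm_atTop_iff_cobounded]
    have h1 : Tendsto (fun ζ : ℂ ↦ ‖w - (starRingEnd ℂ) w * ζ‖) (𝓝[ball 0 1] 1)
        (𝓝 ‖w - (starRingEnd ℂ) w‖) := by
      have : Continuous fun ζ : ℂ ↦ ‖w - (starRingEnd ℂ) w * ζ‖ := by fun_prop
      have h2 := (this.tendsto 1).mono_left (nhdsWithin_le_nhds (s := ball 0 1))
      simpa using h2
    have h2 : Tendsto (fun ζ : ℂ ↦ ‖1 - ζ‖) (𝓝[ball 0 1] 1) (𝓝[>] 0) := by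
      refine tendsto_nhdsWithin_iff.2 ⟨?_, ?_⟩
      · have : Continuous fun ζ : ℂ ↦ ‖1 - ζ‖ := by fun_prop
        have h2 := (this.tendsto 1).mono_left (nhdsWithin_le_nhds (s := ball 0 1))
        simpa using h2
      · filter_upwards [self_mem_nhdsWithin] with ζ hζ
          using norm_pos_iff.2 (one_sub_ne_zero_of_mem_ball hζ)
    have h3 := h1.pos_mul_atTop (norm_pos_iff.2 (sub_conj_ne_zero hw hw.le))
      (tendsto_inv_nhdsGT_zero.comp h2)
    refine h3.congr fun ζ ↦ ?_
    rw [discToHalf, norm_div, div_eq_mul_inv]; rfl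
  · filter_upwards [self_mem_nhdsWithin] with ζ hζ using (discToHalf_pair hw).mapsTo ζ hζ

lemma tendsto_halfToDisc_infH {w : ℂ} (hw : 0 < w.im) :
    Tendsto (fun z ↦ (z - w) / (z - (starRingEnd ℂ) w)) infH (𝓝[ball 0 1] 1) := by
  refine tendsto_nhdsWithin_iff.2 ⟨?_, ?_⟩
  · have h1 : Tendsto (fun z : ℂ ↦ (z - (starRingEnd ℂ) w)) infH (cocompact ℂ) :=
      ((Homeomorph.subRight ((starRingEnd ℂ) w)).isClosedEmbedding.tendsto_cocompact).mono_left
        inf_le_left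
    have h2 : Tendsto (fun z : ℂ ↦ (z - (starRingEnd ℂ) w)⁻¹) infH (𝓝 0) := by
      rw [← Metric.cobounded_eq_cocompact] at h1
      exact tendsto_inv₀_cobounded.comp h1
    have h3 : Tendsto (fun z : ℂ ↦ 1 - (w - (starRingEnd ℂ) w) * (z - (starRingEnd ℂ) w)⁻¹) infH
        (𝓝 (1 - (w - (starRingEnd ℂ) w) * 0)) := (h2.const_mul _).const_sub 1
    rw [mul_zero, sub_zero] at h3
    refine h3.congr' ?_
    filter_upwards [halfPlane_mem_infH] with z hz
    have := sub_conj_ne_zero hz hw.le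
    field_simp; ring
  · filter_upwards [halfPlane_mem_infH] with z hz using (discToHalf_pair hw).mapsTo_symm z hz

lemma map_discToHalf_one {w : ℂ} (hw : 0 < w.im) : map (discToHalf w) (𝓝[ball 0 1] 1) = infH :=
  (discToHalf_pair hw).map_eq halfPlane_mem_infH (tendsto_discToHalf_one hw)
    (tendsto_halfToDisc_infH hw)

lemma map_discToHalf_neg_one (u : ℝ) :
    map (discToHalf (u + Complex.I)) (𝓝[ball 0 1] (-1)) = 𝓝[halfPlane] (u : ℂ) := by
  have hw : 0 < (u + Complex.I : ℂ).im := by simp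
  have hp := discToHalf_pair hw
  refine hp.map_eq self_mem_nhdsWithin ?_ ?_
  · refine tendsto_nhdsWithin_iff.2 ⟨?_, ?_⟩
    · have h1 : ContinuousAt (discToHalf (u + Complex.I)) (-1) := by
        unfold discToHalf
        refine ContinuousAt.div (by fun_prop) (by fun_prop) (by norm_num)
      have h2 : discToHalf (u + Complex.I) (-1) = u := by
        simp [discToHalf]; ring
      have h3 := h1.tendsto
      rw [h2] at h3
      exact h3.mono_left nhdsWithin_le_nhds
    · filter_upwards [self_mem_nhdsWithin] with ζ hζ using hp.mapsTo ζ hζ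
  · refine tendsto_nhdsWithin_iff.2 ⟨?_, ?_⟩
    · have h1 : ContinuousAt (fun z ↦ (z - (u + Complex.I)) / (z - (starRingEnd ℂ) (u + Complex.I)))
          (u : ℂ) := by
        refine ContinuousAt.div (by fun_prop) (by fun_prop) (by simp)
      have h3 := h1.tendsto
      have h2 : ((u : ℂ) - (u + Complex.I)) / (u - (starRingEnd ℂ) (u + Complex.I)) = -1 := by
        simp
      rw [h2] at h3
      exact h3.mono_left nhdsWithin_le_nhds
    · filter_upwards [self_mem_nhdsWithin] with z hz using hp.mapsTo_symm z hz

lemma ConformalPair.isPrimeEnd_map_infH {h G : ℂ → ℂ} {Ω : Set ℂ}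
    (H : ConformalPair h G halfPlane Ω) : IsPrimeEnd Ω (map h infH) := by
  have hw : 0 < Complex.I.im := by simp
  refine ⟨h ∘ discToHalf Complex.I, 1, ((discToHalf_pair hw).trans H).bijOn, norm_one, ?_⟩
  rw [← map_map, unitDisc, map_discToHalf_one hw]

lemma ConformalPair.isPrimeEnd_map_nhdsWithin {h G : ℂ → ℂ} {Ω : Set ℂ}
    (H : ConformalPair h G halfPlane Ω) (u : ℝ) : IsPrimeEnd Ω (map h (𝓝[halfPlane] (u : ℂ))) := by
  have hw : 0 < (u + Complex.I : ℂ).im := by simp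
  refine ⟨h ∘ discToHalf (u + Complex.I), -1, ((discToHalf_pair hw).trans H).bijOn, by simp, ?_⟩
  rw [← map_map, unitDisc, map_discToHalf_neg_one]

lemma IsPrimeEnd.mem {D : Set ℂ} {b : Filter ℂ} (hb : IsPrimeEnd D b) : D ∈ b := by
  obtain ⟨q, ζ, hq, -, rfl⟩ := hb
  rw [mem_map]
  filter_upwards [self_mem_nhdsWithin] with z hz using hq.2.mapsTo hz

lemma IsPrimeEnd.neBot {D : Set ℂ} {b : Filter ℂ} (hb : IsPrimeEnd D b) : b.NeBot := by
  obtain ⟨q, ζ, hq, hζ, rfl⟩ := hb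
  have : (𝓝[unitDisc] ζ).NeBot := one_mem_closure_ball hζ
  infer_instance

/-- The prime end sent to `∞` by a conformal map onto the half plane. -/
lemma IsPrimeEnd.eq_map_infH {D : Set ℂ} {b : Filter ℂ} (hb : IsPrimeEnd D b) {φ f : ℂ → ℂ}
    (h : ConformalPair φ f D halfPlane) (ht : Tendsto φ b (cocompact ℂ)) : b = map f infH := by
  have hbD := hb.mem
  have ht' : Tendsto φ b infH := tendsto_infH_iff.2 ⟨ht, by
    filter_upwards [hbD] with z hz using h.mapsTo z hz⟩
  have hw : 0 < Complex.I.im := by simp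
  rw [← h.map_symm_map hbD]
  congr 1
  obtain ⟨q, ζ, hq, hζ, rfl⟩ := hb
  have hqp := hq.pair isOpen_ball
  -- In disc coordinates this is an automorphism sending `ζ` to `1`, hence a homeomorphism between
  -- the two boundary filters.
  have hF := (hqp.trans h).trans (discToHalf_pair hw).symm
  have h1 := hF.map_nhdsWithin_ball hζ norm_one
    (((tendsto_halfToDisc_infH hw).comp (tendsto_map'_iff.1 ht')).mono_right nhdsWithin_le_nhds)
  rw [← map_discToHalf_one hw, ← h1, map_map, map_map]
  refine Filter.map_congr ?_
  filter_upwards [self_mem_nhdsWithin] with z hz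
  simp only [Function.comp_apply]
  exact ((discToHalf_pair hw).right_inv _ (h.mapsTo _ (hqp.mapsTo z hz))).symm

/-- Read in the disc, the transition map fixes `0`, so it is a rotation, and it fixes the boundary
point `1`. This identifies the chordal map provided by `quadClass` with any other of the same
normalization. -/
lemma eqOn_of_isChordalMap {D : Set ℂ} {b : Filter ℂ} (hb : IsPrimeEnd D b) {φ φ' f f' : ℂ → ℂ}
    (h : ConformalPair φ f D halfPlane) (h' : ConformalPair φ' f' D halfPlane)
    (ht : Tendsto φ b (cocompact ℂ)) (ht' : Tendsto φ' b (cocompact ℂ)) {p : ℂ} (hp : p ∈ D)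
    (hφp : φ p = Complex.I) (hφp' : φ' p = Complex.I) : EqOn φ φ' D := by
  have hw : 0 < Complex.I.im := by simp
  have hd := discToHalf_pair hw
  have hF := ((hd.trans h'.symm).trans h).trans hd.symm
  have h0 : discToHalf Complex.I 0 = Complex.I := by simp [discToHalf]
  have hf'p : f' Complex.I = p := by rw [← hφp', h'.left_inv p hp]
  obtain ⟨c, -, hc⟩ := hF.exists_eq_mul (by simp [h0, hf'p, hφp])
  have hφb : Tendsto φ b infH := tendsto_infH_iff.2 ⟨ht, by
    filter_upwards [hb.mem] with z hz using h.mapsTo z hz⟩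
  have hf'b : Tendsto f' infH b := (hb.eq_map_infH h' ht').symm.le
  have h1 := (tendsto_halfToDisc_infH hw).comp (hφb.comp (hf'b.comp (tendsto_discToHalf_one hw)))
  have h2 := h1.mono_right nhdsWithin_le_nhds
  have hne : (𝓝[ball (0 : ℂ) 1] 1).NeBot := one_mem_closure_ball norm_one
  have h3 : Tendsto (fun z : ℂ ↦ z * c) (𝓝[ball 0 1] 1) (𝓝 (1 * c)) :=
    ((continuous_mul_const c).tendsto 1).mono_left nhdsWithin_le_nhds
  have hc1 : (1 : ℂ) = 1 * c := by
    refine tendsto_nhds_unique h2 (h3.congr' ?_)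
    filter_upwards [self_mem_nhdsWithin] with z hz using (hc z hz).symm
  rw [one_mul] at hc1
  intro z hz
  set v := (φ' z - Complex.I) / (φ' z - (starRingEnd ℂ) Complex.I) with hv
  have hvb : v ∈ ball (0 : ℂ) 1 := hd.mapsTo_symm _ (h'.mapsTo z hz)
  have h4 := hc v hvb
  rw [← hc1, mul_one] at h4
  have h5 : discToHalf Complex.I v = φ' z := hd.right_inv _ (h'.mapsTo z hz)
  simp only [Function.comp_apply, h5, h'.left_inv z hz] at h4
  have h6 := hd.right_inv _ (h.mapsTo z hz)
  rw [← h6, h4, h5]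

/-! ### Inner radii -/

/-- A bound, in terms of `koebeConst`, for the distortion of conformal maps of the half plane on
the set of points of height at least `y` and of modulus at most `N`. -/
def distortionConst (y N : ℝ) : ℝ := koebeConst √(1 - (y / N) ^ 2)

lemma distortionConst_pos (y N : ℝ) : 0 < distortionConst y N := koebeConst_pos _

/-- The squared ratio is `1 - 4 Im z Im w / ‖w - z̄‖²`, with `Im z Im w ≥ y²` and `‖w - z̄‖ ≤ 2N`.
-/
lemma norm_div_sub_conj_le {z w : ℂ} {y N : ℝ} (hy : 0 < y) (hz : y ≤ z.im) (hw : y ≤ w.im)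
    (hzN : ‖z‖ ≤ N) (hwN : ‖w‖ ≤ N) :
    ‖(w - z) / (w - (starRingEnd ℂ) z)‖ ≤ √(1 - (y / N) ^ 2) := by
  have hN : 0 < N := hy.trans_le (hz.trans ((le_abs_self _).trans
    ((Complex.abs_im_le_norm z).trans hzN)))
  have hne := sub_conj_ne_zero (hy.trans_le hw) (hy.le.trans hz)
  have hA := norm_pos_iff.2 hne
  have h1 := normSq_sub_conj w z
  have h2 : ‖w - (starRingEnd ℂ) z‖ ≤ 2 * N := by
    refine (norm_sub_le _ _).trans ?_
    rw [RCLike.norm_conj]; linarith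
  refine Real.le_sqrt_of_sq_le ?_
  rw [norm_div, div_pow, div_le_iff₀ (by positivity), sub_mul, one_mul, div_pow, h1]
  have h3 : y * y ≤ w.im * z.im := mul_le_mul hw hz hy.le (hy.le.trans hw)
  have h4 : ‖w - (starRingEnd ℂ) z‖ ^ 2 ≤ (2 * N) ^ 2 := pow_le_pow_left₀ hA.le h2 2
  rw [h1] at h4
  have h5 : y ^ 2 / N ^ 2 * (‖w - z‖ ^ 2 + 4 * w.im * z.im) ≤ y ^ 2 / N ^ 2 * (2 * N) ^ 2 := by
    gcongr
  have h6 : y ^ 2 / N ^ 2 * (2 * N) ^ 2 = 4 * (y * y) := by field_simp; ring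
  linarith

/-- Take `k` nearest to `h z` outside `Ω` and apply the distortion estimate after moving `z` to the
centre of the disc. -/
lemma ConformalPair.exists_dist_le {h G : ℂ → ℂ} {Ω : Set ℂ} (H : ConformalPair h G halfPlane Ω)
    (hne : Ωᶜ.Nonempty) {z w : ℂ} {y N : ℝ} (hy : 0 < y) (hz : y ≤ z.im) (hw : y ≤ w.im)
    (hzN : ‖z‖ ≤ N) (hwN : ‖w‖ ≤ N) :
    ∃ k, k ∉ Ω ∧ dist (h w) k ≤ distortionConst y N * infDist (h z) Ωᶜ := by
  have hN : 0 < N := hy.trans_le (hz.trans ((le_abs_self _).trans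
    ((Complex.abs_im_le_norm z).trans hzN)))
  obtain ⟨k, hk, hkd⟩ := (H.open_target.isClosed_compl).exists_infDist_eq_dist hne (h z)
  refine ⟨k, hk, ?_⟩
  have hd := discToHalf_pair (hy.trans_le hz)
  have hF := hd.trans H
  have h0 : (h ∘ discToHalf z) 0 = h z := by simp [discToHalf]
  have hρ : √(1 - (y / N) ^ 2) < 1 := by
    rw [Real.sqrt_lt' one_pos]
    have : 0 < (y / N) ^ 2 := by positivity
    linarith
  have := hF.norm_sub_le_koebeConst (k := k) hk ?_ (norm_div_sub_conj_le hy hz hw hzN hwN) hρ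
  · simp only [Function.comp_apply] at this h0
    rw [h0] at this
    have h1 := hd.right_inv w (hy.trans_le hw)
    rw [h1] at this
    rwa [dist_eq_norm, hkd, dist_eq_norm]
  · rw [h0, ← dist_eq_norm, ← hkd]
    intro x hx
    by_contra hxΩ
    have := infDist_le_dist_of_mem (x := h z) (show x ∈ Ωᶜ from hxΩ)
    rw [mem_ball, dist_comm] at hx
    linarith

/-- If a conformal map to the half plane takes `q` to a point twice as high as the image of `k`,
then `k` is not much closer to `q` than the boundary. -/
lemma ConformalPair.infDist_le_of_two_mul_im_le {φ f : ℂ → ℂ} {D : Set ℂ}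
    (h : ConformalPair φ f D halfPlane) {q k : ℂ} (hk : k ∈ D)
    (him : 2 * (φ k).im ≤ (φ q).im) : infDist q Dᶜ ≤ 3 * dist q k := by
  rcases le_or_gt (infDist q Dᶜ) (dist q k) with hle | hlt
  · linarith [dist_nonneg (x := q) (y := k)]
  have hball : ball q (infDist q Dᶜ) ⊆ D := by
    intro x hx
    by_contra hxD
    have := infDist_le_dist_of_mem (x := q) (show x ∈ Dᶜ from hxD)
    rw [mem_ball, dist_comm] at hx
    linarith
  have hkb : k ∈ ball q (infDist q Dᶜ) := by rwa [mem_ball, dist_comm]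
  have h1 := schwarz_pick_ball (h.diff.mono hball) (fun z hz ↦ h.mapsTo z (hball hz)) hkb
  have hki : 0 < (φ k).im := h.mapsTo k hk
  have h2 := normSq_sub_conj (φ k) (φ q)
  have h3 : (φ q).im - (φ k).im ≤ ‖φ k - φ q‖ := by
    rw [norm_sub_rev]
    simpa using (le_abs_self _).trans (Complex.abs_im_le_norm (φ q - φ k))
  have hpos : 0 < ‖φ k - φ q‖ := by linarith
  -- With `n = ‖φ k - φ q‖`, the height condition gives `Im φ(k) ≤ n` and `Im φ(q) ≤ 2n`, so the
  -- square is at most `n² + 8n²`.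
  have h4 : ‖φ k - (starRingEnd ℂ) (φ q)‖ ≤ 3 * ‖φ k - φ q‖ := by
    refine le_of_sq_le_sq ?_ (by positivity)
    rw [h2, mul_pow]
    have : ((φ q).im - (φ k).im) ^ 2 ≤ ‖φ k - φ q‖ ^ 2 := pow_le_pow_left₀ (by linarith) h3 2
    nlinarith
  have h5 : ‖φ k - φ q‖ * infDist q Dᶜ ≤ ‖φ k - φ q‖ * (3 * dist q k) := by
    refine h1.trans ?_
    rw [← dist_eq_norm, dist_comm k q]
    calc dist q k * ‖φ k - (starRingEnd ℂ) (φ q)‖ ≤ dist q k * (3 * ‖φ k - φ q‖) := by gcongr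
      _ = _ := by ring
  exact le_of_mul_le_mul_left h5 hpos

/-! ### Analytic continuation of the inverse map across the boundary point `1` -/

lemma cayley_inv {w : ℂ} (hw : w + Complex.I ≠ 0) :
    Complex.I * (1 + cayley w) / (1 - cayley w) = w := by
  have h1 : 1 - cayley w = 2 * Complex.I / (w + Complex.I) := by
    unfold cayley; field_simp; ring
  have h2 : 1 + cayley w = 2 * w / (w + Complex.I) := by
    unfold cayley; field_simp; ring
  rw [h1, h2]
  field_simp

lemma norm_cayley_sub_one {w : ℂ} (hw : w + Complex.I ≠ 0) :
    ‖cayley w - 1‖ = 2 / ‖w + Complex.I‖ := by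
  have h1 : cayley w - 1 = -(2 * Complex.I / (w + Complex.I)) := by
    unfold cayley; field_simp; ring
  rw [h1, norm_neg, norm_div]
  simp

lemma tendsto_cayley_cocompact : Tendsto cayley (cocompact ℂ) (𝓝 1) := by
  have h1 : Tendsto (fun z : ℂ ↦ z + Complex.I) (cocompact ℂ) (cocompact ℂ) :=
    (Homeomorph.addRight Complex.I).isClosedEmbedding.tendsto_cocompact
  have h2 : Tendsto (fun z : ℂ ↦ (z + Complex.I)⁻¹) (cocompact ℂ) (𝓝 0) := by
    rw [← Metric.cobounded_eq_cocompact] at h1 ⊢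
    exact tendsto_inv₀_cobounded.comp h1
  have h3 : Tendsto (fun z : ℂ ↦ 1 - 2 * Complex.I * (z + Complex.I)⁻¹) (cocompact ℂ)
      (𝓝 (1 - 2 * Complex.I * 0)) := (h2.const_mul _).const_sub 1
  rw [mul_zero, sub_zero] at h3
  refine h3.congr' ?_
  have hev : ∀ᶠ z : ℂ in cocompact ℂ, z ∉ ({-Complex.I} : Set ℂ) :=
    isCompact_singleton.compl_mem_cocompact
  filter_upwards [hev] with z hz
  have hz' : z + Complex.I ≠ 0 := fun h ↦ hz (eq_neg_of_add_eq_zero_left h)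
  unfold cayley
  field_simp; ring

/-- The radius of the disc around `1` in `HydroPair.exists_analytic_extension`. -/
def extensionRadius (δ c m : ℝ) : ℝ := 1 / (hullRad δ c + m + 1)

lemma extensionRadius_pos {δ c m : ℝ} (hδ : 0 < δ) (hm : 0 ≤ m) : 0 < extensionRadius δ c m := by
  have := hullRad_pos (c := c) hδ
  unfold extensionRadius; positivity

/-- Near `1` the extension is `F ∘ Ψ ∘ K ∘ (Ψ⁻¹ + u)`, where `K` continues `h` around infinity by
reflection. The point `1` corresponds to infinity and is a removable singularity. -/
lemma HydroPair.exists_analytic_extension {h G : ℂ → ℂ} {Ω : Set ℂ} {c c' δ η m : ℝ} {u : ℂ}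
    (H : HydroPair h G Ω c) (hδ : 0 < δ) (hΩ : ∀ z ∈ halfPlane, δ < ‖z‖ → z ∈ Ω) (hc : c ≤ c')
    (hη : 0 < η) (hδη : 2 / η + 1 ≤ δ) (hu : ‖u‖ ≤ m) {F : ℂ → ℂ}
    (hF : AnalyticOnNhd ℂ F (ball 1 η)) :
    ∃ E : ℂ → ℂ, AnalyticOnNhd ℂ E (ball 1 (extensionRadius δ c' m)) ∧
      ∀ w, 0 < w.im → 0 < (w + u).im → cayley w ∈ ball 1 (extensionRadius δ c' m) →
        cayley (h (w + u)) ∈ ball 1 η ∧ E (cayley w) = F (cayley (h (w + u))) := by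
  set ρ := hullRad δ c' with hρdef
  have hρ : 0 < ρ := hullRad_pos hδ
  have hρc : hullRad δ c ≤ ρ := by
    simp only [hρdef, hullRad]
    have := Real.sqrt_le_sqrt hc
    linarith
  set η₁ := extensionRadius δ c' m with hη₁def
  have hm : 0 ≤ m := (norm_nonneg u).trans hu
  have hη₁ : 0 < η₁ := extensionRadius_pos hδ hm
  have hη₁' : η₁ * (ρ + m + 1) = 1 := by
    rw [hη₁def, extensionRadius, ← hρdef]
    have : ρ + m + 1 ≠ 0 := by positivity
    field_simp
  have hη₁1 : η₁ ≤ 1 := by nlinarith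
  obtain ⟨K, hKd, hKh, hKn, hKt⟩ := H.exists_extension hδ hΩ
  set W : ℂ → ℂ := fun v ↦ Complex.I * (1 + v) / (1 - v) + u with hW
  -- The radius `1 / (ρ + m + 1)` makes `|Ψ⁻¹ v| ≥ ρ + m + 1`, using `|1 + v| ≥ 1`; the shift by `u`
  -- costs at most `m`.
  have hWn : ∀ v ∈ ball (1 : ℂ) η₁, v ≠ 1 → hullRad δ c < ‖W v‖ := by
    intro v hv hv1
    rw [mem_ball, dist_eq_norm, norm_sub_rev] at hv
    have h0 : 0 < ‖1 - v‖ := norm_pos_iff.2 (sub_ne_zero.2 hv1.symm)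
    have h1 : 1 ≤ ‖1 + v‖ := by
      have h2 : (2 : ℂ) = (1 + v) + (1 - v) := by ring
      have h3 := norm_add_le (1 + v) (1 - v)
      rw [← h2] at h3
      simp only [Complex.norm_ofNat] at h3
      linarith
    have h4 : ρ + m + 1 ≤ ‖Complex.I * (1 + v) / (1 - v)‖ := by
      rw [norm_div, norm_mul, Complex.norm_I, one_mul, le_div_iff₀ h0]
      have : (ρ + m + 1) * ‖1 - v‖ ≤ (ρ + m + 1) * η₁ := by gcongr
      linarith
    have h5 : ‖Complex.I * (1 + v) / (1 - v)‖ ≤ ‖W v‖ + ‖u‖ := by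
      have : Complex.I * (1 + v) / (1 - v) = W v - u := by simp [hW]
      rw [this]; exact _root_.norm_sub_le _ _
    linarith
  have hδ1 : 1 ≤ δ := by
    have : 0 < 2 / η := by positivity
    linarith
  -- `‖z + i‖ ≥ 2δ - 1 > 2 / η`, while `‖Ψ(z) - 1‖ = 2 / ‖z + i‖`.
  have hnorm : ∀ z : ℂ, 2 * δ ≤ ‖z‖ → z + Complex.I ≠ 0 ∧ cayley z ∈ ball 1 η := by
    intro z hz
    have h1 : 2 / η < ‖z + Complex.I‖ := by
      have h2 : ‖z‖ ≤ ‖z + Complex.I‖ + ‖Complex.I‖ := by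
        have := _root_.norm_sub_le (z + Complex.I) Complex.I
        rwa [add_sub_cancel_right] at this
      rw [Complex.norm_I] at h2
      linarith
    have h2 : 0 < ‖z + Complex.I‖ := lt_trans (by positivity) h1
    have h3 := norm_pos_iff.1 h2
    refine ⟨h3, ?_⟩
    rw [mem_ball, dist_eq_norm, norm_cayley_sub_one h3, div_lt_iff₀ h2]
    rw [div_lt_iff₀ hη] at h1
    linarith
  set E₀ : ℂ → ℂ := fun v ↦ F (cayley (K (W v))) with hE₀
  have hWd : ∀ v ≠ 1, DifferentiableAt ℂ W v := by
    intro v hv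
    have : 1 - v ≠ 0 := sub_ne_zero.2 hv.symm
    simp only [hW]
    exact ((((differentiableAt_id.const_add 1).const_mul Complex.I)).div
      (differentiableAt_id.const_sub 1) this).add_const u
  have hKO : IsOpen {w : ℂ | hullRad δ c < ‖w‖} := isOpen_lt continuous_const continuous_norm
  have hE₀d : ∀ v ∈ ball (1 : ℂ) η₁, v ≠ 1 → DifferentiableAt ℂ E₀ v := by
    intro v hv hv1
    have h1 := hWn v hv hv1
    obtain ⟨h2, h3⟩ := hnorm _ (hKn _ h1)
    have h4 : DifferentiableAt ℂ K (W v) := hKd.differentiableAt (hKO.mem_nhds h1)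
    have h5 : DifferentiableAt ℂ cayley (K (W v)) := by
      unfold cayley
      exact (differentiableAt_id.sub_const _).div (differentiableAt_id.add_const _) h2
    have h6 : DifferentiableAt ℂ (fun v ↦ K (W v)) v := h4.comp v (hWd v hv1)
    have h7 : DifferentiableAt ℂ (fun v ↦ cayley (K (W v))) v :=
      DifferentiableAt.comp (g := cayley) v h5 h6
    exact DifferentiableAt.comp (g := F) v (hF _ h3).differentiableAt h7
  have hE₀t : Tendsto E₀ (𝓝[≠] 1) (𝓝 (F 1)) := by
    have h1 : Tendsto (fun v : ℂ ↦ 1 - v) (𝓝[≠] 1) (𝓝[≠] 0) := by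
      refine tendsto_nhdsWithin_iff.2 ⟨?_, ?_⟩
      · have : Continuous fun v : ℂ ↦ 1 - v := by fun_prop
        have h2 := (this.tendsto 1).mono_left (nhdsWithin_le_nhds (s := {1}ᶜ))
        simpa using h2
      · filter_upwards [self_mem_nhdsWithin] with v hv using sub_ne_zero.2 (Ne.symm hv)
    have h2 : Tendsto W (𝓝[≠] 1) (cocompact ℂ) := by
      have h3 : Tendsto (fun v : ℂ ↦ 2 * Complex.I * (1 - v)⁻¹) (𝓝[≠] 1) (cocompact ℂ) := by
        have h4 := tendsto_inv₀_nhdsNE_zero.comp h1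
        rw [Metric.cobounded_eq_cocompact] at h4
        exact ((Homeomorph.mulLeft₀ (2 * Complex.I)
          (by simp)).isClosedEmbedding.tendsto_cocompact).comp h4
      have h5 : Tendsto (fun z : ℂ ↦ z + (u - Complex.I)) (cocompact ℂ) (cocompact ℂ) :=
        (Homeomorph.addRight (u - Complex.I)).isClosedEmbedding.tendsto_cocompact
      refine (h5.comp h3).congr' ?_
      filter_upwards [self_mem_nhdsWithin] with v hv
      have : 1 - v ≠ 0 := sub_ne_zero.2 (Ne.symm hv)
      simp only [hW, Function.comp_apply]
      field_simp; ring
    exact (hF 1 (mem_ball_self hη)).continuousAt.tendsto.comp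
      (tendsto_cayley_cocompact.comp (hKt.comp h2))
  have hone : ball (1 : ℂ) η₁ ∈ 𝓝 (1 : ℂ) := ball_mem_nhds _ hη₁
  refine ⟨Function.update E₀ 1 (F 1), ?_, ?_⟩
  · refine DifferentiableOn.analyticOnNhd ?_ isOpen_ball
    refine (Complex.differentiableOn_compl_singleton_and_continuousAt_iff hone).1 ⟨?_, ?_⟩
    · intro v hv
      refine (DifferentiableAt.congr_of_eventuallyEq (hE₀d v hv.1 hv.2) ?_).differentiableWithinAt
      filter_upwards [isOpen_ne.mem_nhds hv.2] with x hx using Function.update_of_ne hx _ _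
    · exact continuousAt_update_same.2 hE₀t
  · intro w hw hwu hv
    have hwI : w + Complex.I ≠ 0 := by
      intro h0
      have := congrArg Complex.im h0
      simp at this; linarith
    have hv1 : cayley w ≠ 1 := by
      intro h0
      have := norm_cayley_sub_one hwI
      rw [h0, sub_self, norm_zero] at this
      have h1 : 0 < 2 / ‖w + Complex.I‖ := by
        have := norm_pos_iff.2 hwI
        positivity
      linarith
    have hWw : W (cayley w) = w + u := by rw [hW]; simp only [cayley_inv hwI]
    have h1 := hWn _ hv hv1
    have h2 := hKn _ h1
    rw [hWw] at h1 h2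
    rw [hKh _ hwu h1] at h2
    refine ⟨(hnorm _ h2).2, ?_⟩
    rw [Function.update_of_ne hv1]
    simp only [hE₀, hWw]
    rw [hKh _ hwu h1]

/-! ### Slit domains along a Loewner chain -/

lemma IsSimpleCurve.tendsto_nhdsGT {D : Set ℂ} {a b : Filter ℂ} {S : EReal} {γ : ℝ → ℂ}
    (hγ : IsSimpleCurve D a b S γ) {s : ℝ} (hs : 0 < s) (hsS : (s : EReal) < S) :
    Tendsto γ (𝓝[>] s) (𝓝[slitDomain D γ s] (γ s)) := by
  obtain ⟨x, hsx, hxS⟩ := EReal.lt_iff_exists_real_btwn.1 hsS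
  have hsx' : s < x := EReal.coe_lt_coe_iff.1 hsx
  have hsub : ∀ v : ℝ, 0 < v → v < x → 0 < v ∧ (v : EReal) < S := fun v h0 hv ↦
    ⟨h0, (EReal.coe_lt_coe_iff.2 hv).trans hxS⟩
  have hc : ContinuousAt γ s := (hγ.continuousOn.mono fun v (hv : v ∈ Ioo 0 x) ↦
    hsub v hv.1 hv.2).continuousAt (Ioo_mem_nhds hs hsx')
  refine tendsto_nhdsWithin_iff.2 ⟨hc.tendsto.mono_left nhdsWithin_le_nhds, ?_⟩
  filter_upwards [Ioo_mem_nhdsGT hsx'] with u hu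
  have hu' := hsub u (hs.trans hu.1) hu.2
  refine ⟨hγ.mapsTo hu', ?_⟩
  rintro ⟨v, hv, hve⟩
  have := hγ.injOn (hsub v hv.1 (hv.2.trans_lt hsx')) hu' hve
  linarith [hv.2, hu.1]

/-- The driving value is a limit at the tip of the slit; composed with the curve continued past time
`s`, it becomes the right-hand limit that the flow estimates use. -/
lemma IsLoewnerChain.loewnerFlow {D : Set ℂ} {a b : Filter ℂ} {φ : ℂ → ℂ} {S : EReal} {γ : ℝ → ℂ}
    {g : ℝ → ℂ → ℂ} {U : ℝ → ℝ} (hL : IsLoewnerChain D a φ S γ g U) (hφ : IsChordalMap D a b φ)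
    (hγ : IsSimpleCurve D a b S γ) {τ : ℝ} (hτ : (τ : EReal) < S) :
    LoewnerFlow (φ ∘ γ) τ g U := by
  have hlt : ∀ v : ℝ, v < τ → (v : EReal) < S := fun v hv ↦ (EReal.coe_lt_coe_iff.2 hv).trans hτ
  have hsub : Ioo 0 τ ⊆ {t : ℝ | 0 < t ∧ (t : EReal) < S} := fun v hv ↦ ⟨hv.1, hlt v hv.2⟩
  refine ⟨?_, ?_, ?_, hφ.2.1.comp hγ.tendsto_start, fun t ht ↦ hL.mappingOut t ht.1 (hlt t ht.2),
    fun t ht ↦ hL.hcap t ht.1 (hlt t ht.2), fun s hs ↦ ?_⟩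
  · exact hφ.1.1.continuousOn.comp (hγ.continuousOn.mono hsub) (hγ.mapsTo.mono_left hsub)
  · exact hφ.1.2.injOn.comp (hγ.injOn.mono hsub) (hγ.mapsTo.mono_left hsub)
  · exact fun t ht ↦ hφ.1.2.mapsTo (hγ.mapsTo (hsub ht))
  · have hd := hL.driving s hs.1 (hlt s hs.2)
    rcases hs.1.eq_or_lt with rfl | h0
    · rw [tip, if_pos rfl] at hd
      exact hd.comp hγ.tendsto_start
    · rw [tip, if_neg h0.ne'] at hd
      exact hd.comp (hγ.tendsto_nhdsGT h0 (hlt s hs.2))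

namespace LoewnerFlow
variable {D : Set ℂ} {φ f : ℂ → ℂ} {γ : ℝ → ℂ} {τ : ℝ} {g : ℝ → ℂ → ℂ} {U : ℝ → ℝ} {t : ℝ}

lemma slitDomain_eq (h : ConformalPair φ f D halfPlane) (hγD : ∀ s ∈ Ioo 0 τ, γ s ∈ D)
    (ht : t < τ) : slitDomain D γ t = D ∩ φ ⁻¹' dom (φ ∘ γ) t := by
  ext z
  constructor
  · rintro ⟨hz, hzn⟩
    refine ⟨hz, h.mapsTo z hz, ?_⟩
    rintro ⟨v, hv, hve⟩
    exact hzn ⟨v, hv, h.injOn (hγD v ⟨hv.1, hv.2.trans_lt ht⟩) hz hve⟩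
  · rintro ⟨hz, -, hzn⟩
    refine ⟨hz, ?_⟩
    rintro ⟨v, hv, rfl⟩
    exact hzn ⟨v, hv, rfl⟩

lemma slitPair (L : LoewnerFlow (φ ∘ γ) τ g U) (h : ConformalPair φ f D halfPlane)
    (hγD : ∀ s ∈ Ioo 0 τ, γ s ∈ D) (ht : t ∈ Ico 0 τ) :
    ConformalPair (g t ∘ φ) (f ∘ inv (φ ∘ γ) g t) (slitDomain D γ t) halfPlane := by
  have he := slitDomain_eq h hγD ht.2
  have ho : IsOpen (slitDomain D γ t) := by
    rw [he]
    exact h.diff.continuousOn.isOpen_inter_preimage h.open_source (L.isOpen_dom ht)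
  have h1 := h.restrict ho sdiff_subset
  have h2 : φ '' slitDomain D γ t = dom (φ ∘ γ) t := by
    rw [he]
    refine Subset.antisymm (image_subset_iff.2 fun z hz ↦ hz.2) fun w hw ↦ ?_
    exact ⟨f w, ⟨h.mapsTo_symm w hw.1, by rwa [mem_preimage, h.right_inv w hw.1]⟩,
      h.right_inv w hw.1⟩
  rw [h2] at h1
  exact h1.trans (L.pair ht)

lemma map_inv_infH (L : LoewnerFlow (φ ∘ γ) τ g U) (ht : t ∈ Ico 0 τ) :
    map (inv (φ ∘ γ) g t) infH = infH := by
  refine (L.pair ht).symm.map_eq (L.dom_mem_infH ht)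
    ((L.pair ht).symm.tendsto_infH sdiff_subset (L.dom_mem_infH ht) (L.tendsto_sub ht)) ?_
  refine tendsto_infH_infH_of_sub (L.tendsto_sub ht) ?_
  filter_upwards [L.dom_mem_infH ht] with z hz using (L.pair ht).mapsTo z hz

/-- The tip of the slit is the prime end that corresponds to the driving function. -/
lemma map_nhdsWithin_eq_tip (L : LoewnerFlow (φ ∘ γ) τ g U) (h : ConformalPair φ f D halfPlane)
    (hb : Bornology.IsBounded D) (hγ : ContinuousOn γ (Ioo 0 τ)) (hi : InjOn γ (Ioo 0 τ))
    (hγD : ∀ s ∈ Ioo 0 τ, γ s ∈ D) (ht : t ∈ Ioo 0 τ)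
    (hU : Tendsto (g t ∘ φ) (𝓝[slitDomain D γ t] (γ t)) (𝓝 (U t : ℂ))) :
    map (f ∘ inv (φ ∘ γ) g t) (𝓝[halfPlane] (U t : ℂ)) = 𝓝[slitDomain D γ t] (γ t) := by
  have ht' : t ∈ Ico 0 τ := ⟨ht.1.le, ht.2⟩
  have hp := (L.slitPair h hγD ht').symm
  have htr : ConformalPair (fun z : ℂ ↦ z + U t) (fun z ↦ z - U t) halfPlane halfPlane := by
    refine ⟨isOpen_halfPlane, isOpen_halfPlane, by fun_prop, by fun_prop, ?_, ?_, ?_, ?_⟩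
    · intro z hz; simpa [halfPlane] using hz
    · intro z hz; simpa [halfPlane] using hz
    · intro z _; simp
    · intro z _; simp
  have hG : Tendsto ((fun z : ℂ ↦ z - U t) ∘ (g t ∘ φ)) (𝓝[slitDomain D γ t] (γ t)) (𝓝 0) := by
    have := hU.sub_const (U t : ℂ)
    rwa [sub_self] at this
  -- In the half plane the earlier part of the curve together with `0` is compact and misses `φ (γ
  -- t)`; continuity of `φ` carries the gap back to `D`.
  have hstart : ∀ s ∈ Ioo 0 t, ∃ ε > 0, ∀ u ∈ Ioc 0 s, ε ≤ dist (γ u) (γ t) := by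
    intro s hs
    have hK := (L.isCompact_insert ⟨hs.1.le, hs.2.trans ht.2⟩).isClosed
    have hn : φ (γ t) ∉ insert 0 ((φ ∘ γ) '' Ioc 0 s) := by
      have := L.curve_mem_dom hs.1.le hs.2 ht.2
      rw [dom_eq] at this
      exact this.2
    have hc : ContinuousAt φ (γ t) :=
      (h.diff.differentiableAt (h.open_source.mem_nhds (hγD t ht))).continuousAt
    obtain ⟨ε, hε, hεb⟩ := Metric.mem_nhds_iff.1 (hc (hK.isOpen_compl.mem_nhds hn))
    refine ⟨ε, hε, fun u hu ↦ ?_⟩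
    by_contra! hlt
    exact hεb hlt (Or.inr ⟨u, hu, rfl⟩)
  have hmain := tendsto_slit_tip h.open_source hb ht.1 ht.2 hγ hi hγD hstart (htr.trans hp) hG
  refine hp.map_eq self_mem_nhdsWithin ?_ ?_
  · refine tendsto_nhdsWithin_iff.2 ⟨?_, ?_⟩
    · have h1 : Tendsto (fun z : ℂ ↦ z - U t) (𝓝[halfPlane] (U t : ℂ)) (𝓝[halfPlane] 0) := by
        refine tendsto_nhdsWithin_iff.2 ⟨?_, ?_⟩
        · have hc : Continuous fun z : ℂ ↦ z - U t := by fun_prop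
          have h2 := (hc.tendsto (U t : ℂ)).mono_left (nhdsWithin_le_nhds (s := halfPlane))
          simpa using h2
        · filter_upwards [self_mem_nhdsWithin] with z hz using htr.mapsTo_symm z hz
      refine (hmain.comp h1).congr fun z ↦ ?_
      simp
    · filter_upwards [self_mem_nhdsWithin] with z hz using hp.mapsTo z hz
  · refine tendsto_nhdsWithin_iff.2 ⟨hU, ?_⟩
    filter_upwards [self_mem_nhdsWithin] with z hz using hp.mapsTo_symm z hz

lemma norm_le_of_mem (L : LoewnerFlow (φ ∘ γ) τ g U) {m : ℝ} (ht : t ∈ Ico 0 τ)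
    (hU : ∀ s ∈ Icc 0 t, |U s| < m) {s : ℝ} (hs : s ∈ Ioc 0 t) :
    ‖φ (γ s)‖ ≤ m + √(8 * t) :=
  (L.norm_le ⟨hs.1, hs.2.trans_lt ht.2⟩ fun s' h' ↦ hU s' ⟨h'.1, h'.2.trans hs.2⟩).trans
    (add_le_add_right (Real.sqrt_le_sqrt (by linarith [hs.2])) m)

/-- A lower bound for the inner radius of the slit domain. -/
lemma le_infDist (L : LoewnerFlow (φ ∘ γ) τ g U) (h : ConformalPair φ f D halfPlane)
    (hγD : ∀ s ∈ Ioo 0 τ, γ s ∈ D) (hb : Dᶜ.Nonempty) (ht : t ∈ Ico 0 τ) {m B T r : ℝ}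
    (htT : t ≤ T) (hU : ∀ s ∈ Icc 0 t, |U s| < m) (hB : ∀ s ∈ Ioc 0 t, ‖φ (γ s)‖ ≤ B)
    (hB0 : 0 ≤ B) (hr : r ≤ infDist (f Complex.I) Dᶜ) :
    r / (3 * distortionConst 1 (m + (2 * B + 2) + 2 * T) ^ 2) ≤
      infDist (f (inv (φ ∘ γ) g t (U t + Complex.I))) (slitDomain D γ t)ᶜ := by
  set Y := 2 * B + 2 with hY
  -- The points `U + i`, `U + iY`, `z₁` and `i` all have height at least `1` and modulus at most
  -- `N`; `2T` bounds the displacement `2t / Y`.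
  set N := m + Y + 2 * T with hN
  set C := distortionConst 1 N with hC
  have hC0 : 0 < C := distortionConst_pos _ _
  have hT0 : 0 ≤ T := ht.1.trans htT
  have hUt := hU t ⟨ht.1, le_rfl⟩
  have hY1 : 1 ≤ Y := by linarith
  have hp := (L.slitPair h hγD ht).symm
  have hcompl : (slitDomain D γ t)ᶜ.Nonempty := hb.mono (compl_subset_compl.2 sdiff_subset)
  set wY : ℂ := U t + Y * Complex.I with hwY
  have hwYim : wY.im = Y := by simp [hwY]
  have hwYn : ‖wY‖ ≤ m + Y := by
    refine (norm_add_le _ _).trans (add_le_add ?_ ?_)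
    · rw [Complex.norm_real]; exact hUt.le
    · rw [norm_mul, Complex.norm_I, mul_one, Complex.norm_real, Real.norm_of_nonneg (by linarith)]
  have hwn : ‖(U t + Complex.I : ℂ)‖ ≤ N := by
    refine (norm_add_le _ _).trans ?_
    rw [Complex.norm_real, Complex.norm_I, Real.norm_eq_abs]
    linarith
  have hwYH : 0 < wY.im := by linarith
  set z₁ := inv (φ ∘ γ) g t wY with hz₁
  have hz₁im : Y ≤ z₁.im := by
    have := (L.hydro ht).im_le hwYH
    rwa [hwYim] at this
  have hz₁n : ‖z₁‖ ≤ N := by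
    have h1 := (L.hydro ht).norm_sub_le_div hwYH
    have h2 : 2 * t / wY.im ≤ 2 * T := by
      rw [hwYim, div_le_iff₀ (by linarith)]
      nlinarith
    have h3 : ‖z₁‖ ≤ ‖z₁ - wY‖ + ‖wY‖ := by
      simpa using norm_add_le (z₁ - wY) wY
    linarith
  have hz₁H : z₁ ∈ halfPlane := show 0 < z₁.im by linarith
  obtain ⟨k, hk, hkd⟩ := hp.exists_dist_le hcompl (z := U t + Complex.I) (w := wY) (y := 1) (N := N)
    one_pos (by simp) (by linarith) hwn (by linarith)
  obtain ⟨k', hk', hkd'⟩ := h.symm.exists_dist_le hb (z := z₁) (w := Complex.I) (y := 1) (N := N)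
    one_pos (by linarith) (by simp) hz₁n (by rw [Complex.norm_I]; linarith [abs_nonneg (U t)])
  have h1 : r ≤ C * infDist (f z₁) Dᶜ := by
    refine (hr.trans (infDist_le_dist_of_mem (y := k') hk')).trans hkd'
  -- Either `k` is outside `D`, or it is on the slit, where `φ k` has height at most `B` while `Im
  -- z₁ ≥ Y > 2B`.
  have h2 : infDist (f z₁) Dᶜ ≤ 3 * dist (f z₁) k := by
    by_cases hkD : k ∈ D
    · have : k ∈ γ '' Ioc 0 t := by
        by_contra hkn
        exact hk ⟨hkD, hkn⟩
      obtain ⟨s, hs, rfl⟩ := this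
      refine h.infDist_le_of_two_mul_im_le hkD ?_
      rw [h.right_inv _ hz₁H]
      have h3 := (le_abs_self _).trans ((Complex.abs_im_le_norm _).trans (hB s hs))
      linarith
    · have := infDist_le_dist_of_mem (x := f z₁) (show k ∈ Dᶜ from hkD)
      linarith [dist_nonneg (x := f z₁) (y := k)]
  simp only [Function.comp_apply] at hkd
  rw [div_le_iff₀ (by positivity)]
  calc r ≤ C * (3 * dist (f z₁) k) := h1.trans (by gcongr)
    _ ≤ C * (3 * (C * infDist (f (inv (φ ∘ γ) g t (U t + Complex.I))) (slitDomain D γ t)ᶜ)) := by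
      gcongr
    _ = _ := by ring

end LoewnerFlow

/-! ### Choice of constants and verification of the class conditions. -/

lemma isSimplyConnected_halfPlane : IsSimplyConnected halfPlane := by
  have hc : Convex ℝ halfPlane := convex_halfSpace_im_gt 0
  have : ContractibleSpace halfPlane := hc.contractibleSpace ⟨Complex.I, by simp [halfPlane]⟩
  exact (inferInstance : SimplyConnectedSpace halfPlane)

lemma exists_lt_of_lt_exitTime {T ε : ℝ} {S : EReal} {U : ℝ → ℝ} {t : ℝ} (ht : 0 ≤ t)
    (h : t < exitTime T ε S U) :
    ∃ τ, t < τ ∧ τ ≤ T ∧ (τ : EReal) < S ∧ ∀ s ∈ Icc 0 τ, |U s| < 1 / ε := by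
  have hne : {t : ℝ | 0 ≤ t ∧ t ≤ T ∧ (t : EReal) < S ∧ ∀ s ∈ Icc 0 t, |U s| < 1 / ε}.Nonempty := by
    -- The supremum of the empty set is `0` by convention, which `0 ≤ t < exitTime` rules out.
    by_contra hemp
    rw [Set.not_nonempty_iff_eq_empty] at hemp
    rw [exitTime, hemp, Real.sSup_empty] at h
    linarith
  obtain ⟨τ, hτ, hlt⟩ := exists_lt_of_lt_csSup hne h
  exact ⟨τ, hlt, hτ.2⟩

end

theorem mainTheorem10 (r R η : ℝ) (hr : 0 < r) (hR : 0 < R) (hη : 0 < η)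
    (T ε : ℝ) (hT : 1 < T) (hε : 0 < ε) :
    ∃ r₁ η₁ : ℝ, 0 < r₁ ∧ 0 < η₁ ∧
      ∀ (D : Set ℂ) (a b : Filter ℂ) (p : ℂ), (D, a, b, p) ∈ quadClass r R η →
      ∀ φ : ℂ → ℂ, IsChordalMap D a b φ → φ p = Complex.I →
      ∀ (S : EReal) (γ : ℝ → ℂ), IsSimpleCurve D a b S γ →
      ∀ (g : ℝ → ℂ → ℂ) (U : ℝ → ℝ), IsLoewnerChain D a φ S γ g U →
      ∀ t : ℝ, 0 ≤ t → t < exitTime T ε S U →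
        (slitDomain D γ t, tip D a γ t, b, refPoint D φ γ g U t) ∈ quadClass r₁ R η₁ := by
  set m := 1 / ε with hm
  have hm0 : 0 < m := by positivity
  set B := m + √(8 * T) with hB
  have hB0 : 0 ≤ B := by positivity
  -- The hull must lie in the disc of radius `δ`, and `h` must send large points to where `Ψ` is
  -- within `η` of `1`.
  set δ := max B (2 / η + 1) with hδdef
  have hδ : 0 < δ := lt_max_of_lt_right (by positivity)
  set C := distortionConst 1 (m + (2 * B + 2) + 2 * T) with hC
  have hC0 : 0 < C := distortionConst_pos _ _
  refine ⟨r / (3 * C ^ 2), extensionRadius δ (2 * T) m, by positivity,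
    extensionRadius_pos hδ hm0.le, ?_⟩
  rintro D a b p ⟨hDo, -, ha, hb, -, hpD, hrp, hDR, φ', hφ', hφ'p, F, hF, hFφ⟩ φ hφ hφp S γ hγ g U
    hL t ht htex
  obtain ⟨τ, htτ, hτT, hτS, hUτ⟩ := exists_lt_of_lt_exitTime ht htex
  have htI : t ∈ Ico 0 τ := ⟨ht, htτ⟩
  have hU : ∀ s ∈ Icc 0 t, |U s| < m := fun s hs ↦ hUτ s ⟨hs.1, hs.2.trans htτ.le⟩
  have htT : t ≤ T := htτ.le.trans hτT
  have hsub : Ioo 0 τ ⊆ {t : ℝ | 0 < t ∧ (t : EReal) < S} := fun v hv ↦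
    ⟨hv.1, (EReal.coe_lt_coe_iff.2 hv.2).trans hτS⟩
  have hγD : ∀ s ∈ Ioo 0 τ, γ s ∈ D := fun s hs ↦ hγ.mapsTo (hsub hs)
  have L := hL.loewnerFlow hφ hγ hτS
  have h := hφ.1.pair hDo
  set f := Function.invFunOn φ D with hf
  have hp := L.slitPair h hγD htI
  have hbdd : Bornology.IsBounded D := isBounded_ball.subset hDR
  have hDc : Dᶜ.Nonempty := by
    by_contra hne
    rw [Set.not_nonempty_iff_eq_empty, compl_empty_iff] at hne
    have : ((R : ℝ) : ℂ) ∈ ball (0 : ℂ) R := hDR (hne ▸ mem_univ _)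
    simp [abs_of_pos hR] at this
  have hUH : (U t + Complex.I : ℂ) ∈ halfPlane := by simp [halfPlane]
  have hdrive := hL.driving t ht ((EReal.coe_lt_coe_iff.2 htτ).trans hτS)
  have hbmap : map (f ∘ LoewnerFlow.inv (φ ∘ γ) g t) infH = b := by
    rw [← map_map, L.map_inv_infH htI, ← hb.eq_map_infH h hφ.2.2]
  have hbt : IsPrimeEnd (slitDomain D γ t) b := hbmap ▸ hp.symm.isPrimeEnd_map_infH
  have htip : IsPrimeEnd (slitDomain D γ t) (tip D a γ t) := by
    rcases ht.eq_or_lt with rfl | h0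
    · simpa [tip, slitDomain] using ha
    · rw [tip, if_neg h0.ne'] at hdrive ⊢
      rw [← L.map_nhdsWithin_eq_tip h hbdd (hγ.continuousOn.mono hsub) (hγ.injOn.mono hsub) hγD
        ⟨h0, htτ⟩ hdrive]
      exact hp.symm.isPrimeEnd_map_nhdsWithin (U t)
  have hdb : Tendsto (g t ∘ φ) b (cocompact ℂ) := by
    rw [← hbmap, tendsto_map'_iff]
    have h1 : Tendsto (fun z : ℂ ↦ z) infH (cocompact ℂ) := inf_le_left
    refine h1.congr' ?_
    filter_upwards [halfPlane_mem_infH] with z hz using (hp.right_inv z hz).symm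
  have hqmem : refPoint D φ γ g U t ∈ slitDomain D γ t := hp.bijOn.2.surjOn.mapsTo_invFunOn hUH
  have hqval : (g t ∘ φ) (refPoint D φ γ g U t) = U t + Complex.I :=
    hp.bijOn.2.surjOn.rightInvOn_invFunOn hUH
  have hq : refPoint D φ γ g U t = f (LoewnerFlow.inv (φ ∘ γ) g t (U t + Complex.I)) := by
    rw [← hqval]; exact (hp.left_inv _ hqmem).symm
  have hκB : ∀ s ∈ Ioc 0 t, ‖φ (γ s)‖ ≤ B := fun s hs ↦
    (L.norm_le_of_mem htI hU hs).trans
      (add_le_add_right (Real.sqrt_le_sqrt (by linarith)) m)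
  have hsc : IsSimplyConnected (slitDomain D γ t) := hp.isSimplyConnected isSimplyConnected_halfPlane
  have hfp : f Complex.I = p := by rw [← hφp, h.left_inv p hpD]
  refine ⟨hp.open_source, hsc, htip, hbt, ?_, hqmem, ?_, sdiff_subset.trans hDR,
    fun z ↦ g t (φ z) - U t, ⟨⟨hp.diff.sub_const _, ?_⟩, ?_, ?_⟩, ?_, ?_⟩
  -- Along the tip `g t ∘ φ` has the finite limit `U t`, along `b` it tends to infinity.
  · intro hab
    rw [hab] at hdrive
    have := hbt.neBot
    exact hdb.not_tendsto (disjoint_nhds_cocompact _).symm hdrive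
  · rw [innerRadius, hq]
    exact L.le_infDist h hγD hDc htI htT hU hκB hB0 (by rw [hfp]; exact hrp)
  · refine ⟨fun z hz ↦ ?_, fun z hz w hw hzw ↦ ?_, fun w hw ↦ ?_⟩
    · simpa [halfPlane] using hp.mapsTo z hz
    · exact hp.injOn hz hw (sub_left_injective hzw)
    · have hw' : w + U t ∈ halfPlane := by simpa [halfPlane] using hw
      obtain ⟨z, hz, hzw⟩ := hp.bijOn.2.surjOn hw'
      refine ⟨z, hz, ?_⟩
      have hzw' : g t (φ z) = w + U t := hzw
      simp [hzw']
  · have := hdrive.sub_const (U t : ℂ)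
    rwa [sub_self] at this
  · exact (Homeomorph.subRight (U t : ℂ)).isClosedEmbedding.tendsto_cocompact.comp hdb
  · have hq' : g t (φ (refPoint D φ γ g U t)) = U t + Complex.I := hqval
    simp [hq']
  · have hΩ : ∀ z ∈ halfPlane, δ < ‖z‖ → z ∈ LoewnerFlow.dom (φ ∘ γ) t := by
      refine fun z hz hzn ↦ ⟨hz, ?_⟩
      rintro ⟨s, hs, rfl⟩
      exact ((le_max_left _ _).trans_lt hzn).not_ge (hκB s hs)
    obtain ⟨E, hE, hEw⟩ := (L.hydro htI).exists_analytic_extension hδ hΩ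
      (show 2 * t ≤ 2 * T by linarith) hη (le_max_right _ _) (u := U t) (m := m)
      (by rw [Complex.norm_real]; exact (hU t ⟨ht, le_rfl⟩).le) hF
    refine ⟨E, hE, fun z hz hzb ↦ ?_⟩
    have hgz : 0 < (g t (φ z)).im := hp.mapsTo z hz
    obtain ⟨h1, h2⟩ := hEw (g t (φ z) - U t) (by simpa using hgz) (by simpa using hgz) hzb
    have hzd : φ z ∈ LoewnerFlow.dom (φ ∘ γ) t := by
      rw [LoewnerFlow.slitDomain_eq h hγD htτ] at hz
      exact hz.2
    rw [sub_add_cancel, (L.pair htI).left_inv _ hzd] at h1 h2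
    -- The extension `F` was given for the chordal map `φ'` of the class, which agrees with `φ` on
    -- `D` by uniqueness.
    have heq := eqOn_of_isChordalMap hb h (hφ'.1.pair hDo) hφ.2.2 hφ'.2.2 hpD hφp hφ'p hz.1
    rw [heq] at h1
    refine h2.trans ?_
    rw [heq]
    exact hFφ z hz.1 h1
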